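/- Let $\mathbb T^2=\mathbb R/\mathbb Z\times\mathbb R/\mathbb Z$ with normalized Lebesgue measure $\mu$, let $\mathrm{Diff}^\infty(\mathbb T^2,\mu)$ be the group of $C^\infty$ diffeomorphisms of $\mathbb T^2$ preserving $\mu$, let $S_\alpha(x_1,x_2)=(x_1+\alpha,x_2)$, and let $\mathcal A_\alpha(\mathbb T^2)$ be the closure in $\mathrm{Diff}^\infty(\mathbb T^2,\mu)$, in the $C^\infty$ topology, of $\{h\circ S_\alpha\circ h^{-1}: h\in \mathrm{Diff}^\infty(\mathbb T^2,\mu)\}$. Theorem A. For every natural number $r$ and every Liouville number $\alpha$ there is a diffeomorphism $T\in\mathcal A_\alpha(\mathbb T^2)$ such that: (1) $T$ is minimal, i.e. every forward orbit $\{T^n x: n\ge 0\}$ is dense in $\mathbb T^2$; (2) $\mu$ is a generic measure for $T$, i.e. there is a point $x$ with $\frac1N\sum_{i=0}^{N-1}\varphi(T^ix)\to\int\varphi\,d\mu$ for every continuous $\varphi:\mathbb T^2\to\mathbb R$, but $\mu$ is not ergodic for $T$; (3) there are pairwise disjoint Borel sets $E_1,\dots,E_r\subset\mathbb T^2$ of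 positive Lebesgue measure, with $\mu(E_t)=1/r$ for all $t$ if $r\ge 2$ (so that then $\mu=\frac1r\sum_t\mu_t$), such that $T$ preserves, and is weakly mixing with respect to, each of the $r$ probability measures $\mu_t(A)=\mu(A\cap E_t)/\mu(E_t)$, which are absolutely continuous with respect to $\mu$. Here $T$ is weakly mixing with respect to $\mu_t$ if there is a sequence of natural numbers $m_n\to\infty$ with $\mu_t(B\cap T^{-m_n}A)\to\mu_t(A)\mu_t(B)$ for all Borel sets $A,B$. -/

import Mathlib

open Filter Topology MeasureTheory
open scoped ContDiff

/-- The two-dimensional torus `𝕋² = ℝ/ℤ × ℝ/ℤ`. Its `volume` is the normalized Lebesgue measure. -/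
abbrev Torus2 : Type := UnitAddCircle × UnitAddCircle

/-- The covering projection `ℝ² → 𝕋²`. -/
def torusProj (p : ℝ × ℝ) : Torus2 := ((p.1 : UnitAddCircle), (p.2 : UnitAddCircle))

/-- `F : ℝ² → ℝ²` is a smooth (`C^∞`) lift of the torus map `f`. -/
def IsSmoothLift (F : ℝ × ℝ → ℝ × ℝ) (f : Torus2 → Torus2) : Prop :=
  ContDiff ℝ ∞ F ∧ ∀ p, torusProj (F p) = f (torusProj p)

/-- A torus map is smooth if it has a smooth lift to the universal cover. -/
def TorusSmooth (f : Torus2 → Torus2) : Prop := ∃ F, IsSmoothLift F f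

/-- `Diff^∞(𝕋², μ)`: the smooth diffeomorphisms of the torus that preserve Lebesgue measure. -/
def DiffTorus : Set (Equiv.Perm Torus2) :=
  {f | TorusSmooth f ∧ TorusSmooth f.symm ∧ MeasurePreserving f volume volume}

/-- `f` and `g` are `ε`-close in `C^k`: for suitable lifts, all derivatives of order `0, …, k` of the
difference of the lifts are bounded by `ε`, uniformly. -/
def CkClose (k : ℕ) (ε : ℝ) (f g : Torus2 → Torus2) : Prop :=
  ∃ F G, IsSmoothLift F f ∧ IsSmoothLift G g ∧
    ∀ j ≤ k, ∀ p : ℝ × ℝ, ‖iteratedFDeriv ℝ j (fun q => F q - G q) p‖ ≤ ε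

/-- The closure in `Diff^∞(𝕋², μ)`, for the `C^∞` topology, of a set of diffeomorphisms. A basic
neighbourhood of `f` consists of the `g` such that `g`, `g⁻¹` are `ε`-close in `C^k` to
`f`, `f⁻¹`. -/
def smoothClosure (S : Set (Equiv.Perm Torus2)) : Set (Equiv.Perm Torus2) :=
  {f | f ∈ DiffTorus ∧ ∀ (k : ℕ) (ε : ℝ), 0 < ε →
    ∃ g ∈ S, CkClose k ε f g ∧ CkClose k ε f.symm g.symm}

/-- The translation `S_α (x₁, x₂) = (x₁ + α, x₂)`. -/
def torusTranslation (α : ℝ) : Equiv.Perm Torus2 := Equiv.addRight ((α : UnitAddCircle), 0)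

/-- `𝒜_α(𝕋²)`: the `C^∞`-closure of the set of conjugates `h ∘ S_α ∘ h⁻¹`, `h ∈ Diff^∞(𝕋², μ)`. -/
def anosovKatokSpace (α : ℝ) : Set (Equiv.Perm Torus2) :=
  smoothClosure {f | ∃ h ∈ DiffTorus, f = h * torusTranslation α * h⁻¹}

/-- Minimality: every forward orbit is dense. -/
def IsMinimalMap {X : Type*} [TopologicalSpace X] (T : X → X) : Prop :=
  ∀ x, Dense (Set.range fun n : ℕ => T^[n] x)

/-- `x` is a generic point for `μ`: the Birkhoff averages along the orbit of `x` of every continuous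
compactly supported function converge to its integral. -/
def IsBirkhoffGenericPoint {X : Type*} [TopologicalSpace X] [MeasurableSpace X]
    (T : X → X) (μ : Measure X) (x : X) : Prop :=
  ∀ φ : X → ℝ, Continuous φ → HasCompactSupport φ →
    Tendsto (fun N : ℕ => birkhoffAverage ℝ T φ N x) atTop (𝓝 (∫ y, φ y ∂μ))

/-- A generic measure is a measure that has a generic point. -/
def IsGenericMeasure {X : Type*} [TopologicalSpace X] [MeasurableSpace X]
    (T : X → X) (μ : Measure X) : Prop :=
  ∃ x, IsBirkhoffGenericPoint T μ x

/-- Weak mixing of a map preserving the probability measure `μ`: there is a mixing sequence of times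
`m n → ∞`, along which `μ (B ∩ T^{-m n} A) → μ B * μ A` for all measurable `A`, `B`. -/
def IsWeaklyMixing {X : Type*} [MeasurableSpace X] (T : X → X) (μ : Measure X) : Prop :=
  IsProbabilityMeasure μ ∧ MeasurePreserving T μ μ ∧
    ∃ m : ℕ → ℕ, Tendsto m atTop atTop ∧
      ∀ A B : Set X, MeasurableSet A → MeasurableSet B →
        Tendsto (fun n => μ (B ∩ T^[m n] ⁻¹' A)) atTop (𝓝 (μ B * μ A))

/-!
The diffeomorphism `T` is a limit of conjugates `H_n ∘ S_α ∘ H_n⁻¹` (approximation by conjugation),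
where every `H_n` is a word of shears of the torus, `(x₁, x₂) ↦ (x₁, x₂ + g x₁)` and
`(x₁, x₂) ↦ (x₁ + a x₂, x₂)` with `g`, `a` smooth and periodic (`Shear`, `evalWord`).

*Convergence.* Under the covering `(x₁, x₂) ↦ (q x₁, x₂)` a word `φ` lifts to a word `h_q`
(`scaleWord q φ`) that commutes with `S_{p/q}`, moves the first coordinate by `O(1 / q)` only, and
whose derivatives grow polynomially in `q` (`polyBdd_conjLift`). Since `α` is a Liouville number,
`|α - p / q|` is smaller than any power of `1 / q` for suitable `q`, so that passing from `H` to
`H h_q` hardly changes the conjugate of `S_α` in `C^k` (`FastApprox.eventually_conjLift_close`).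
So `φ` can be chosen freely, before `q`, and each step can be made as small as wanted with respect
to the earlier ones. Moreover `H h_q` is asymptotically `x ↦ H (x₁, y)`, where `y` is the height of
`φ (q x₁, x₂)`, and `x₁` and `q x₁` behave like independent variables
(`abs_integral_torus_fast_le`). Thus the effect of a step is determined by how `φ` changes heights.

*Strips.* The torus is cut into `r` horizontal strips of equal area. Each `φ` preserves the height
modulo strips up to a small set, so the images of the strips under `H_n` converge in measure to
disjoint sets of measure `1 / r` (`limitStrip`), invariant under `T`; hence `μ` is not ergodic.

*Base point.* A point `(z, 0)` with `q z = 1 / 4` is followed through the construction; it hardly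
moves in one step. Along its orbit the first coordinate of the covering torus moves slowly from
`1 / 4` on, so Birkhoff averages of length `N` are averages of fibre means over a window
of the curve `u ↦ φ (u, 0)` that starts at `u = 1 / 4`. The length from which on this holds does
not depend on `φ` (`exists_average_length`), which leaves no gap between the lengths controlled
by consecutive steps. The `deviation` of `H` for a function `f` is the distance from the mean of
`f` over the image of the circle `x₂ = 0` to the mean of `f` over the torus; all three kinds of
words below keep the averages over every such window within the deviation, up to a small error.

*Three kinds of steps*, taken in turn:
* a sweeping word `V_g W_a V_g⁻¹` changes heights on a set of small measure only, but lets half of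
  the circle `x₂ = 0` sweep over the torus uniformly while the other half stays where it is. This
  halves the deviations (`exists_sweep`), which therefore tend to `0`, and the limit of the base
  points is generic for `μ`;
* a covering word is one vertical shear along a function that is supported on a short interval and
  takes all values modulo `1`; then every circle `x₂ = const` has an almost dense image, and all
  orbits are `ε`-dense (`exists_covering_word`), which yields minimality;
* a mixing word is a smooth approximation of a permutation of the cells of a grid, which fixes the
  left half of the torus and acts on the rows of the right half by exchanging the last two digits
  of the row number `t k² + a k + b`. Inside a strip this is close to `v ↦ k v` modulo `1`, and at
  a time `m` with `m α ≈ 1 / (2 q)` it compares a height with its image, which are nearly independent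
  (`exists_mixing_word`). The permutation is realized by shears since all cell exchanges away
  from the bottom row are conjugates of exchanges within a row (`approximable_rightColumn`). Together
  with a steep horizontal shear, which commutes with `S_α` and makes the vertical segments
  equidistributed in the strips (`exists_equalizing_shear`), this gives weak mixing on each strip.

Everything asserted of a step concerns finite orbit segments, so it persists for all maps close
to the conjugate of that step, in particular for the limit (`IsStep`).
-/

/-! ### Shears and words of shears -/

lemma norm_coe_circle_le (t : ℝ) : ‖(t : UnitAddCircle)‖ ≤ |t| :=
  QuotientAddGroup.norm_mk_le_norm

/-- A smooth `1`-periodic function `ℝ → ℝ`. -/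
structure PerFun where
  /-- the underlying function -/
  f : ℝ → ℝ
  smooth : ContDiff ℝ ∞ f
  per : Function.Periodic f 1

namespace PerFun

/-- The function on the circle induced by a periodic function. -/
noncomputable def circ (g : PerFun) : UnitAddCircle → ℝ := g.per.lift

@[simp] lemma circ_coe (g : PerFun) (x : ℝ) : g.circ (x : UnitAddCircle) = g.f x :=
  g.per.lift_coe x

lemma continuous_circ (g : PerFun) : Continuous g.circ :=
  continuous_coinduced_dom.mpr g.smooth.continuous

lemma f_add_int (g : PerFun) (x : ℝ) (m : ℤ) : g.f (x + m) = g.f x := by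
  simpa using g.per.int_mul m x

instance : Neg PerFun := ⟨fun g => ⟨fun x => -g.f x, g.smooth.neg, fun x => by simp [g.per x]⟩⟩

@[simp] lemma neg_f (g : PerFun) (x : ℝ) : (-g).f x = -g.f x := rfl

@[simp] lemma neg_circ (g : PerFun) (x : UnitAddCircle) : (-g).circ x = -g.circ x := by
  induction x using QuotientAddGroup.induction_on with
  | H x => exact ((-g).circ_coe x).trans (by rw [neg_f]; exact congrArg _ (g.circ_coe x).symm)

/-- `x ↦ g (q x)`. -/
def speedUp (g : PerFun) (q : ℕ) : PerFun where
  f x := g.f (q * x)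
  smooth := g.smooth.comp (contDiff_const.mul contDiff_id)
  per x := by
    have := g.f_add_int (q * x) q
    show g.f (q * (x + 1)) = g.f (q * x)
    rw [← this]; congr 1; push_cast; ring

/-- `x ↦ g x / q`. -/
noncomputable def divide (g : PerFun) (q : ℕ) : PerFun where
  f x := (q : ℝ)⁻¹ * g.f x
  smooth := contDiff_const.mul g.smooth
  per x := by simp [g.per x]

@[simp] lemma speedUp_circ (g : PerFun) (q : ℕ) (x : UnitAddCircle) :
    (g.speedUp q).circ x = g.circ (q • x) := by
  induction x using QuotientAddGroup.induction_on with
  | H x =>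
    refine ((g.speedUp q).circ_coe x).trans ?_
    have : (q • (x : UnitAddCircle)) = ((q * x : ℝ) : UnitAddCircle) := by
      rw [← nsmul_eq_mul]; rfl
    exact (g.circ_coe (q * x)).symm.trans (by rw [← this])

@[simp] lemma divide_circ (g : PerFun) (q : ℕ) (x : UnitAddCircle) :
    (g.divide q).circ x = (q : ℝ)⁻¹ * g.circ x := by
  induction x using QuotientAddGroup.induction_on with
  | H x => exact ((g.divide q).circ_coe x).trans (by
      show _ = _ * g.circ ((x : ℝ) : UnitAddCircle); rw [g.circ_coe]; rfl)

lemma exists_bound (g : PerFun) : ∃ C : ℝ, 0 ≤ C ∧ ∀ x, |g.circ x| ≤ C := by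
  obtain ⟨C, hC⟩ := isCompact_univ.exists_bound_of_continuousOn (g.continuous_circ.continuousOn)
  exact ⟨C, (norm_nonneg _).trans (hC 0 trivial), fun x => hC x trivial⟩

end PerFun

/-- A shear of the plane or of the torus along a smooth periodic function: `V g` is the vertical
shear `(x₁, x₂) ↦ (x₁, x₂ + g x₁)`, and `W a` the horizontal one `(x₁, x₂) ↦ (x₁ + a x₂, x₂)`. -/
inductive Shear where
  | V (g : PerFun)
  | W (a : PerFun)

namespace Shear

/-- The shear of the plane. -/
def lift : Shear → ℝ × ℝ → ℝ × ℝ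
  | V g, x => (x.1, x.2 + g.f x.1)
  | W a, x => (x.1 + a.f x.2, x.2)

/-- The shear of the torus. -/
noncomputable def perm : Shear → Equiv.Perm Torus2
  | V g =>
    { toFun := fun x => (x.1, x.2 + (g.circ x.1 : ℝ))
      invFun := fun x => (x.1, x.2 - (g.circ x.1 : ℝ))
      left_inv := fun x => by simp
      right_inv := fun x => by simp }
  | W a =>
    { toFun := fun x => (x.1 + (a.circ x.2 : ℝ), x.2)
      invFun := fun x => (x.1 - (a.circ x.2 : ℝ), x.2)
      left_inv := fun x => by simp
      right_inv := fun x => by simp }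

/-- The inverse shear. -/
def inv : Shear → Shear
  | V g => V (-g)
  | W a => W (-a)

/-- The lift of a shear under the `q`-fold covering `(x₁, x₂) ↦ (q x₁, x₂)` of the torus. -/
noncomputable def scale (q : ℕ) : Shear → Shear
  | V g => V (g.speedUp q)
  | W a => W (a.divide q)

@[simp] lemma perm_V (g : PerFun) (x : Torus2) :
    (V g).perm x = (x.1, x.2 + (g.circ x.1 : ℝ)) := rfl

@[simp] lemma perm_W (a : PerFun) (x : Torus2) :
    (W a).perm x = (x.1 + (a.circ x.2 : ℝ), x.2) := rfl

lemma perm_inv (s : Shear) : s.inv.perm = s.perm⁻¹ := by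
  cases s with
  | V g => ext x <;> simp [inv, sub_eq_add_neg, perm, Equiv.Perm.inv_def]
  | W a => ext x <;> simp [inv, sub_eq_add_neg, perm, Equiv.Perm.inv_def]

lemma lift_inv' (s : Shear) (x : ℝ × ℝ) : s.lift (s.inv.lift x) = x := by
  cases s <;> simp [inv, lift]

lemma proj_lift (s : Shear) (x : ℝ × ℝ) : torusProj (s.lift x) = s.perm (torusProj x) := by
  cases s <;> simp [torusProj, lift]

lemma contDiff_lift (s : Shear) : ContDiff ℝ ∞ s.lift := by
  cases s with
  | V g => exact contDiff_fst.prodMk (contDiff_snd.add (g.smooth.comp contDiff_fst))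
  | W a => exact (contDiff_fst.add (a.smooth.comp contDiff_snd)).prodMk contDiff_snd

lemma continuous_perm (s : Shear) : Continuous s.perm := by
  cases s with
  | V g =>
    exact continuous_fst.prodMk (continuous_snd.add
      ((AddCircle.continuous_mk' 1).comp (g.continuous_circ.comp continuous_fst)))
  | W a =>
    exact (continuous_fst.add
      ((AddCircle.continuous_mk' 1).comp (a.continuous_circ.comp continuous_snd))).prodMk
        continuous_snd

lemma measurePreserving_perm_V (g : PerFun) :
    MeasurePreserving (V g).perm (volume : Measure Torus2) volume := by
  have hm : Measurable fun p : UnitAddCircle × UnitAddCircle =>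
      p.2 + ((g.circ p.1 : ℝ) : UnitAddCircle) :=
    (continuous_snd.add ((AddCircle.continuous_mk' 1).comp
      (g.continuous_circ.comp continuous_fst))).measurable
  exact MeasurePreserving.skew_product (g := fun x y => y + ((g.circ x : ℝ) : UnitAddCircle))
    (MeasurePreserving.id volume) hm
    (ae_of_all _ fun x => (measurePreserving_add_right volume _).map_eq)

lemma measurePreserving_perm (s : Shear) :
    MeasurePreserving s.perm (volume : Measure Torus2) volume := by
  cases s with
  | V g => exact measurePreserving_perm_V g
  | W a =>
    have h := (Measure.measurePreserving_swap (μ := (volume : Measure UnitAddCircle))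
      (ν := (volume : Measure UnitAddCircle)))
    exact (h.comp ((measurePreserving_perm_V a).comp h) :)

lemma lift_scale_comm (q : ℕ) (hq : q ≠ 0) (p : ℤ) (s : Shear) (x : ℝ × ℝ) :
    (s.scale q).lift (x + ((p / q : ℝ), 0)) = (s.scale q).lift x + ((p / q : ℝ), 0) := by
  cases s with
  | V g =>
    have : (q : ℝ) * (x.1 + p / q) = q * x.1 + p := by field_simp
    simp [scale, lift, PerFun.speedUp, this, PerFun.f_add_int]
  | W a => simp [scale, lift, add_right_comm]

lemma scale_semiconj (q : ℕ) (hq : q ≠ 0) (s : Shear) (x : Torus2) :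
    (q • ((s.scale q).perm x).1, ((s.scale q).perm x).2) = s.perm (q • x.1, x.2) := by
  cases s with
  | V g => simp [scale]
  | W a =>
    have : q • (((q : ℝ)⁻¹ * a.circ x.2 : ℝ) : UnitAddCircle) =
        ((a.circ x.2 : ℝ) : UnitAddCircle) := by
      rw [← AddCircle.coe_nsmul, nsmul_eq_mul, mul_inv_cancel_left₀ (by exact_mod_cast hq)]
    simp [scale, smul_add, this]

end Shear

/-- The composition of the shears in a list, the last one acting first. -/
noncomputable def evalWord (w : List Shear) : Equiv.Perm Torus2 := (w.map Shear.perm).prod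

/-- The composition of the lifts to the plane of the shears in a list. -/
def liftWord : List Shear → ℝ × ℝ → ℝ × ℝ
  | [] => id
  | s :: w => s.lift ∘ liftWord w

/-- The word of the inverse composition. -/
def invWord : List Shear → List Shear
  | [] => []
  | s :: w => invWord w ++ [s.inv]

/-- The lift of a word under the `q`-fold covering `(x₁, x₂) ↦ (q x₁, x₂)` of the torus. -/
noncomputable def scaleWord (q : ℕ) (w : List Shear) : List Shear := w.map (Shear.scale q)

section Words

@[simp] lemma evalWord_nil : evalWord [] = 1 := rfl

@[simp] lemma evalWord_cons (s : Shear) (w : List Shear) :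
    evalWord (s :: w) = s.perm * evalWord w := by simp [evalWord]

@[simp] lemma evalWord_append (v w : List Shear) :
    evalWord (v ++ w) = evalWord v * evalWord w := by simp [evalWord]

lemma evalWord_inv (w : List Shear) : evalWord (invWord w) = (evalWord w)⁻¹ := by
  induction w with
  | nil => simp [invWord]
  | cons s w ih => simp [invWord, ih, Shear.perm_inv]

lemma liftWord_append (v w : List Shear) : liftWord (v ++ w) = liftWord v ∘ liftWord w := by
  induction v with
  | nil => rfl
  | cons s v ih => simp [liftWord, ih, Function.comp_assoc]

lemma liftWord_inv' (w : List Shear) (x : ℝ × ℝ) : liftWord w (liftWord (invWord w) x) = x := by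
  induction w generalizing x with
  | nil => rfl
  | cons s w ih => simp [invWord, liftWord_append, liftWord, Shear.lift_inv', ih]

lemma proj_liftWord (w : List Shear) (x : ℝ × ℝ) :
    torusProj (liftWord w x) = evalWord w (torusProj x) := by
  induction w generalizing x with
  | nil => rfl
  | cons s w ih => simp [liftWord, Shear.proj_lift, ih]

lemma contDiff_liftWord (w : List Shear) : ContDiff ℝ ∞ (liftWord w) := by
  induction w with
  | nil => exact contDiff_id
  | cons s w ih => exact s.contDiff_lift.comp ih

lemma continuous_evalWord (w : List Shear) : Continuous (evalWord w) := by
  induction w with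
  | nil => exact continuous_id
  | cons s w ih => rw [evalWord_cons, Equiv.Perm.coe_mul]; exact s.continuous_perm.comp ih

lemma measurePreserving_evalWord (w : List Shear) :
    MeasurePreserving (evalWord w) (volume : Measure Torus2) volume := by
  induction w with
  | nil => exact MeasurePreserving.id _
  | cons s w ih =>
    rw [evalWord_cons, Equiv.Perm.coe_mul]; exact s.measurePreserving_perm.comp ih

lemma continuous_evalWord_inv (w : List Shear) :
    Continuous ((evalWord w)⁻¹ : Equiv.Perm Torus2) := by
  rw [← evalWord_inv]; exact continuous_evalWord _

lemma measurePreserving_evalWord_inv (w : List Shear) :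
    MeasurePreserving ((evalWord w)⁻¹ : Equiv.Perm Torus2) (volume : Measure Torus2) volume := by
  rw [← evalWord_inv]; exact measurePreserving_evalWord _

lemma measurableEmbedding_evalWord (w : List Shear) : MeasurableEmbedding (evalWord w) :=
  MeasurableEmbedding.of_measurable_inverse (g := ((evalWord w)⁻¹ : Equiv.Perm Torus2))
      (continuous_evalWord w).measurable
    (by rw [Equiv.range_eq_univ]; exact .univ) (continuous_evalWord_inv w).measurable
    (fun x => by simp)

lemma evalWord_mem_diffTorus (w : List Shear) : evalWord w ∈ DiffTorus := by
  refine ⟨⟨liftWord w, contDiff_liftWord w, proj_liftWord w⟩,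
    ⟨liftWord (invWord w), contDiff_liftWord _, fun p => ?_⟩, measurePreserving_evalWord w⟩
  rw [proj_liftWord, evalWord_inv]; rfl

lemma liftWord_scale_comm (q : ℕ) (hq : q ≠ 0) (p : ℤ) (w : List Shear) (x : ℝ × ℝ) :
    liftWord (scaleWord q w) (x + ((p / q : ℝ), 0)) =
      liftWord (scaleWord q w) x + ((p / q : ℝ), 0) := by
  induction w generalizing x with
  | nil => rfl
  | cons s w ih =>
    have ih' := ih x
    simp only [scaleWord, List.map_cons, liftWord, Function.comp] at ih' ⊢
    rw [ih', Shear.lift_scale_comm _ hq]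

lemma scaleWord_semiconj (q : ℕ) (hq : q ≠ 0) (w : List Shear) (x : Torus2) :
    (q • (evalWord (scaleWord q w) x).1, (evalWord (scaleWord q w) x).2) =
      evalWord w (q • x.1, x.2) := by
  induction w generalizing x with
  | nil => rfl
  | cons s w ih =>
    have ih' := ih x
    simp only [scaleWord, List.map_cons, evalWord_cons, Equiv.Perm.coe_mul, Function.comp] at ih' ⊢
    rw [Shear.scale_semiconj q hq, ih']

lemma scaleWord_snd (q : ℕ) (hq : q ≠ 0) (w : List Shear) (x : Torus2) :
    (evalWord (scaleWord q w) x).2 = (evalWord w (q • x.1, x.2)).2 := by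
  rw [← scaleWord_semiconj q hq]

/-- The `q`-fold lift of a word moves the first coordinate by `O(1/q)`. -/
lemma exists_dist_scaleWord_fst (w : List Shear) :
    ∃ C : ℝ, ∀ (q : ℕ) (x : Torus2), dist (evalWord (scaleWord q w) x).1 x.1 ≤ C * (q : ℝ)⁻¹ := by
  induction w with
  | nil => exact ⟨0, fun q x => by simp [scaleWord]⟩
  | cons s w ih =>
    obtain ⟨C, hC⟩ := ih
    cases s with
    | V g => exact ⟨C, fun q x => by simpa [scaleWord, Shear.scale] using hC q x⟩
    | W a =>
      obtain ⟨B, hB, hB'⟩ := a.exists_bound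
      refine ⟨B + C, fun q x => ?_⟩
      have h1 := hC q x
      simp only [scaleWord, List.map_cons, evalWord_cons, Equiv.Perm.coe_mul, Function.comp,
        Shear.scale, Shear.perm_W] at h1 ⊢
      refine (dist_triangle _ (evalWord (List.map (Shear.scale q) w) x).1 _).trans ?_
      rw [add_mul]
      refine add_le_add ?_ h1
      rw [dist_eq_norm, add_sub_cancel_left, PerFun.divide_circ]
      refine (norm_coe_circle_le _).trans ?_
      rw [abs_mul, abs_of_nonneg (inv_nonneg.mpr (Nat.cast_nonneg q)), mul_comm]
      exact mul_le_mul_of_nonneg_right (hB' _) (inv_nonneg.mpr (Nat.cast_nonneg q))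

end Words

/-! ### Polynomial growth of derivatives -/

section PolyBdd

variable {E F G : Type*} [NormedAddCommGroup E] [NormedSpace ℝ E] [NormedAddCommGroup F]
  [NormedSpace ℝ F] [NormedAddCommGroup G] [NormedSpace ℝ G]

/-- A sequence of smooth maps all of whose derivatives of positive order grow at most polynomially
in the index, uniformly in space. -/
def PolyBdd (f : ℕ → E → F) : Prop :=
  (∀ q, ContDiff ℝ ∞ (f q)) ∧ ∀ k : ℕ, ∃ (C : ℝ) (M : ℕ), 1 ≤ C ∧ ∀ j, 1 ≤ j → j ≤ k →
    ∀ q : ℕ, 1 ≤ q → ∀ x, ‖iteratedFDeriv ℝ j (f q) x‖ ≤ C * (q : ℝ) ^ M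

lemma PolyBdd.of_bounds {f : ℕ → E → F} (hf : ∀ q, ContDiff ℝ ∞ (f q))
    (h : ∀ j, 1 ≤ j → ∃ (C : ℝ) (M : ℕ), ∀ q : ℕ, 1 ≤ q → ∀ x,
      ‖iteratedFDeriv ℝ j (f q) x‖ ≤ C * (q : ℝ) ^ M) : PolyBdd f := by
  refine ⟨hf, fun k => ?_⟩
  induction k with
  | zero => exact ⟨1, 0, le_rfl, fun j h1 h2 => by omega⟩
  | succ k ih =>
    obtain ⟨C, M, hC, hb⟩ := ih
    obtain ⟨C', M', hb'⟩ := h (k + 1) (by omega)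
    refine ⟨max C C', max M M', hC.trans (le_max_left _ _), fun j h1 h2 q hq x => ?_⟩
    have hq' : (1 : ℝ) ≤ q := by exact_mod_cast hq
    rcases Nat.lt_or_ge k j with h3 | h3
    · obtain rfl : j = k + 1 := by omega
      refine (hb' q hq x).trans (mul_le_mul (le_max_right _ _)
        (pow_le_pow_right₀ hq' (le_max_right _ _)) (by positivity)
        (zero_le_one.trans (hC.trans (le_max_left _ _))))
    · exact (hb j h1 h3 q hq x).trans (mul_le_mul (le_max_left _ _)
        (pow_le_pow_right₀ hq' (le_max_left _ _)) (by positivity)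
        (zero_le_one.trans (hC.trans (le_max_left _ _))))

lemma PolyBdd.add {f g : ℕ → E → F} (hf : PolyBdd f) (hg : PolyBdd g) :
    PolyBdd fun q x => f q x + g q x := by
  refine ⟨fun q => (hf.1 q).add (hg.1 q), fun k => ?_⟩
  obtain ⟨C, M, hC, hb⟩ := hf.2 k
  obtain ⟨C', M', hC', hb'⟩ := hg.2 k
  refine ⟨C + C', M + M', by linarith, fun j h1 h2 q hq x => ?_⟩
  have hq' : (1 : ℝ) ≤ q := by exact_mod_cast hq
  have e : iteratedFDeriv ℝ j (fun x => f q x + g q x) x =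
      iteratedFDeriv ℝ j (f q) x + iteratedFDeriv ℝ j (g q) x :=
    iteratedFDeriv_add_apply ((hf.1 q).of_le (by exact_mod_cast le_top)).contDiffAt
      ((hg.1 q).of_le (by exact_mod_cast le_top)).contDiffAt
  rw [e, add_mul]
  refine (norm_add_le _ _).trans (add_le_add ((hb j h1 h2 q hq x).trans ?_)
    ((hb' j h1 h2 q hq x).trans ?_))
  · exact mul_le_mul_of_nonneg_left (pow_le_pow_right₀ hq' (by omega)) (by linarith)
  · exact mul_le_mul_of_nonneg_left (pow_le_pow_right₀ hq' (by omega)) (by linarith)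

lemma PolyBdd.comp {g : ℕ → F → G} {f : ℕ → E → F} (hg : PolyBdd g) (hf : PolyBdd f) :
    PolyBdd fun q x => g q (f q x) := by
  refine ⟨fun q => (hg.1 q).comp (hf.1 q), fun k => ?_⟩
  obtain ⟨C, M, hC, hb⟩ := hf.2 k
  obtain ⟨C', M', hC', hb'⟩ := hg.2 k
  have hk : (1 : ℝ) ≤ (k.factorial : ℝ) := by
    exact_mod_cast Nat.one_le_iff_ne_zero.mpr k.factorial_ne_zero
  refine ⟨k.factorial * C' * C ^ k, M' + M * k, ?_, fun j h1 h2 q hq x => ?_⟩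
  · exact one_le_mul_of_one_le_of_one_le (one_le_mul_of_one_le_of_one_le hk hC') (one_le_pow₀ hC)
  have hq' : (1 : ℝ) ≤ q := by exact_mod_cast hq
  have hD : 1 ≤ C * (q : ℝ) ^ M := one_le_mul_of_one_le_of_one_le hC (one_le_pow₀ hq')
  have hD' : 0 ≤ C' * (q : ℝ) ^ M' := by positivity
  -- Subtracting the constant `g q (f q x)` makes the derivative of order `0` at `f q x` vanish.
  set c := g q (f q x) with hc
  have hsub : ∀ i, 1 ≤ i → ∀ y, iteratedFDeriv ℝ i (fun y => g q y - c) y =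
      iteratedFDeriv ℝ i (g q) y := by
    intro i hi y
    have := iteratedFDeriv_sub_apply (𝕜 := ℝ) (i := i) (x := y) (f := g q) (g := fun _ => c)
      ((hg.1 q).of_le (by exact_mod_cast le_top)).contDiffAt contDiffAt_const
    rw [iteratedFDeriv_const_of_ne (by omega), Pi.zero_apply, sub_zero] at this
    exact this
  have hsub' : iteratedFDeriv ℝ j (fun y => g q (f q y) - c) x =
      iteratedFDeriv ℝ j (fun y => g q (f q y)) x := by
    have := iteratedFDeriv_sub_apply (𝕜 := ℝ) (i := j) (x := x) (f := fun y => g q (f q y))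
      (g := fun _ => c)
      (((hg.1 q).comp (hf.1 q)).of_le (by exact_mod_cast le_top)).contDiffAt contDiffAt_const
    rw [iteratedFDeriv_const_of_ne (by omega), Pi.zero_apply, sub_zero] at this
    exact this
  rw [← hsub']
  have := norm_iteratedFDeriv_comp_le (𝕜 := ℝ) (g := fun y => g q y - c) (f := f q) (n := j)
    (N := ∞) ((hg.1 q).sub contDiff_const) (hf.1 q) (by exact_mod_cast le_top) x
    (C := C' * (q : ℝ) ^ M') (D := C * (q : ℝ) ^ M) (fun i hi => ?_) (fun i hi hij => ?_)
  · refine this.trans ?_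
    have e : (k.factorial : ℝ) * C' * C ^ k * (q : ℝ) ^ (M' + M * k) =
        k.factorial * (C' * (q : ℝ) ^ M') * (C * (q : ℝ) ^ M) ^ k := by
      rw [mul_pow, pow_add, pow_mul]; ring
    rw [e]
    refine mul_le_mul (mul_le_mul_of_nonneg_right ?_ hD') (pow_le_pow_right₀ hD h2)
      (by positivity) (by positivity)
    exact_mod_cast Nat.factorial_le h2
  · rcases Nat.eq_zero_or_pos i with rfl | hi'
    · rw [norm_iteratedFDeriv_zero]; simpa [hc] using hD'
    · rw [hsub i hi']; exact hb' i hi' (hi.trans h2) q hq _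
  · exact (hb i hi (hij.trans h2) q hq x).trans (le_self_pow₀ hD (by omega))

lemma PolyBdd.clm (L : ℕ → E →L[ℝ] F) (C : ℝ) (M : ℕ) (h : ∀ q, 1 ≤ q → ‖L q‖ ≤ C * (q : ℝ) ^ M) :
    PolyBdd fun q x => L q x := by
  refine PolyBdd.of_bounds (fun q => (L q).contDiff) fun j hj => ⟨C, M, fun q hq x => ?_⟩
  obtain ⟨n, rfl⟩ : ∃ n, j = n + 1 := ⟨j - 1, by omega⟩
  rw [← norm_iteratedFDeriv_fderiv]
  have : fderiv ℝ (fun x => L q x) = fun _ => L q := by ext1 x; exact (L q).fderiv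
  rw [this]
  rcases Nat.eq_zero_or_pos n with rfl | hn
  · simpa using h q hq
  · rw [iteratedFDeriv_const_of_ne (by omega)]
    simpa using (norm_nonneg _).trans (h q hq)

lemma PolyBdd.clm_const (L : E →L[ℝ] F) : PolyBdd fun (_ : ℕ) x => L x :=
  PolyBdd.clm (fun _ => L) ‖L‖ 0 (fun q _ => by simp)

lemma PolyBdd.id : PolyBdd fun (_ : ℕ) (x : E) => x :=
    PolyBdd.clm_const (ContinuousLinearMap.id ℝ E)

lemma PerFun.polyBdd (g : PerFun) : PolyBdd fun (_ : ℕ) => g.f := by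
  refine PolyBdd.of_bounds (fun _ => g.smooth) fun j _ => ?_
  have hc : Continuous fun x => iteratedFDeriv ℝ j g.f x :=
    g.smooth.continuous_iteratedFDeriv (by exact_mod_cast le_top)
  obtain ⟨C, hC⟩ := isCompact_Icc.exists_bound_of_continuousOn (s := Set.Icc (0 : ℝ) 1)
    hc.continuousOn
  have hper : Function.Periodic (fun x => iteratedFDeriv ℝ j g.f x) 1 := fun x => by
    have := iteratedFDeriv_comp_add_right (𝕜 := ℝ) (f := g.f) j 1 x
    refine this.symm.trans ?_
    congr 1
    ext y; exact g.per y
  refine ⟨C, 0, fun q _ x => ?_⟩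
  obtain ⟨y, hy, e⟩ := hper.exists_mem_Ico₀ one_pos x
  refine (le_of_eq (congrArg norm e)).trans ?_
  simpa using hC y ⟨hy.1, hy.2.le⟩

lemma Shear.polyBdd (s : Shear) : PolyBdd fun (_ : ℕ) => s.lift := by
  cases s with
  | V g =>
    convert PolyBdd.id.add ((PolyBdd.clm_const (ContinuousLinearMap.inr ℝ ℝ ℝ)).comp
      (g.polyBdd.comp (PolyBdd.clm_const (ContinuousLinearMap.fst ℝ ℝ ℝ)))) using 3
    simp [Shear.lift, Prod.ext_iff]
  | W a =>
    convert PolyBdd.id.add ((PolyBdd.clm_const (ContinuousLinearMap.inl ℝ ℝ ℝ)).comp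
      (a.polyBdd.comp (PolyBdd.clm_const (ContinuousLinearMap.snd ℝ ℝ ℝ)))) using 3
    simp [Shear.lift, Prod.ext_iff]

lemma Shear.polyBdd_scale (s : Shear) : PolyBdd fun (q : ℕ) => (s.scale q).lift := by
  cases s with
  | V g =>
    convert PolyBdd.id.add ((PolyBdd.clm_const (ContinuousLinearMap.inr ℝ ℝ ℝ)).comp
      (g.polyBdd.comp (PolyBdd.clm (fun q => (q : ℝ) • ContinuousLinearMap.fst ℝ ℝ ℝ) 1 1 ?_)))
      using 3
    · simp [Shear.lift, Shear.scale, PerFun.speedUp, Prod.ext_iff]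
    · intro q _
      rw [norm_smul]
      simp
  | W a =>
    convert PolyBdd.id.add ((PolyBdd.clm (fun q => (q : ℝ)⁻¹ • ContinuousLinearMap.inl ℝ ℝ ℝ) 1 0
      ?_).comp (a.polyBdd.comp (PolyBdd.clm_const (ContinuousLinearMap.snd ℝ ℝ ℝ)))) using 3
    · simp [Shear.lift, Shear.scale, PerFun.divide, Prod.ext_iff]
    · intro q hq
      rw [norm_smul]
      have h1 : ‖(q : ℝ)⁻¹‖ ≤ 1 := by
        rw [norm_inv, Real.norm_natCast]; exact inv_le_one_of_one_le₀ (by exact_mod_cast hq)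
      simpa using mul_le_one₀ h1 (norm_nonneg _) (ContinuousLinearMap.norm_inl_le_one ℝ ℝ ℝ)

lemma polyBdd_liftWord (w : List Shear) : PolyBdd fun (_ : ℕ) => liftWord w := by
  induction w with
  | nil => exact PolyBdd.id
  | cons s w ih => exact s.polyBdd.comp ih

lemma polyBdd_liftWord_scale (w : List Shear) :
    PolyBdd fun (q : ℕ) => liftWord (scaleWord q w) := by
  induction w with
  | nil => exact PolyBdd.id
  | cons s w ih => exact s.polyBdd_scale.comp ih

lemma invWord_append (v w : List Shear) : invWord (v ++ w) = invWord w ++ invWord v := by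
  induction v with
  | nil => simp [invWord]
  | cons s v ih => simp [invWord, ih]

lemma invWord_scale (q : ℕ) (w : List Shear) :
    invWord (scaleWord q w) = scaleWord q (invWord w) := by
  induction w with
  | nil => rfl
  | cons s w ih =>
    have hs : (s.scale q).inv = s.inv.scale q := by
      cases s with
      | V g => rfl
      | W a =>
        have : -(a.divide q) = (-a).divide q := by
          show PerFun.mk _ _ _ = PerFun.mk _ _ _
          congr 1; ext x; exact (mul_neg _ _).symm
        simp [Shear.scale, Shear.inv, this]
    simp only [scaleWord, List.map_cons, invWord, List.map_append, List.map_nil] at ih ⊢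
    rw [ih, hs]

end PolyBdd

/-! ### Conjugates of translations by nearby amounts -/

/-- The lift of `H ∘ S_t ∘ H⁻¹`, where `H` is given by a word. -/
def conjLift (w : List Shear) (t : ℝ) (x : ℝ × ℝ) : ℝ × ℝ :=
  liftWord w (liftWord (invWord w) x + (t, 0))

lemma conjLift_scale (w φ : List Shear) (q : ℕ) (hq : q ≠ 0) (p : ℤ) :
    conjLift (w ++ scaleWord q φ) (p / q) = conjLift w (p / q) := by
  ext1 x
  simp only [conjLift, liftWord_append, invWord_append, Function.comp]
  rw [liftWord_scale_comm _ hq, liftWord_inv']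

lemma contDiff_conjLift (w : List Shear) (t : ℝ) : ContDiff ℝ ∞ (conjLift w t) :=
  (contDiff_liftWord w).comp ((contDiff_liftWord _).add contDiff_const)

lemma polyBdd_conjLift (w φ : List Shear) :
    PolyBdd fun (q : ℕ) (y : ℝ × (ℝ × ℝ)) => conjLift (w ++ scaleWord q φ) y.1 y.2 := by
  have h1 : PolyBdd fun (q : ℕ) => liftWord (w ++ scaleWord q φ) := by
    simp_rw [liftWord_append]; exact (polyBdd_liftWord w).comp (polyBdd_liftWord_scale φ)
  have h2 : PolyBdd fun (q : ℕ) => liftWord (invWord (w ++ scaleWord q φ)) := by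
    simp_rw [invWord_append, invWord_scale, liftWord_append]
    exact (polyBdd_liftWord_scale _).comp (polyBdd_liftWord _)
  convert h1.comp ((h2.comp (PolyBdd.clm_const (ContinuousLinearMap.snd ℝ ℝ (ℝ × ℝ)))).add
    (PolyBdd.clm_const ((ContinuousLinearMap.inl ℝ ℝ ℝ).comp
      (ContinuousLinearMap.fst ℝ ℝ (ℝ × ℝ))))) using 3
  simp [conjLift]

lemma norm_iteratedFDeriv_slice_sub_le {E F : Type*} [NormedAddCommGroup E] [NormedSpace ℝ E]
    [NormedAddCommGroup F] [NormedSpace ℝ F] (f : ℝ × E → F) (hf : ContDiff ℝ ∞ f) (j : ℕ) (C : ℝ)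
    (hC : ∀ y, ‖iteratedFDeriv ℝ (j + 1) f y‖ ≤ C) (s t : ℝ) (x : E) :
    ‖iteratedFDeriv ℝ j (fun z => f (s, z) - f (t, z)) x‖ ≤ C * |s - t| := by
  have hslice : ∀ s : ℝ, ContDiff ℝ ∞ fun z => f (s, z) := fun s =>
    hf.comp (contDiff_const.prodMk contDiff_id)
  have key : ∀ s : ℝ, iteratedFDeriv ℝ j (fun z => f (s, z)) x =
      (iteratedFDeriv ℝ j f (s, x)).compContinuousLinearMap
        fun _ => ContinuousLinearMap.inr ℝ ℝ E := by
    intro s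
    have h1 : (fun z => f (s, z)) =
        (fun y => f (y + (s, 0))) ∘ (ContinuousLinearMap.inr ℝ ℝ E) := by
      ext z; simp
    have h2 : ContDiff ℝ ∞ fun y => f (y + (s, 0)) := hf.comp (contDiff_id.add contDiff_const)
    rw [h1, ContinuousLinearMap.iteratedFDeriv_comp_right _ h2 x (i := j)
        (by exact_mod_cast le_top),
      iteratedFDeriv_comp_add_right]
    simp
  have e : iteratedFDeriv ℝ j (fun z => f (s, z) - f (t, z)) x =
      iteratedFDeriv ℝ j (fun z => f (s, z)) x - iteratedFDeriv ℝ j (fun z => f (t, z)) x :=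
    iteratedFDeriv_sub_apply ((hslice s).of_le (by exact_mod_cast le_top)).contDiffAt
      ((hslice t).of_le (by exact_mod_cast le_top)).contDiffAt
  have e2 : iteratedFDeriv ℝ j (fun z => f (s, z)) x - iteratedFDeriv ℝ j (fun z => f (t, z)) x =
      (iteratedFDeriv ℝ j f (s, x) - iteratedFDeriv ℝ j f (t, x)).compContinuousLinearMap
        fun _ => ContinuousLinearMap.inr ℝ ℝ E := by
    rw [key, key]; ext v; simp
  rw [e, e2]
  refine (ContinuousMultilinearMap.norm_compContinuousLinearMap_le _ _).trans ?_
  have h3 : (∏ _i : Fin j, ‖ContinuousLinearMap.inr ℝ ℝ E‖) ≤ 1 :=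
    Finset.prod_le_one (fun _ _ => norm_nonneg _)
      (fun _ _ => ContinuousLinearMap.norm_inr_le_one ℝ ℝ E)
  refine (mul_le_of_le_one_right (norm_nonneg _) h3).trans ?_
  have := Convex.norm_image_sub_le_of_norm_fderiv_le (𝕜 := ℝ) (f := iteratedFDeriv ℝ j f)
    (s := Set.univ) (C := C) (x := (t, x)) (y := (s, x))
    (fun y _ => (hf.differentiable_iteratedFDeriv
      (by exact_mod_cast WithTop.coe_lt_top _)).differentiableAt)
    (fun y _ => by rw [norm_fderiv_iteratedFDeriv]; exact hC y) convex_univ trivial trivial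
  refine this.trans (le_of_eq ?_)
  simp [Prod.norm_def, Real.norm_eq_abs]

/-- A sequence of rational numbers `p n / q n` that approximates `α` faster than any power of
`1 / q n`. -/
structure FastApprox (α : ℝ) (q : ℕ → ℕ) (p : ℕ → ℤ) : Prop where
  q_pos : ∀ n, 1 ≤ q n
  q_tendsto : Tendsto q atTop atTop
  fast : ∀ M : ℕ, Tendsto (fun n => (q n : ℝ) ^ M * |α - p n / q n|) atTop (𝓝 0)

lemma Liouville.exists_fastApprox {α : ℝ} (hα : Liouville α) : ∃ q p, FastApprox α q p := by
  have h : ∀ n : ℕ, ∃ q : ℕ, ∃ p : ℤ, n + 2 ≤ q ∧ |α - p / q| < 1 / (q : ℝ) ^ n := by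
    intro n
    obtain ⟨q, ⟨p, _, hp⟩, hq⟩ := ((hα.frequently_exists_num n).and_eventually
      (eventually_ge_atTop (n + 2))).exists
    exact ⟨q, p, hq, hp⟩
  choose q p hq hp using h
  refine ⟨q, p, fun n => by have := hq n; omega,
    tendsto_atTop_mono (fun n => (by have := hq n; omega : n ≤ q n)) tendsto_id, fun M => ?_⟩
  have hlim : Tendsto (fun n => ((q n : ℝ))⁻¹) atTop (𝓝 0) :=
    tendsto_inv_atTop_zero.comp (tendsto_natCast_atTop_atTop.comp
      (tendsto_atTop_mono (fun n => (by have := hq n; omega : n ≤ q n)) tendsto_id))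
  refine squeeze_zero' (Eventually.of_forall fun n => by positivity) ?_ hlim
  filter_upwards [eventually_ge_atTop (M + 1)] with n hn
  have h1 : (1 : ℝ) ≤ q n := by exact_mod_cast (by have := hq n; omega : 1 ≤ q n)
  have h0 : (0 : ℝ) < q n := by linarith
  calc (q n : ℝ) ^ M * |α - p n / q n| ≤ (q n : ℝ) ^ M * (1 / (q n : ℝ) ^ (M + 1)) := by
        gcongr
        refine (hp n).le.trans ?_
        gcongr
    _ = ((q n : ℝ))⁻¹ := by rw [pow_succ]; field_simp

lemma FastApprox.neg {α : ℝ} {q : ℕ → ℕ} {p : ℕ → ℤ} (h : FastApprox α q p) :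
    FastApprox (-α) q (fun n => -p n) := by
  refine ⟨h.q_pos, h.q_tendsto, fun M => ?_⟩
  convert h.fast M using 3 with n
  rw [← abs_neg]; congr 1; push_cast; ring

/-- Since the derivatives of `h_q` grow polynomially in `q`, while `h_q` commutes with `S_{p/q}`,
the conjugates of `S_α` by `H ∘ h_q` and by `H` are `C^k`-close along fast rational approximations.
-/
lemma FastApprox.eventually_conjLift_close {α : ℝ} {q : ℕ → ℕ} {p : ℕ → ℤ} (h : FastApprox α q p)
    (w φ : List Shear) (k : ℕ) {ε : ℝ} (hε : 0 < ε) :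
    ∀ᶠ n in atTop, ∀ j ≤ k, ∀ x, ‖iteratedFDeriv ℝ j
      (fun y => conjLift (w ++ scaleWord (q n) φ) α y - conjLift w α y) x‖ ≤ ε := by
  obtain ⟨C, M, hC, hb⟩ := (polyBdd_conjLift w φ).2 (k + 1)
  obtain ⟨C', M', hC', hb'⟩ := (polyBdd_conjLift w []).2 (k + 1)
  have hlim : Tendsto (fun n => C * ((q n : ℝ) ^ M * |α - p n / q n|) +
      C' * ((q n : ℝ) ^ M' * |α - p n / q n|)) atTop (𝓝 0) := by
    simpa using ((h.fast M).const_mul C).add ((h.fast M').const_mul C')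
  filter_upwards [hlim.eventually_le_const hε] with n hn j hj x
  have hq := h.q_pos n
  have h1 := norm_iteratedFDeriv_slice_sub_le _ ((polyBdd_conjLift w φ).1 (q n)) j _
    (fun y => hb (j + 1) (by omega) (by omega) (q n) hq y) α (p n / q n) x
  have h2 := norm_iteratedFDeriv_slice_sub_le _ ((polyBdd_conjLift w []).1 (q n)) j _
    (fun y => hb' (j + 1) (by omega) (by omega) (q n) hq y) α (p n / q n) x
  simp only [scaleWord, List.map_nil, List.append_nil] at h1 h2
  have hc := fun w t => contDiff_conjLift w t
  have e : (fun y => conjLift (w ++ scaleWord (q n) φ) α y - conjLift w α y) =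
      fun y => (conjLift (w ++ scaleWord (q n) φ) α y -
        conjLift (w ++ scaleWord (q n) φ) (p n / q n) y) -
        (conjLift w α y - conjLift w (p n / q n) y) := by
    ext1 y; rw [conjLift_scale w φ (q n) (by omega)]; abel
  rw [e]
  have e2 := iteratedFDeriv_sub_apply (𝕜 := ℝ) (i := j) (x := x)
    (f := fun y => conjLift (w ++ scaleWord (q n) φ) α y -
        conjLift (w ++ scaleWord (q n) φ) (p n / q n) y)
    (g := fun y => conjLift w α y - conjLift w (p n / q n) y)
    (((hc _ _).sub (hc _ _)).of_le (by exact_mod_cast le_top)).contDiffAt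
    (((hc _ _).sub (hc _ _)).of_le (by exact_mod_cast le_top)).contDiffAt
  refine (le_of_eq (congrArg norm e2)).trans ((norm_sub_le _ _).trans ?_)
  refine le_trans (add_le_add h1 h2) (le_trans (le_of_eq ?_) hn)
  ring

/-! ### Equidistribution -/

section Equidistribution

lemma intervalIntegrable_of_measurable_of_abs_le {f : ℝ → ℝ} (hf : Measurable f) {C : ℝ}
    (hC : ∀ x, |f x| ≤ C) (a b : ℝ) : IntervalIntegrable f volume a b :=
  (intervalIntegrable_const (c := C)).mono_fun hf.aestronglyMeasurable
    (ae_of_all _ fun x => (hC x).trans (le_abs_self C))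

lemma abs_integral_sub_le_of_forall {f g : ℝ → ℝ} (hf : IntervalIntegrable f volume 0 1)
    (hg : IntervalIntegrable g volume 0 1) {η : ℝ} (h : ∀ x ∈ Set.Icc (0 : ℝ) 1, |f x - g x| ≤ η) :
    |(∫ x in (0 : ℝ)..1, f x) - ∫ x in (0 : ℝ)..1, g x| ≤ η := by
  rw [← intervalIntegral.integral_sub hf hg]
  have := intervalIntegral.norm_integral_le_of_norm_le_const (a := (0 : ℝ)) (b := 1) (C := η)
    (f := fun x => f x - g x) (fun x hx => by
      rw [Set.uIoc_of_le zero_le_one] at hx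
      exact h x ⟨hx.1.le, hx.2⟩)
  simpa using this

lemma abs_integral_sub_const_le {f : ℝ → ℝ} (hf : IntervalIntegrable f volume 0 1) {c η : ℝ}
    (h : ∀ x ∈ Set.Icc (0 : ℝ) 1, |f x - c| ≤ η) : |(∫ x in (0 : ℝ)..1, f x) - c| ≤ η := by
  simpa using abs_integral_sub_le_of_forall hf (intervalIntegrable_const (c := c)) h

lemma integral_unit_eq_sum {g : ℝ → ℝ} (hg : ∀ a b, IntervalIntegrable g volume a b) (d : ℕ)
    (hd : 1 ≤ d) : ∫ x in (0 : ℝ)..1, g x =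
      ∑ i ∈ Finset.range d, (d : ℝ)⁻¹ * ∫ w in (0 : ℝ)..1, g ((i + w) / d) := by
  have hd' : (d : ℝ) ≠ 0 := by positivity
  have h := intervalIntegral.sum_integral_adjacent_intervals (f := g) (μ := volume)
    (a := fun i : ℕ => (i : ℝ) / d) (n := d) (fun k _ => hg _ _)
  simp only [Nat.cast_zero, zero_div, div_self hd'] at h
  rw [← h]
  refine Finset.sum_congr rfl fun i _ => ?_
  have e := intervalIntegral.integral_comp_mul_add (a := (0 : ℝ)) (b := 1) g (inv_ne_zero hd')
    ((i : ℝ) / d)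
  have e1 : (d : ℝ)⁻¹ * 1 + i / d = ((i + 1 : ℕ) : ℝ) / d := by push_cast; field_simp; ring
  have e2 : ∀ w : ℝ, (d : ℝ)⁻¹ * w + i / d = (i + w) / d := fun w => by field_simp; ring
  rw [mul_zero, zero_add, e1, inv_inv, smul_eq_mul] at e
  simp_rw [e2] at e
  rw [e, inv_mul_cancel_left₀ hd']

lemma abs_inv_mul_sum_le {d : ℕ} (hd : 1 ≤ d) {a : ℕ → ℝ} {η : ℝ} (h : ∀ i < d, |a i| ≤ η) :
    |∑ i ∈ Finset.range d, (d : ℝ)⁻¹ * a i| ≤ η := by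
  have hd' : (0 : ℝ) < d := by exact_mod_cast hd
  rw [← Finset.mul_sum, abs_mul, abs_of_pos (inv_pos.mpr hd'), inv_mul_le_iff₀ hd']
  refine (Finset.abs_sum_le_sum_abs _ _).trans
    ((Finset.sum_le_sum fun i hi => h i (Finset.mem_range.mp hi)).trans (le_of_eq ?_))
  simp

lemma measurable_integral_unit {K : ℝ → ℝ → ℝ} (hK : Measurable (Function.uncurry K)) :
    Measurable fun v => ∫ u in (0 : ℝ)..1, K v u := by
  simp_rw [intervalIntegral.integral_of_le (zero_le_one' ℝ)]
  exact (hK.stronglyMeasurable.integral_prod_right (ν := volume.restrict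
      (Set.Ioc (0 : ℝ) 1))).measurable

lemma abs_integral_unit_le {f : ℝ → ℝ} {C : ℝ} (hC : ∀ x, |f x| ≤ C) :
    |∫ u in (0 : ℝ)..1, f u| ≤ C := by
  have := intervalIntegral.norm_integral_le_of_norm_le_const (a := (0 : ℝ)) (b := 1) (C := C)
    (f := f) (fun x _ => hC x)
  simpa using this

/-- If `K v u` is periodic in `u` and nearly constant in `v` over distances `1 / k`, then `v` and
`k v` behave in `K v (k v)` like independent variables. -/
lemma abs_integral_fast_sub_le {K : ℝ → ℝ → ℝ} (hK : Measurable (Function.uncurry K)) {C : ℝ}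
    (hC : ∀ v u, |K v u| ≤ C) (hper : ∀ v, Function.Periodic (K v) 1) {k : ℕ} (hk : 1 ≤ k) {η : ℝ}
    (hη : ∀ v ∈ Set.Icc (0 : ℝ) 1, ∀ v' ∈ Set.Icc (0 : ℝ) 1, |v - v'| ≤ (k : ℝ)⁻¹ →
      ∀ u, |K v u - K v' u| ≤ η) :
    |(∫ v in (0 : ℝ)..1, K v (k * v)) - ∫ v in (0 : ℝ)..1, ∫ u in (0 : ℝ)..1, K v u| ≤ η := by
  have hk' : (0 : ℝ) < k := by exact_mod_cast hk
  have m1 : ∀ φ ψ : ℝ → ℝ, Measurable φ → Measurable ψ → Measurable fun v => K (φ v) (ψ v) :=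
    fun φ ψ h1 h2 => hK.comp (h1.prodMk h2)
  have i1 : ∀ φ ψ : ℝ → ℝ, Measurable φ → Measurable ψ → ∀ a b,
      IntervalIntegrable (fun v => K (φ v) (ψ v)) volume a b := fun φ ψ h1 h2 =>
    intervalIntegrable_of_measurable_of_abs_le (m1 φ ψ h1 h2) (fun v => hC _ _)
  have i2 : ∀ a b, IntervalIntegrable (fun v => ∫ u in (0 : ℝ)..1, K v u) volume a b :=
    intervalIntegrable_of_measurable_of_abs_le (measurable_integral_unit hK)
      (fun v => abs_integral_unit_le (hC v))
  rw [integral_unit_eq_sum (i1 (fun v => v) (fun v => k * v) (by fun_prop) (by fun_prop)) k hk,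
      integral_unit_eq_sum i2 k hk,
    ← Finset.sum_sub_distrib]
  simp_rw [← mul_sub]
  refine abs_inv_mul_sum_le hk fun i hi => ?_
  have hi' : (i : ℝ) + 1 ≤ k := by exact_mod_cast hi
  have e : ∀ w : ℝ, K ((i + w) / k) (k * ((i + w) / k)) = K ((i + w) / k) w := by
    intro w
    have : (k : ℝ) * ((i + w) / k) = w + i := by field_simp; ring
    rw [this]; simpa using (hper ((i + w) / k)).nat_mul i w
  simp_rw [e]
  have hmem : ∀ w ∈ Set.Icc (0 : ℝ) 1, (i + w) / k ∈ Set.Icc (0 : ℝ) 1 := fun w hw =>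
    ⟨by have := hw.1; positivity, by rw [div_le_one hk']; linarith [hw.2]⟩
  rw [abs_sub_comm]
  have i3 : IntervalIntegrable (fun w => ∫ u in (0 : ℝ)..1, K ((i + w) / k) u) volume 0 1 :=
    intervalIntegrable_of_measurable_of_abs_le
      ((measurable_integral_unit hK).comp (by fun_prop : Measurable fun w : ℝ => (i + w) / k))
      (fun v => abs_integral_unit_le (hC _)) _ _
  refine abs_integral_sub_const_le i3 fun w' hw' => ?_
  refine abs_integral_sub_le_of_forall (i1 _ _ (by fun_prop) (by fun_prop) _ _)
    (i1 _ _ (by fun_prop) (by fun_prop) _ _) fun u hu => ?_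
  refine hη _ (hmem w' hw') _ (hmem u hu) ?_ u
  have : ((i : ℝ) + w') / k - (i + u) / k = (w' - u) / k := by ring
  rw [this, abs_div, abs_of_pos hk', div_le_iff₀ hk', inv_mul_cancel₀ hk'.ne', abs_le]
  constructor <;> linarith [hw'.1, hw'.2, hu.1, hu.2]

lemma exists_dist_circle_le {D : UnitAddCircle → ℝ} (hD : Continuous D) {η : ℝ} (hη : 0 < η) :
    ∃ δ > 0, ∀ x y, dist x y ≤ δ → |D x - D y| ≤ η := by
  obtain ⟨δ, hδ, h⟩ := Metric.uniformContinuous_iff.mp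
    (CompactSpace.uniformContinuous_of_continuous hD) η hη
  exact ⟨δ / 2, by positivity, fun x y hxy => (h (lt_of_le_of_lt hxy (by linarith))).le⟩

lemma exists_dist_torus_le {F : Torus2 → ℝ} (hF : Continuous F) {η : ℝ} (hη : 0 < η) :
    ∃ δ > 0, ∀ x y, dist x y ≤ δ → |F x - F y| ≤ η := by
  obtain ⟨δ, hδ, h⟩ := Metric.uniformContinuous_iff.mp
    (CompactSpace.uniformContinuous_of_continuous hF) η hη
  exact ⟨δ / 2, by positivity, fun x y hxy => (h (lt_of_le_of_lt hxy (by linarith))).le⟩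

lemma exists_abs_le_torus {F : Torus2 → ℝ} (hF : Continuous F) : ∃ C, 0 ≤ C ∧ ∀ x, |F x| ≤ C := by
  obtain ⟨C, hC⟩ := isCompact_univ.exists_bound_of_continuousOn hF.continuousOn
  exact ⟨C, (norm_nonneg _).trans (hC 0 trivial), fun x => hC x trivial⟩

lemma dist_coe_add_le (u : UnitAddCircle) (a b : ℝ) :
    dist (u + (a : UnitAddCircle)) (u + (b : UnitAddCircle)) ≤ |a - b| := by
  rw [dist_add_left, dist_eq_norm, ← AddCircle.coe_sub]
  exact norm_coe_circle_le _

lemma integral_circle_eq (f : UnitAddCircle → ℝ) :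
    ∫ x, f x = ∫ x in (0 : ℝ)..1, f (x : UnitAddCircle) := by
  rw [← UnitAddCircle.intervalIntegral_preimage 0 f, zero_add]

/-- Slow Birkhoff averages over a small rotation are averages over a segment. -/
lemma exists_slow_average_close {D : UnitAddCircle → ℝ} (hD : Continuous D) {η : ℝ} (hη : 0 < η) :
    ∃ τ₀ > 0, ∀ τ : ℝ, |τ| ≤ τ₀ → ∀ N : ℕ, 1 ≤ N → ∀ u : UnitAddCircle,
      |(N : ℝ)⁻¹ * ∑ k ∈ Finset.range N, D (u + ((k * τ : ℝ) : UnitAddCircle)) -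
        ∫ w in (0 : ℝ)..1, D (u + ((N * τ * w : ℝ) : UnitAddCircle))| ≤ η := by
  obtain ⟨δ, hδ, h⟩ := exists_dist_circle_le hD hη
  refine ⟨δ, hδ, fun τ hτ N hN u => ?_⟩
  have hN' : (0 : ℝ) < N := by exact_mod_cast hN
  have hc : ∀ φ : ℝ → ℝ, Continuous φ → Continuous fun w => D (u + ((φ w : ℝ) : UnitAddCircle)) :=
    fun φ hφ => hD.comp (continuous_const.add ((AddCircle.continuous_mk' 1).comp hφ))
  rw [integral_unit_eq_sum (fun a b => (hc _ (by fun_prop)).intervalIntegrable a b) N hN,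
    Finset.mul_sum, ← Finset.sum_sub_distrib]
  simp_rw [← mul_sub]
  refine abs_inv_mul_sum_le hN fun i hi => ?_
  rw [abs_sub_comm]
  refine abs_integral_sub_const_le ((hc _ (by fun_prop)).intervalIntegrable _ _) fun w hw => ?_
  refine h _ _ ((dist_coe_add_le _ _ _).trans ?_)
  have : (N : ℝ) * τ * ((i + w) / N) - i * τ = w * τ := by field_simp; ring
  rw [this, abs_mul]
  refine (mul_le_of_le_one_left (abs_nonneg _) ?_).trans hτ
  rw [abs_of_nonneg hw.1]; exact hw.2

lemma abs_sum_sub_sum_shift_le {a : ℕ → ℝ} {M : ℝ} (hM : ∀ k, |a k| ≤ M) (N l : ℕ) :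
    |∑ k ∈ Finset.range N, a k - ∑ k ∈ Finset.range N, a (k + l)| ≤ 2 * M * l := by
  induction l with
  | zero => simp
  | succ l ih =>
    have h1 := Finset.sum_range_succ (fun k => a (k + l)) N
    have h2 := Finset.sum_range_succ' (fun k => a (k + l)) N
    have e : ∑ k ∈ Finset.range N, a (k + (l + 1)) =
        ∑ k ∈ Finset.range N, a (k + l) + a (N + l) - a l := by
      rw [h1] at h2
      simp only [zero_add] at h2
      have : ∀ k, k + 1 + l = k + (l + 1) := fun k => by ring
      simp_rw [this] at h2
      linarith
    rw [e]
    have h3 := abs_le.mp ih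
    have h4 := abs_le.mp (hM (N + l))
    have h5 := abs_le.mp (hM l)
    rw [abs_le]; push_cast
    constructor <;> nlinarith [h3.1, h3.2, h4.1, h4.2, h5.1, h5.2]

/-- Birkhoff sums may be replaced by sums of averages over `L` consecutive terms. -/
lemma abs_sum_sub_sum_average_le {a : ℕ → ℝ} {M : ℝ} (hM : ∀ k, |a k| ≤ M) (N : ℕ) {L : ℕ}
    (hL : 1 ≤ L) :
    |∑ k ∈ Finset.range N, a k -
      ∑ k ∈ Finset.range N, ∑ l ∈ Finset.range L, (L : ℝ)⁻¹ * a (k + l)| ≤ 2 * M * L := by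
  have hM0 : 0 ≤ M := (abs_nonneg _).trans (hM 0)
  have hL' : (L : ℝ) ≠ 0 := by positivity
  have e : ∑ k ∈ Finset.range N, a k -
      ∑ k ∈ Finset.range N, ∑ l ∈ Finset.range L, (L : ℝ)⁻¹ * a (k + l) =
      ∑ l ∈ Finset.range L, (L : ℝ)⁻¹ *
        (∑ k ∈ Finset.range N, a k - ∑ k ∈ Finset.range N, a (k + l)) := by
    simp_rw [mul_sub]
    rw [Finset.sum_sub_distrib, Finset.sum_const, Finset.card_range, nsmul_eq_mul,
      mul_inv_cancel_left₀ hL', Finset.sum_comm]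
    simp_rw [Finset.mul_sum]
  rw [e]
  refine abs_inv_mul_sum_le hL fun l hl => (abs_sum_sub_sum_shift_le hM N l).trans ?_
  have : (l : ℝ) ≤ L := by exact_mod_cast hl.le
  nlinarith

lemma Irrational.exists_rat_close {α : ℝ} (hα : Irrational α) (D : ℕ) :
    ∃ r : ℚ, D ≤ r.den ∧ |α - r| * r.den * (D + 1) ≤ 1 := by
  obtain ⟨ε, hε, h⟩ := (((hα.eventually_forall_le_dist_cast_rat_of_den_le D).filter_mono
    nhdsWithin_le_nhds).and (self_mem_nhdsWithin : Set.Ioi (0 : ℝ) ∈ 𝓝[>] 0)).exists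
  obtain ⟨n, hn⟩ := exists_nat_gt (max ((ε : ℝ)⁻¹) (D : ℝ))
  have hn1 : (D : ℝ) < n := (le_max_right _ _).trans_lt hn
  have hn2 : (ε : ℝ)⁻¹ < n := (le_max_left _ _).trans_lt hn
  have hn0 : (0 : ℝ) < n := lt_of_le_of_lt (Nat.cast_nonneg D) hn1
  obtain ⟨r, hr1, hr2⟩ := Real.exists_rat_abs_sub_le_and_den_le α (n := n) (by exact_mod_cast hn0)
  have hd : (0 : ℝ) < r.den := by exact_mod_cast r.den_pos
  have hd1 : (1 : ℝ) ≤ r.den := by exact_mod_cast r.den_pos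
  have key : |α - r| * ((n + 1) * r.den) ≤ 1 := by
    rw [le_div_iff₀ (by positivity)] at hr1; exact hr1
  refine ⟨r, ?_, ?_⟩
  · by_contra! hlt
    have h1 : ε ≤ |α - r| := hε r hlt.le
    have h2 : (0 : ℝ) < ε := h
    have h3 : 1 < ε * n := by rwa [inv_lt_iff_one_lt_mul₀' h2] at hn2
    have h4 : ε * (n * 1) ≤ |α - r| * ((n + 1) * r.den) := by
      gcongr
      linarith
    linarith
  · refine le_trans ?_ key
    rw [mul_assoc, mul_comm (r.den : ℝ)]
    gcongr

lemma sum_range_eq_sum_zmod {d : ℕ} [NeZero d] (f : ZMod d → ℝ) :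
    ∑ l ∈ Finset.range d, f l = ∑ x : ZMod d, f x := by
  refine Finset.sum_bij' (fun l _ => (l : ZMod d)) (fun x _ => x.val) (by simp) ?_ ?_ (by simp)
    (by simp)
  · intro x _; simpa using x.val_lt
  · intro l hl; exact ZMod.val_cast_of_lt (Finset.mem_range.mp hl)

lemma sum_rat_rotation (r : ℚ) (f : UnitAddCircle → ℝ) :
    ∑ l ∈ Finset.range r.den, f ((l * (r : ℝ) : ℝ) : UnitAddCircle) =
      ∑ l ∈ Finset.range r.den, f ((l / r.den : ℝ) : UnitAddCircle) := by
  have : NeZero r.den := ⟨r.den_nz⟩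
  have hd : (r.den : ℝ) ≠ 0 := by exact_mod_cast r.den_nz
  have e : ∀ j : ℤ, ZMod.toAddCircle (N := r.den) (j : ZMod r.den) =
      ((j / r.den : ℝ) : UnitAddCircle) :=
    fun j => ZMod.toAddCircle_intCast j
  have h1 : ∀ l : ℕ, f ((l * (r : ℝ) : ℝ) : UnitAddCircle) =
      (fun x : ZMod r.den => f (ZMod.toAddCircle (x * (r.num : ZMod r.den)))) (l : ZMod r.den) := by
    intro l
    have := e (l * r.num)
    push_cast at this
    simp only [this]
    congr 2
    rw [Rat.cast_def]; ring
  have h2 : ∀ l : ℕ, f ((l / r.den : ℝ) : UnitAddCircle) =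
      (fun x : ZMod r.den => f (ZMod.toAddCircle x)) (l : ZMod r.den) := by
    intro l
    have := e l
    push_cast at this
    simp only [this]
  simp_rw [h1, h2]
  rw [sum_range_eq_sum_zmod (fun x : ZMod r.den => f (ZMod.toAddCircle (x * (r.num : ZMod r.den)))),
    sum_range_eq_sum_zmod (fun x : ZMod r.den => f (ZMod.toAddCircle x))]
  have hu : IsUnit (r.num : ZMod r.den) := by
    have := (ZMod.isUnit_iff_coprime _ _).mpr r.reduced
    rcases Int.natAbs_eq r.num with h | h
    · rw [h]; simpa using this
    · rw [h]; simpa using this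
  obtain ⟨u, hu⟩ := hu
  rw [← hu]
  exact Equiv.sum_comp (Units.mulRight u) (fun x : ZMod r.den => f (ZMod.toAddCircle x))

/-- The average of a function over the horizontal circle at height `y`. -/
noncomputable def fiberMean (F : Torus2 → ℝ) (y : UnitAddCircle) : ℝ :=
  ∫ s : UnitAddCircle, F (s, y)

lemma continuous_fiberMean {F : Torus2 → ℝ} (hF : Continuous F) : Continuous (fiberMean F) := by
  obtain ⟨C, _, hC⟩ := exists_abs_le_torus hF
  refine continuous_of_dominated (bound := fun _ => C)
    (fun y => (hF.comp (by fun_prop)).aestronglyMeasurable)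
    (fun y => ae_of_all _ fun s => hC _) (integrable_const C)
    (ae_of_all _ fun s => hF.comp (by fun_prop))

lemma abs_fiberMean_le {F : Torus2 → ℝ} {C : ℝ} (hC : ∀ x, |F x| ≤ C) (y : UnitAddCircle) :
    |fiberMean F y| ≤ C := by
  rw [fiberMean, integral_circle_eq]
  exact abs_integral_unit_le fun x => hC _

lemma integral_fiberMean {F : Torus2 → ℝ} (hF : Continuous F) : ∫ y, fiberMean F y = ∫ x, F x := by
  rw [Measure.volume_eq_prod, integral_prod_symm]
  · rfl
  · obtain ⟨C, _, hC⟩ := exists_abs_le_torus hF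
    rw [← Measure.volume_eq_prod]
    exact (integrable_const C).mono' hF.aestronglyMeasurable (ae_of_all _ hC)

/-- Birkhoff averages of an irrational rotation converge uniformly, also in a parameter. -/
lemma exists_uniform_average {α : ℝ} (hα : Irrational α) {F : Torus2 → ℝ} (hF : Continuous F)
    {η : ℝ} (hη : 0 < η) : ∃ L : ℕ, 1 ≤ L ∧ ∀ z y : UnitAddCircle,
      |∑ l ∈ Finset.range L, (L : ℝ)⁻¹ * F (z + ((l * α : ℝ) : UnitAddCircle), y) -
        fiberMean F y| ≤ η := by
  obtain ⟨δ, hδ, h⟩ := exists_dist_torus_le hF (half_pos hη)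
  obtain ⟨D, hD⟩ := exists_nat_gt δ⁻¹
  obtain ⟨r, hr1, hr2⟩ := hα.exists_rat_close (D + 1)
  have hd : (0 : ℝ) < r.den := by exact_mod_cast r.den_pos
  have hDδ : 1 ≤ δ * D := by rw [inv_lt_iff_one_lt_mul₀' hδ] at hD; exact hD.le
  have hrδ : (r.den : ℝ)⁻¹ ≤ δ := by
    rw [inv_le_iff_one_le_mul₀' hd]
    have : (D : ℝ) + 1 ≤ r.den := by exact_mod_cast hr1
    nlinarith
  refine ⟨r.den, r.den_pos, fun z y => ?_⟩
  -- first replace the rotation by `α` by the rotation by `r`, then compare with the integral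
  have h1 : |∑ l ∈ Finset.range r.den, (r.den : ℝ)⁻¹ * F (z + ((l * α : ℝ) : UnitAddCircle), y) -
      ∑ l ∈ Finset.range r.den, (r.den : ℝ)⁻¹ * F (z + ((l * (r : ℝ) : ℝ) : UnitAddCircle), y)| ≤
      η / 2 := by
    rw [← Finset.sum_sub_distrib]
    simp_rw [← mul_sub]
    refine abs_inv_mul_sum_le r.den_pos fun l hl => h _ _ ?_
    rw [Prod.dist_eq, dist_self]
    refine max_le ((dist_coe_add_le _ _ _).trans ?_) hδ.le
    rw [← mul_sub, abs_mul, Nat.abs_cast]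
    have hl' : (l : ℝ) ≤ r.den := by exact_mod_cast hl.le
    have h2 : (l : ℝ) * |α - r| ≤ |α - r| * r.den := by
      rw [mul_comm]; exact mul_le_mul_of_nonneg_left hl' (abs_nonneg _)
    push_cast at hr2
    have h3 : |α - r| * r.den * D ≤ 1 := by
      have : 0 ≤ |α - r| * r.den := by positivity
      nlinarith
    have hD0 : (0 : ℝ) < D := lt_trans (inv_pos.mpr hδ) hD
    by_contra! hlt
    nlinarith
  have h2 : |∑ l ∈ Finset.range r.den, (r.den : ℝ)⁻¹ *
      F (z + ((l / r.den : ℝ) : UnitAddCircle), y) -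
      fiberMean F y| ≤ η / 2 := by
    have hc : Continuous fun x : ℝ => F (z + (x : UnitAddCircle), y) :=
      hF.comp ((continuous_const.add (AddCircle.continuous_mk' 1)).prodMk continuous_const)
    have e : fiberMean F y = ∫ x in (0 : ℝ)..1, F (z + (x : UnitAddCircle), y) := by
      rw [← integral_circle_eq (fun x => F (z + x, y)), fiberMean]
      exact (integral_add_left_eq_self (fun x => F (x, y)) z).symm
    rw [e, integral_unit_eq_sum (fun a b => hc.intervalIntegrable a b) r.den r.den_pos,
      ← Finset.sum_sub_distrib]
    simp_rw [← mul_sub]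
    refine abs_inv_mul_sum_le r.den_pos fun l hl => ?_
    rw [abs_sub_comm]
    refine abs_integral_sub_const_le ((hc.comp (by fun_prop : Continuous fun w : ℝ =>
      ((l : ℝ) + w) / r.den)).intervalIntegrable _ _) fun w hw => h _ _ ?_
    rw [Prod.dist_eq, dist_self]
    refine max_le ((dist_coe_add_le _ _ _).trans (le_trans ?_ hrδ)) hδ.le
    have : ((l : ℝ) + w) / r.den - l / r.den = w * (r.den : ℝ)⁻¹ := by ring
    rw [this, abs_of_nonneg (mul_nonneg hw.1 (by positivity))]
    exact mul_le_of_le_one_left (by positivity) hw.2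
  have h3 := sum_rat_rotation r fun s => (r.den : ℝ)⁻¹ * F (z + s, y)
  rw [h3] at h1
  calc _ ≤ _ := abs_sub_le _ _ _
    _ ≤ η / 2 + η / 2 := add_le_add h1 h2
    _ = η := by ring

/-- Along an orbit of a rotation by `α`, whose height is steered slowly by `Y`, long averages of `F`
are averages of the fibre means of `F`. The length needed does not depend on `Y`. -/
lemma exists_average_sub_fiberMean_le {α : ℝ} (hα : Irrational α) {F : Torus2 → ℝ}
    (hF : Continuous F) {η : ℝ} (hη : 0 < η) : ∃ N₀ : ℕ, 1 ≤ N₀ ∧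
      ∀ Y : UnitAddCircle → UnitAddCircle, Continuous Y → ∃ τ₀ > 0, ∀ τ : ℝ, |τ| ≤ τ₀ →
        ∀ N : ℕ, N₀ ≤ N → ∀ z u : UnitAddCircle,
        |(N : ℝ)⁻¹ * ∑ k ∈ Finset.range N, F (z + ((k * α : ℝ) : UnitAddCircle),
            Y (u + ((k * τ : ℝ) : UnitAddCircle))) -
          (N : ℝ)⁻¹ * ∑ k ∈ Finset.range N, fiberMean F (Y (u + ((k * τ : ℝ) : UnitAddCircle)))| ≤
          η := by
  obtain ⟨C, hC0, hC⟩ := exists_abs_le_torus hF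
  obtain ⟨L, hL, hLF⟩ := exists_uniform_average hα hF (η := η / 3) (by positivity)
  obtain ⟨N₀, hN₀⟩ := exists_nat_gt (4 * C * L / (η / 3))
  refine ⟨N₀ + 1, by omega, fun Y hY => ?_⟩
  have hL' : (0 : ℝ) < L := by exact_mod_cast hL
  let K : Torus2 → ℝ := fun x => F (x.1, Y x.2) - fiberMean F (Y x.2)
  have hK : Continuous K := (hF.comp (by fun_prop)).sub
    ((continuous_fiberMean hF).comp (hY.comp continuous_snd))
  obtain ⟨δ, hδ, h⟩ := exists_dist_torus_le hK (η := η / 3) (by positivity)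
  refine ⟨δ / L, by positivity, fun τ hτ N hN z u => ?_⟩
  have hN' : (0 : ℝ) < N := by exact_mod_cast (by omega : 0 < N)
  set a : ℕ → ℝ := fun k => K (z + ((k * α : ℝ) : UnitAddCircle),
    u + ((k * τ : ℝ) : UnitAddCircle)) with ha
  have hKb : ∀ x, |K x| ≤ 2 * C := fun x => by
    refine (abs_sub _ _).trans ?_
    linarith [hC (x.1, Y x.2), abs_fiberMean_le hC (Y x.2)]
  have h1 := abs_sum_sub_sum_average_le (a := a) (fun k => hKb _) N hL
  have h2 : ∀ k, |∑ l ∈ Finset.range L, (L : ℝ)⁻¹ * a (k + l)| ≤ 2 * (η / 3) := by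
    intro k
    have h3 : |∑ l ∈ Finset.range L, (L : ℝ)⁻¹ * a (k + l) - ∑ l ∈ Finset.range L, (L : ℝ)⁻¹ *
        K (z + ((k * α : ℝ) : UnitAddCircle) + ((l * α : ℝ) : UnitAddCircle),
          u + ((k * τ : ℝ) : UnitAddCircle))| ≤ η / 3 := by
      rw [← Finset.sum_sub_distrib]
      simp_rw [← mul_sub]
      refine abs_inv_mul_sum_le hL fun l hl => h _ _ ?_
      have e1 : z + (((k + l : ℕ) * α : ℝ) : UnitAddCircle) =
          z + ((k * α : ℝ) : UnitAddCircle) + ((l * α : ℝ) : UnitAddCircle) := by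
        rw [add_assoc, ← AddCircle.coe_add]; congr 2; push_cast; ring
      rw [e1, Prod.dist_eq, dist_self]
      refine max_le hδ.le ((dist_coe_add_le _ _ _).trans ?_)
      have : ((k + l : ℕ) : ℝ) * τ - k * τ = l * τ := by push_cast; ring
      rw [this, abs_mul, Nat.abs_cast]
      have hl' : (l : ℝ) ≤ L := by exact_mod_cast hl.le
      calc (l : ℝ) * |τ| ≤ L * (δ / L) := by gcongr
        _ = δ := by field_simp
    have h4 : |∑ l ∈ Finset.range L, (L : ℝ)⁻¹ *
        K (z + ((k * α : ℝ) : UnitAddCircle) + ((l * α : ℝ) : UnitAddCircle),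
          u + ((k * τ : ℝ) : UnitAddCircle))| ≤ η / 3 := by
      have := hLF (z + ((k * α : ℝ) : UnitAddCircle)) (Y (u + ((k * τ : ℝ) : UnitAddCircle)))
      refine le_trans (le_of_eq ?_) this
      simp only [K, mul_sub, Finset.sum_sub_distrib, Finset.sum_const, Finset.card_range,
        nsmul_eq_mul, mul_inv_cancel_left₀ hL'.ne']
    have := abs_sub_abs_le_abs_sub (∑ l ∈ Finset.range L, (L : ℝ)⁻¹ * a (k + l))
      (∑ l ∈ Finset.range L, (L : ℝ)⁻¹ *
        K (z + ((k * α : ℝ) : UnitAddCircle) + ((l * α : ℝ) : UnitAddCircle),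
          u + ((k * τ : ℝ) : UnitAddCircle)))
    linarith
  have h5 : |∑ k ∈ Finset.range N, a k| ≤ N * η := by
    have h6 : |∑ k ∈ Finset.range N, ∑ l ∈ Finset.range L, (L : ℝ)⁻¹ * a (k + l)| ≤
        N * (2 * (η / 3)) := by
      refine (Finset.abs_sum_le_sum_abs _ _).trans ((Finset.sum_le_sum fun k _ => h2 k).trans ?_)
      simp
    have h7 : 4 * C * L ≤ N * (η / 3) := by
      rw [div_lt_iff₀ (by positivity)] at hN₀
      have : (N₀ : ℝ) ≤ N := by exact_mod_cast (by omega : N₀ ≤ N)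
      nlinarith
    have h8 := abs_sub_abs_le_abs_sub (∑ k ∈ Finset.range N, a k)
      (∑ k ∈ Finset.range N, ∑ l ∈ Finset.range L, (L : ℝ)⁻¹ * a (k + l))
    linarith
  rw [← mul_sub, ← Finset.sum_sub_distrib, abs_mul, abs_of_pos (inv_pos.mpr hN'),
    inv_mul_le_iff₀ hN']
  exact h5

end Equidistribution

/-! ### Averages over windows of arbitrary length -/

section Windows

lemma integral_window_le_of_pos {χ : ℝ → ℝ} (hper : Function.Periodic χ 1)
    (hint : ∀ a b, IntervalIntegrable χ volume a b) (h0 : ∀ v, 0 ≤ χ v) {U : ℝ} (hU : 0 < U) :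
    ∫ w in (0 : ℝ)..1, χ (U * w) ≤ (1 + 1 / U) * ∫ v in (0 : ℝ)..1, χ v := by
  have h1 : ∫ w in (0 : ℝ)..1, χ (U * w) = U⁻¹ * ∫ v in (0 : ℝ)..U, χ v := by
    rw [intervalIntegral.integral_comp_mul_left _ hU.ne']; simp
  have h2 : ∫ v in (0 : ℝ)..U, χ v ≤ ∫ v in (0 : ℝ)..(⌈U⌉₊ : ℝ), χ v :=
    intervalIntegral.integral_mono_interval le_rfl hU.le (Nat.le_ceil U)
      (ae_of_all _ h0) (hint _ _)
  have h3 : ∫ v in (0 : ℝ)..(⌈U⌉₊ : ℝ), χ v = ⌈U⌉₊ * ∫ v in (0 : ℝ)..1, χ v := by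
    have := hper.intervalIntegral_add_zsmul_eq (⌈U⌉₊ : ℤ) 0 hint
    simpa using this
  have h4 : 0 ≤ ∫ v in (0 : ℝ)..1, χ v :=
    intervalIntegral.integral_nonneg zero_le_one fun v _ => h0 v
  have h5 : (⌈U⌉₊ : ℝ) ≤ U + 1 := (Nat.ceil_lt_add_one hU.le).le
  rw [h1]
  calc U⁻¹ * ∫ v in (0 : ℝ)..U, χ v ≤ U⁻¹ * ((U + 1) * ∫ v in (0 : ℝ)..1, χ v) := by
        gcongr
        rw [h3] at h2
        exact h2.trans (mul_le_mul_of_nonneg_right h5 h4)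
    _ = (1 + 1 / U) * ∫ v in (0 : ℝ)..1, χ v := by field_simp

/-- The average over any window starting at `0` of a nonnegative periodic function vanishing near
`0` is controlled by its integral over a period. -/
lemma integral_window_le {χ : ℝ → ℝ} (hper : Function.Periodic χ 1)
    (hint : ∀ a b, IntervalIntegrable χ volume a b) (h0 : ∀ v, 0 ≤ χ v) {ρ : ℝ} (hρ : 0 < ρ)
    (hz : ∀ v, |v| < ρ → χ v = 0) (U : ℝ) :
    ∫ w in (0 : ℝ)..1, χ (U * w) ≤ (1 + 1 / ρ) * ∫ v in (0 : ℝ)..1, χ v := by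
  have h4 : 0 ≤ ∫ v in (0 : ℝ)..1, χ v :=
    intervalIntegral.integral_nonneg zero_le_one fun v _ => h0 v
  rcases lt_or_ge |U| ρ with hU | hU
  · have : ∫ w in (0 : ℝ)..1, χ (U * w) = 0 := by
      rw [intervalIntegral.integral_congr (g := fun _ => (0 : ℝ))]
      · simp
      · intro w hw
        rw [Set.uIcc_of_le zero_le_one] at hw
        refine hz _ (lt_of_le_of_lt ?_ hU)
        rw [abs_mul, abs_of_nonneg hw.1]
        exact mul_le_of_le_one_right (abs_nonneg _) hw.2
    rw [this]; positivity
  · have hmono : ∀ V, ρ ≤ V → (1 + 1 / V) * ∫ v in (0 : ℝ)..1, χ v ≤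
        (1 + 1 / ρ) * ∫ v in (0 : ℝ)..1, χ v := fun V hV => by gcongr
    rcases le_total 0 U with h | h
    · rw [abs_of_nonneg h] at hU
      exact (integral_window_le_of_pos hper hint h0 (hρ.trans_le hU)).trans (hmono _ hU)
    · rw [abs_of_nonpos h] at hU
      have e : ∫ v in (0 : ℝ)..1, χ (-v) = ∫ v in (0 : ℝ)..1, χ v := by
        rw [intervalIntegral.integral_comp_neg]
        have := hper.intervalIntegral_add_eq (-1) 0
        simpa using this
      have := integral_window_le_of_pos (χ := fun v => χ (-v))
        (fun v => by
          show χ (-(v + 1)) = χ (-v)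
          rw [← hper (-(v + 1))]; congr 1; ring)
        (fun a b => (IntervalIntegrable.iff_comp_neg (by simp)).mpr (by simpa using hint (-a) (-b)))
            (fun v => h0 _) (hρ.trans_le hU)
      rw [e] at this
      refine le_trans (le_of_eq ?_) (this.trans (hmono _ hU))
      congr 1; ext w; congr 1; ring

/-- The average over any window of a periodic function vanishing near the start of the window is
small if its primitive stays small over one period. -/
lemma abs_integral_window_le {D : ℝ → ℝ} (hper : Function.Periodic D 1)
    (hint : ∀ a b, IntervalIntegrable D volume a b) {c : ℝ}
    (hc : ∀ x ∈ Set.Icc (0 : ℝ) 1, |∫ v in (0 : ℝ)..x, D v| ≤ c) {u₀ ρ : ℝ}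
    (hu₀ : u₀ ∈ Set.Icc (0 : ℝ) 1) (hρ : 0 < ρ)
    (hz : ∀ v, |v| < ρ → D (u₀ + v) = 0) (U : ℝ) :
    |∫ w in (0 : ℝ)..1, D (u₀ + U * w)| ≤ c * (1 + 6 / ρ) := by
  have hc0 : 0 ≤ c := (abs_nonneg _).trans (hc 0 ⟨le_rfl, zero_le_one⟩)
  have hP : ∀ x : ℝ, |∫ v in (0 : ℝ)..x, D v| ≤ c * (|x| + 2) := by
    intro x
    have e1 : ∫ v in (0 : ℝ)..(⌊x⌋ : ℝ), D v = ⌊x⌋ * ∫ v in (0 : ℝ)..1, D v := by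
      have := hper.intervalIntegral_add_zsmul_eq ⌊x⌋ 0 hint
      simpa using this
    have e2 : ∫ v in (⌊x⌋ : ℝ)..x, D v = ∫ v in (0 : ℝ)..Int.fract x, D v := by
      have h := intervalIntegral.integral_comp_add_right (a := 0) (b := Int.fract x) D (⌊x⌋ : ℝ)
      rw [zero_add, Int.fract_add_floor] at h
      rw [← h]
      congr 1; ext v; simpa using hper.int_mul ⌊x⌋ v
    rw [← intervalIntegral.integral_add_adjacent_intervals (hint 0 ⌊x⌋) (hint _ x), e1, e2]
    have h1 := hc 1 ⟨zero_le_one, le_rfl⟩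
    have h2 := hc (Int.fract x) ⟨Int.fract_nonneg x, (Int.fract_lt_one x).le⟩
    have h3 : |(⌊x⌋ : ℝ)| ≤ |x| + 1 := by
      have h3 := Int.fract_nonneg x
      have h4 := (Int.fract_lt_one x).le
      have h5 : (⌊x⌋ : ℝ) = x - Int.fract x := by rw [Int.self_sub_fract]
      rw [h5]
      refine (abs_sub _ _).trans ?_
      rw [abs_of_nonneg h3]; linarith
    refine (abs_add_le _ _).trans ?_
    rw [abs_mul]
    calc _ ≤ (|x| + 1) * c + c := by gcongr
      _ = c * (|x| + 2) := by ring
  rcases lt_or_ge |U| ρ with hU | hU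
  · have : ∫ w in (0 : ℝ)..1, D (u₀ + U * w) = 0 := by
      rw [intervalIntegral.integral_congr (g := fun _ => (0 : ℝ))]
      · simp
      · intro w hw
        rw [Set.uIcc_of_le zero_le_one] at hw
        refine hz _ (lt_of_le_of_lt ?_ hU)
        rw [abs_mul, abs_of_nonneg hw.1]
        exact mul_le_of_le_one_right (abs_nonneg _) hw.2
    rw [this, abs_zero]; positivity
  · have hU0 : 0 < |U| := hρ.trans_le hU
    have hU1 : U ≠ 0 := abs_pos.mp hU0
    have e : ∫ w in (0 : ℝ)..1, D (u₀ + U * w) =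
        U⁻¹ * ((∫ v in (0 : ℝ)..(u₀ + U), D v) - ∫ v in (0 : ℝ)..u₀, D v) := by
      rw [intervalIntegral.integral_comp_add_mul _ hU1,
        intervalIntegral.integral_interval_sub_left (hint _ _) (hint _ _)]
      simp
    rw [e, abs_mul, abs_inv]
    have h1 := hP (u₀ + U)
    have h2 := hP u₀
    have h3 : |u₀| ≤ 1 := abs_le.mpr ⟨by linarith [hu₀.1], hu₀.2⟩
    have h4 : |u₀ + U| ≤ 1 + |U| := (abs_add_le _ _).trans (by linarith)
    have h5 : |(∫ v in (0 : ℝ)..(u₀ + U), D v) - ∫ v in (0 : ℝ)..u₀, D v| ≤ c * (|U| + 6) := by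
      refine (abs_sub _ _).trans ?_
      nlinarith
    calc |U|⁻¹ * _ ≤ |U|⁻¹ * (c * (|U| + 6)) := by gcongr
      _ = c * (1 + 6 / |U|) := by field_simp
      _ ≤ c * (1 + 6 / ρ) := by gcongr

/-- The average of a continuous mean-zero function along a fast linear motion is small. -/
lemma abs_integral_ramp_le {D : ℝ → ℝ} (hD : Continuous D) (hper : Function.Periodic D 1) {C : ℝ}
    (hC : ∀ x, |D x| ≤ C) (h0 : ∫ x in (0 : ℝ)..1, D x = 0) {A : ℝ} (hA : 0 < A) (a b : ℝ) :
    |∫ σ in a..b, D (A * σ)| ≤ 2 * C / A := by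
  have hint : ∀ a b, IntervalIntegrable D volume a b := fun a b => hD.intervalIntegrable a b
  have hP : ∀ x : ℝ, |∫ v in (0 : ℝ)..x, D v| ≤ C := by
    intro x
    have e1 : ∫ v in (0 : ℝ)..(⌊x⌋ : ℝ), D v = 0 := by
      have := hper.intervalIntegral_add_zsmul_eq ⌊x⌋ 0 hint
      simpa [h0] using this
    rw [← intervalIntegral.integral_add_adjacent_intervals (hint 0 ⌊x⌋) (hint _ x), e1, zero_add]
    have := intervalIntegral.norm_integral_le_of_norm_le_const (a := (⌊x⌋ : ℝ)) (b := x) (C := C)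
      (f := D) (fun v _ => hC v)
    refine this.trans ?_
    have hC0 : 0 ≤ C := (abs_nonneg _).trans (hC 0)
    refine mul_le_of_le_one_right hC0 ?_
    rw [Int.self_sub_floor, abs_of_nonneg (Int.fract_nonneg x)]
    exact (Int.fract_lt_one x).le
  rw [intervalIntegral.integral_comp_mul_left _ hA.ne', smul_eq_mul, abs_mul, abs_inv,
    abs_of_pos hA, ← intervalIntegral.integral_interval_sub_left (hint 0 _) (hint 0 _)]
  have h1 := hP (A * b)
  have h2 := hP (A * a)
  have h3 := (abs_sub (∫ v in (0 : ℝ)..(A * b), D v) (∫ v in (0 : ℝ)..(A * a), D v))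
  rw [div_eq_inv_mul]
  gcongr
  linarith

/-- Window averages of a function that differs from a constant only on a small set. -/
lemma abs_window_sub_const_le {D : UnitAddCircle → ℝ} (hD : Measurable D) {C d : ℝ}
    {B : Set UnitAddCircle} (hB : MeasurableSet B) (hC : ∀ u ∈ B, |D u - d| ≤ C) {e : ℝ}
        (he : 0 ≤ e)
    (hd : ∀ u ∉ B, |D u - d| ≤ e) {u₀ : UnitAddCircle} {ρ : ℝ} (hρ : 0 < ρ) (hC0 : 0 ≤ C)
    (hz : ∀ v : ℝ, |v| < ρ → u₀ + (v : UnitAddCircle) ∉ B) (U : ℝ) :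
    |(∫ w in (0 : ℝ)..1, D (u₀ + ((U * w : ℝ) : UnitAddCircle))) - d| ≤
      e + C * ((1 + 1 / ρ) * (volume B).toReal) := by
  set χ : ℝ → ℝ := fun v => B.indicator (fun _ => (1 : ℝ)) (u₀ + (v : UnitAddCircle)) with hχ
  have hm : Measurable fun v : ℝ => u₀ + (v : UnitAddCircle) :=
    measurable_const.add AddCircle.measurable_mk'
  have hχm : Measurable χ := (measurable_const.indicator hB).comp hm
  have hχb : ∀ v, |χ v| ≤ 1 := fun v => by
    simp only [hχ, Set.indicator]; split_ifs <;> simp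
  have hχ0 : ∀ v, 0 ≤ χ v := fun v => by
    simp only [hχ, Set.indicator]; split_ifs <;> simp
  have hper : Function.Periodic χ 1 := fun v => by simp [hχ]
  have hi : ∀ a b, IntervalIntegrable χ volume a b :=
    intervalIntegrable_of_measurable_of_abs_le hχm hχb
  have h1 := integral_window_le hper hi hχ0 hρ
    (fun v hv => Set.indicator_of_notMem (hz v hv) _) U
  have h2 : ∫ v in (0 : ℝ)..1, χ v = (volume B).toReal := by
    simp only [hχ]
    rw [← integral_circle_eq (fun v => B.indicator (fun _ => (1 : ℝ)) (u₀ + v)),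
      integral_add_left_eq_self (fun v => B.indicator (fun _ => (1 : ℝ)) v) u₀,
      integral_indicator hB]
    simp [Measure.real]
  rw [h2] at h1
  have hUm : Measurable fun w : ℝ => U * w := by fun_prop
  have hDb : ∀ u, |D u| ≤ e + C + |d| := fun u => by
    have : |D u - d| ≤ e + C := by
      by_cases hu : u ∈ B
      · linarith [hC u hu]
      · linarith [hd u hu]
    have h3 := abs_sub_abs_le_abs_sub (D u) d
    linarith
  have iD : IntervalIntegrable (fun w : ℝ => D (u₀ + ((U * w : ℝ) : UnitAddCircle))) volume 0 1 :=
    intervalIntegrable_of_measurable_of_abs_le ((hD.comp hm).comp hUm) (fun w => hDb _) _ _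
  have iχ : IntervalIntegrable (fun w : ℝ => χ (U * w)) volume 0 1 :=
    intervalIntegrable_of_measurable_of_abs_le (hχm.comp hUm) (fun w => hχb _) _ _
  have e1 : (∫ w in (0 : ℝ)..1, D (u₀ + ((U * w : ℝ) : UnitAddCircle))) - d =
      ∫ w in (0 : ℝ)..1, (D (u₀ + ((U * w : ℝ) : UnitAddCircle)) - d) := by
    rw [intervalIntegral.integral_sub iD intervalIntegrable_const]; simp
  have e2 : e + C * ∫ w in (0 : ℝ)..1, χ (U * w) = ∫ w in (0 : ℝ)..1, (e + C * χ (U * w)) := by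
    rw [intervalIntegral.integral_add intervalIntegrable_const (iχ.const_mul C),
      intervalIntegral.integral_const_mul]
    simp
  rw [e1]
  refine le_trans ?_ (add_le_add le_rfl (mul_le_mul_of_nonneg_left h1 hC0))
  rw [e2, ← Real.norm_eq_abs]
  refine intervalIntegral.norm_integral_le_of_norm_le zero_le_one
    (ae_of_all _ fun w _ => ?_) (intervalIntegrable_const.add (iχ.const_mul C))
  rw [Real.norm_eq_abs]
  by_cases hu : u₀ + ((U * w : ℝ) : UnitAddCircle) ∈ B
  · simp only [hχ, Set.indicator_of_mem hu, mul_one]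
    linarith [hC _ hu]
  · simp only [hχ, Set.indicator_of_notMem hu, mul_zero, add_zero]
    exact hd _ hu

end Windows

/-! ### Periodic functions with prescribed plateaus -/

section Plateau

/-- The representative in `[0, 1)` of a point of the circle. -/
noncomputable def rep (u : UnitAddCircle) : ℝ := AddCircle.equivIco 1 0 u

lemma rep_mem (u : UnitAddCircle) : rep u ∈ Set.Ico (0 : ℝ) 1 := by
  have := (AddCircle.equivIco 1 0 u).2
  exact ⟨this.1, this.2.trans_eq (zero_add 1)⟩

@[simp] lemma coe_rep (u : UnitAddCircle) : (rep u : UnitAddCircle) = u :=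
  AddCircle.coe_equivIco

lemma rep_coe (x : ℝ) : rep (x : UnitAddCircle) = Int.fract x := by
  simp [rep]

lemma rep_coe_of_mem {x : ℝ} (hx : x ∈ Set.Ico (0 : ℝ) 1) : rep (x : UnitAddCircle) = x := by
  rw [rep_coe, Int.fract_eq_self.mpr hx]

lemma measurable_rep : Measurable rep :=
  measurable_subtype_coe.comp (AddCircle.measurableEquivIco 1 0).measurable

lemma PerFun.circ_eq (g : PerFun) (u : UnitAddCircle) : g.circ u = g.f (rep u) := by
  conv_lhs => rw [← coe_rep u]
  exact g.circ_coe _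

/-- A smooth function supported inside `(0, 1)` extends periodically. -/
lemma exists_periodization {f : ℝ → ℝ} (hf : ContDiff ℝ ∞ f) {a b : ℝ} (ha : 0 < a) (hb : b < 1)
    (hz : ∀ x, x ∉ Set.Icc a b → f x = 0) : ∃ g : PerFun, ∀ x ∈ Set.Ico (0 : ℝ) 1, g.f x = f x := by
  refine ⟨⟨fun x => f (Int.fract x), contDiff_iff_contDiffAt.mpr fun x => ?_, fun x => by simp⟩,
    fun x hx => by simp [Int.fract_eq_self.mpr hx]⟩
  rcases eq_or_ne (Int.fract x) 0 with h | h
  · obtain ⟨n, rfl⟩ : ∃ n : ℤ, (n : ℝ) = x := ⟨⌊x⌋, by rw [← Int.self_sub_fract, h, sub_zero]⟩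
    refine (contDiffAt_const (c := (0 : ℝ))).congr_of_eventuallyEq ?_
    filter_upwards [Ioo_mem_nhds (show (n : ℝ) - (1 - b) < n by linarith)
      (show (n : ℝ) < n + min a 1 by linarith [lt_min ha one_pos])] with y hy
    refine hz _ fun hmem => ?_
    rcases le_or_gt (n : ℝ) y with h1 | h1
    · have h3 : y < n + 1 := hy.2.trans_le (by linarith [min_le_right a 1])
      have h2 : Int.fract y = y - n := by
        rw [Int.fract_eq_iff]
        exact ⟨by linarith, by linarith, n, by ring⟩
      have := hmem.1
      linarith [hy.2, min_le_left a 1]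
    · have h2 : Int.fract y = y - n + 1 := by
        rw [Int.fract_eq_iff]
        have h4 := hmem.1
        have h5 := hmem.2
        refine ⟨?_, by linarith, n - 1, by push_cast; ring⟩
        linarith [hy.1, (Int.fract_nonneg y).trans h5]
      have := hmem.2
      linarith [hy.1]
  · have h0 : 0 < Int.fract x := lt_of_le_of_ne (Int.fract_nonneg x) (Ne.symm h)
    refine ContDiffAt.congr_of_eventuallyEq (f := fun y => f (y - ⌊x⌋))
      (hf.comp (contDiff_id.sub contDiff_const)).contDiffAt ?_
    have hx1 : (⌊x⌋ : ℝ) < x := by rw [← Int.self_sub_fract]; linarith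
    filter_upwards [Ioo_mem_nhds hx1 (Int.lt_floor_add_one x)] with y hy
    have : ⌊y⌋ = ⌊x⌋ := Int.floor_eq_iff.mpr ⟨hy.1.le, hy.2⟩
    rw [← Int.self_sub_floor, this]

/-- A smooth periodic function that agrees with `m` on `[a + κ, b - κ]`, vanishes off `(a, b)`
modulo `1`, and is dominated by `m` on `[0, 1)`. -/
lemma exists_plateau {m : ℝ → ℝ} (hm : ContDiff ℝ ∞ m) {a b κ : ℝ} (ha : 0 ≤ a) (hb : b ≤ 1)
    (hκ : 0 < κ) (h : 2 * κ < b - a) : ∃ g : PerFun,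
      (∀ x ∈ Set.Icc (a + κ) (b - κ), g.f x = m x) ∧
      (∀ x ∈ Set.Icc (0 : ℝ) 1, x ∉ Set.Ioo a b → g.f x = 0) ∧
      ∀ x ∈ Set.Ico (0 : ℝ) 1, |g.f x| ≤ |m x| := by
  let χ : ContDiffBump ((a + b) / 2) :=
    ⟨(b - a) / 2 - κ, (b - a) / 2 - κ / 2, by linarith, by linarith⟩
  have hχz : ∀ x, x ∉ Set.Icc (a + κ / 2) (b - κ / 2) → χ x = 0 := by
    intro x hx
    refine χ.zero_of_le_dist ?_
    show (b - a) / 2 - κ / 2 ≤ dist x _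
    rw [Real.dist_eq, le_abs]
    by_contra! hlt
    exact hx ⟨by linarith, by linarith⟩
  obtain ⟨g, hg⟩ := exists_periodization (f := fun x => m x * χ x) (hm.mul χ.contDiff)
    (a := a + κ / 2) (b := b - κ / 2) (by linarith) (by linarith)
    (fun x hx => by simp [hχz x hx])
  refine ⟨g, fun x hx => ?_, fun x hx hx' => ?_, fun x hx => ?_⟩
  · rw [hg x ⟨by linarith [hx.1], by linarith [hx.2]⟩, χ.one_of_mem_closedBall, mul_one]
    rw [Metric.mem_closedBall, Real.dist_eq, abs_le]
    show -((b - a) / 2 - κ) ≤ _ ∧ _ ≤ (b - a) / 2 - κ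
    exact ⟨by linarith [hx.1], by linarith [hx.2]⟩
  · have key : ∀ y ∈ Set.Ico (0 : ℝ) 1, y ∉ Set.Ioo a b → g.f y = 0 := fun y hy hy' => by
      rw [hg y hy, hχz y, mul_zero]
      exact fun hmem => hy' ⟨by linarith [hmem.1], by linarith [hmem.2]⟩
    rcases eq_or_lt_of_le hx.2 with rfl | h1
    · have := g.per 0
      rw [zero_add] at this
      rw [this]
      exact key 0 ⟨le_rfl, one_pos⟩ fun h0 => by linarith [h0.1]
    · exact key x ⟨hx.1, h1⟩ hx'
  · rw [hg x hx, abs_mul]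
    refine mul_le_of_le_one_right (abs_nonneg _) ?_
    rw [abs_of_nonneg χ.nonneg]; exact χ.le_one

lemma exists_rep_mem_Ico (y : UnitAddCircle) (a : ℝ) :
    ∃ t ∈ Set.Ico a (a + 1), (t : UnitAddCircle) = y :=
  ⟨AddCircle.equivIco 1 a y, (AddCircle.equivIco 1 a y).2, AddCircle.coe_equivIco⟩

/-- A periodic function supported on a short interval that takes every value modulo `1`. -/
lemma exists_covering_bump {δ : ℝ} (hδ : 0 < δ) (hδ1 : δ ≤ 1) : ∃ g : PerFun,
    (∀ x ∈ Set.Icc δ 1, g.f x = 0) ∧ ∀ y : UnitAddCircle, ∃ u : ℝ, (g.f u : UnitAddCircle) = y := by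
  obtain ⟨g, h1, h2, -⟩ := exists_plateau (m := fun x => 2 / δ * x)
    (contDiff_const.mul contDiff_id) (a := 0) (b := δ) (κ := δ / 4) le_rfl hδ1 (by linarith)
    (by linarith)
  refine ⟨g, fun x hx => h2 x ⟨hδ.le.trans hx.1, hx.2⟩ fun h => by linarith [h.2, hx.1],
    fun y => ?_⟩
  obtain ⟨t, ht, rfl⟩ := exists_rep_mem_Ico y (1 / 2)
  refine ⟨t * δ / 2, ?_⟩
  rw [h1]
  · congr 1; field_simp
  · constructor <;> nlinarith [ht.1, ht.2]

end Plateau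

/-! ### A sweep: making one circle more equidistributed -/

section Sweep

/-- The heights along the image of the circle `x₂ = 0` under a word. -/
noncomputable def track (φ : List Shear) (u : UnitAddCircle) : UnitAddCircle :=
    (evalWord φ (u, 0)).2

lemma continuous_track (φ : List Shear) : Continuous (track φ) :=
  continuous_snd.comp ((continuous_evalWord φ).comp (by fun_prop))

lemma exists_coe_eq_norm_eq (y : UnitAddCircle) :
    ∃ t ∈ Set.Ico (-1 / 2 : ℝ) (1 / 2), (t : UnitAddCircle) = y ∧ ‖y‖ = |t| := by
  obtain ⟨t, ht, rfl⟩ := exists_rep_mem_Ico y (-1 / 2)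
  refine ⟨t, ⟨ht.1, by linarith [ht.2]⟩, rfl, ?_⟩
  have := (AddCircle.norm_coe_eq_abs_iff (p := (1 : ℝ)) (x := t) one_ne_zero).mpr
  refine this ?_
  rw [abs_one, abs_le]
  constructor <;> linarith [ht.1, ht.2]

/-- A smooth function on the circle equal to `1 / 2` near `0` and supported near `0`. -/
lemma exists_half_bump {κ : ℝ} (hκ : 0 < κ) (hκ1 : κ ≤ 1 / 4) : ∃ a : PerFun,
    (∀ y : UnitAddCircle, ‖y‖ ≤ κ / 2 → a.circ y = 1 / 2) ∧ ∀ y : UnitAddCircle, κ ≤ ‖y‖ →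
        a.circ y = 0 := by
  obtain ⟨g, h1, h2, -⟩ := exists_plateau (m := fun _ => 1 / 2) contDiff_const (a := 1 / 2 - κ)
    (b := 1 / 2 + κ) (κ := κ / 2) (by linarith) (by linarith) (by linarith) (by linarith)
  let a : PerFun := ⟨fun x => g.f (x + 1 / 2), g.smooth.comp (contDiff_id.add contDiff_const),
    fun x => by
      show g.f (x + 1 + 1 / 2) = g.f (x + 1 / 2)
      rw [add_right_comm]; exact g.per _⟩
  have ha : ∀ t : ℝ, a.circ (t : UnitAddCircle) = g.f (t + 1 / 2) := fun t => a.circ_coe t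
  refine ⟨a, fun y hy => ?_, fun y hy => ?_⟩
  · obtain ⟨t, ht, rfl, e⟩ := exists_coe_eq_norm_eq y
    rw [e, abs_le] at hy
    rw [ha]
    exact h1 _ ⟨by linarith [hy.1], by linarith [hy.2]⟩
  · obtain ⟨t, ht, rfl, e⟩ := exists_coe_eq_norm_eq y
    rw [e] at hy
    rw [ha]
    refine h2 _ ⟨by linarith [ht.1], by linarith [ht.2]⟩ fun hmem => ?_
    have : |t| < κ := abs_lt.mpr ⟨by linarith [hmem.1], by linarith [hmem.2]⟩
    linarith

lemma exists_small_annulus {g : UnitAddCircle → UnitAddCircle} (hg : Continuous g) {ε : ℝ}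
    (hε : 0 < ε) : ∃ κ₀ > 0, ∀ κ ≤ κ₀, (volume {u | 0 < ‖g u‖ ∧ ‖g u‖ < κ}).toReal ≤ ε := by
  let s : ℕ → Set UnitAddCircle := fun n => {u | 0 < ‖g u‖ ∧ ‖g u‖ < 1 / ((n : ℝ) + 1)}
  have hm : ∀ n, NullMeasurableSet (s n) volume := fun n =>
    ((isOpen_lt continuous_const hg.norm).inter
      (isOpen_lt hg.norm continuous_const)).measurableSet.nullMeasurableSet
  have hanti : Antitone s := fun m n hmn u hu =>
    ⟨hu.1, hu.2.trans_le (one_div_le_one_div_of_le (by positivity) (by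
      have : (m : ℝ) ≤ n := by exact_mod_cast hmn
      linarith))⟩
  have hempty : ⋂ n, s n = ∅ := by
    refine Set.eq_empty_of_forall_notMem fun u hu => ?_
    rw [Set.mem_iInter] at hu
    obtain ⟨n, hn⟩ := exists_nat_one_div_lt (hu 0).1
    exact lt_irrefl _ (hn.trans (hu n).2)
  have h := tendsto_measure_iInter_atTop hm hanti ⟨0, measure_ne_top _ _⟩
  rw [hempty, measure_empty] at h
  obtain ⟨n, hn⟩ := (h.eventually_le_const (ENNReal.ofReal_pos.mpr hε)).exists
  refine ⟨1 / ((n : ℝ) + 1), by positivity, fun κ hκ => ?_⟩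
  refine ENNReal.toReal_le_of_le_ofReal hε.le ((measure_mono ?_).trans hn)
  exact fun u hu => ⟨hu.1, hu.2.trans_le hκ⟩

lemma volume_strip_le (κ : ℝ) :
    volume {x : Torus2 | ‖x.2‖ < κ} ≤ ENNReal.ofReal (2 * κ) := by
  have : {x : Torus2 | ‖x.2‖ < κ} ⊆ Set.univ ×ˢ Metric.closedBall (0 : UnitAddCircle) κ :=
    fun x hx => ⟨trivial, by rw [mem_closedBall_zero_iff]; exact hx.le⟩
  refine (measure_mono this).trans ?_
  rw [Measure.volume_eq_prod, Measure.prod_prod, AddCircle.volume_closedBall]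
  simp only [UnitAddCircle.measure_univ, one_mul]
  exact ENNReal.ofReal_le_ofReal (min_le_right _ _)

/-- The composition `V_g ∘ W_a ∘ V_g⁻¹`, where `g` is a steep ramp over half of the circle and `a`
is supported on a thin annulus, moves few points vertically; but the image of the circle `x₂ = 0`
spends half of the time near `x₂ = 0` and sweeps over the torus uniformly during the other half. -/
lemma exists_sweep {ε : ℝ} (hε : 0 < ε) : ∃ φ : List Shear,
    volume {x | (evalWord φ x).2 ≠ x.2} ≤ ENNReal.ofReal ε ∧
    track φ ((1 / 4 : ℝ) : UnitAddCircle) = 0 ∧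
    ∀ G : UnitAddCircle → ℝ, Continuous G → ∀ C, (∀ y, |G y - ∫ x, G x| ≤ C) → ∀ η,
      (∀ y, ‖y‖ ≤ ε → |G y - G 0| ≤ η) →
      (∀ U : ℝ, |(∫ w in (0 : ℝ)..1, G (track φ (((1 / 4 : ℝ) : UnitAddCircle) +
        ((U * w : ℝ) : UnitAddCircle)))) - ∫ x, G x| ≤ |G 0 - ∫ x, G x| + η + C * ε) ∧
      |(∫ u, G (track φ u)) - ∫ x, G x| ≤ |G 0 - ∫ x, G x| / 2 + η + C * ε := by
  -- `A` is congruent to `2` modulo `4`, so that the ramp passes through `1 / 2` at `1 / 4`.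
  obtain ⟨n, hn⟩ := exists_nat_gt (200 / ε)
  set A : ℝ := 4 * n + 2 with hA
  have hn0 : (0 : ℝ) ≤ n := Nat.cast_nonneg n
  have hA0 : 0 < A := by positivity
  have hAε : 200 ≤ A * ε := by
    rw [div_lt_iff₀ hε] at hn; nlinarith
  set κ' : ℝ := min (ε / 400) (1 / 8) with hκ'
  have hκ'0 : 0 < κ' := lt_min (by positivity) (by norm_num)
  have hκ'1 : κ' ≤ ε / 400 := min_le_left _ _
  have hκ'2 : κ' ≤ 1 / 8 := min_le_right _ _
  obtain ⟨g, hg1, hg2, -⟩ := exists_plateau (m := fun x => A * x) (contDiff_const.mul contDiff_id)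
    (a := 0) (b := 1 / 2) (κ := κ') le_rfl (by norm_num) hκ'0 (by linarith)
  have hgR : ∀ u : UnitAddCircle, 1 / 2 ≤ rep u → g.circ u = 0 := fun u hu => by
    rw [g.circ_eq]
    exact hg2 _ ⟨(rep_mem u).1, (rep_mem u).2.le⟩ fun h => by linarith [h.2]
  have hgc : Continuous fun u => ((g.circ u : ℝ) : UnitAddCircle) :=
    (AddCircle.continuous_mk' 1).comp g.continuous_circ
  obtain ⟨κ₀, hκ₀, hB₀⟩ := exists_small_annulus hgc (ε := ε / (2 * (1 + 4 * A))) (by positivity)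
  set κ : ℝ := min κ₀ (min (ε / 2) (1 / 4)) with hκ
  have hκ0 : 0 < κ := lt_min hκ₀ (lt_min (by positivity) (by norm_num))
  have hκ1 : κ ≤ ε / 2 := (min_le_right _ _).trans (min_le_left _ _)
  have hκ2 : κ ≤ 1 / 4 := (min_le_right _ _).trans (min_le_right _ _)
  obtain ⟨a, ha1, ha2⟩ := exists_half_bump hκ0 hκ2
  set B : Set UnitAddCircle :=
    {u | κ / 2 < ‖((g.circ u : ℝ) : UnitAddCircle)‖ ∧
        ‖((g.circ u : ℝ) : UnitAddCircle)‖ < κ} with hB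
  have hBm : MeasurableSet B := ((isOpen_lt continuous_const hgc.norm).inter
      (isOpen_lt hgc.norm continuous_const)).measurableSet
  have hBv : (1 + 4 * A) * (volume B).toReal ≤ ε / 2 := by
    have h1 : (volume B).toReal ≤ ε / (2 * (1 + 4 * A)) := by
      refine le_trans (ENNReal.toReal_mono (measure_ne_top _ _) (measure_mono ?_))
        (hB₀ κ (min_le_left _ _))
      exact fun u hu => ⟨lt_trans (by positivity) hu.1, hu.2⟩
    rw [le_div_iff₀ (by positivity)] at h1
    linarith
  set φ : List Shear := [.V g, .W a, .V (-g)] with hφ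
  have hY : ∀ x : Torus2, (evalWord φ x).2 = x.2 - ((g.circ x.1 : ℝ) : UnitAddCircle) +
      ((g.circ (x.1 + ((a.circ (x.2 - ((g.circ x.1 : ℝ) : UnitAddCircle)) : ℝ) : UnitAddCircle)) :
          ℝ) :
        UnitAddCircle) := by
    intro x
    simp [hφ, sub_eq_add_neg]
  have htrack : ∀ u : UnitAddCircle, track φ u = - ((g.circ u : ℝ) : UnitAddCircle) +
      ((g.circ (u + ((a.circ (- ((g.circ u : ℝ) : UnitAddCircle)) : ℝ) : UnitAddCircle)) : ℝ) :
        UnitAddCircle) := by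
    intro u
    rw [track, hY]; simp
  have hhalf : ∀ u : UnitAddCircle, rep u < 1 / 2 →
      g.circ (u + ((1 / 2 : ℝ) : UnitAddCircle)) = 0 := by
    intro u hu
    refine hgR _ ?_
    have h0 := (rep_mem u).1
    have : u + ((1 / 2 : ℝ) : UnitAddCircle) = ((rep u + 1 / 2 : ℝ) : UnitAddCircle) := by
      rw [AddCircle.coe_add, coe_rep]
    rw [this, rep_coe_of_mem ⟨by linarith, by linarith⟩]
    linarith
  -- the first half: the track stays near `0` outside `B`
  have hleft : ∀ u : UnitAddCircle, rep u < 1 / 2 → u ∉ B → ‖track φ u‖ ≤ ε := by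
    intro u hu huB
    rw [htrack]
    rcases le_or_gt κ ‖((g.circ u : ℝ) : UnitAddCircle)‖ with h | h
    · rw [ha2 _ (by rwa [norm_neg])]
      simpa using hε.le
    · have h' : ‖((g.circ u : ℝ) : UnitAddCircle)‖ ≤ κ / 2 := by
        by_contra! h2; exact huB ⟨h2, h⟩
      rw [ha1 _ (by rwa [norm_neg]), hhalf u hu]
      simp only [AddCircle.coe_zero, add_zero, norm_neg]
      linarith
  -- the second half: the track follows the ramp
  have hright : ∀ u : UnitAddCircle, 1 / 2 ≤ rep u →
      track φ u = ((g.f (rep u - 1 / 2) : ℝ) : UnitAddCircle) := by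
    intro u hu
    rw [htrack, hgR u hu]
    simp only [AddCircle.coe_zero, neg_zero, zero_add]
    rw [ha1 0 (by rw [norm_zero]; positivity)]
    have h1 := (rep_mem u).2
    have : u + ((1 / 2 : ℝ) : UnitAddCircle) = ((rep u - 1 / 2 : ℝ) : UnitAddCircle) := by
      have h2 : ((1 / 2 : ℝ) : UnitAddCircle) = -((1 / 2 : ℝ) : UnitAddCircle) := by
        rw [eq_neg_iff_add_eq_zero, ← AddCircle.coe_add]
        norm_num
      rw [AddCircle.coe_sub, coe_rep, sub_eq_add_neg, ← h2]
    rw [this, g.circ_coe]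
  -- near `1 / 4` the ramp is near `1 / 2`, far from the annulus
  have hnear : ∀ v : ℝ, |v| < 1 / (4 * A) →
      1 / 4 ≤ ‖((g.circ (((1 / 4 : ℝ) : UnitAddCircle) + (v : UnitAddCircle)) : ℝ) :
          UnitAddCircle)‖ := by
    intro v hv
    have hv1 : |A * v| < 1 / 4 := by
      rw [abs_mul, abs_of_pos hA0]
      rw [lt_div_iff₀ (by positivity)] at hv
      linarith
    have hA2 : 2 ≤ A := by rw [hA]; linarith
    have hv2 : |v| < 1 / 8 := by
      refine hv.trans_le (one_div_le_one_div_of_le (by norm_num) (by linarith))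
    rw [abs_lt] at hv1 hv2
    rw [← AddCircle.coe_add, g.circ_coe, hg1 _ ⟨by linarith [hv2.1], by linarith [hv2.2]⟩]
    have : ((A * (1 / 4 + v) : ℝ) : UnitAddCircle) = ((1 / 2 + A * v : ℝ) : UnitAddCircle) := by
      have e : A * (1 / 4 + v) = (1 / 2 + A * v) + n := by rw [hA]; ring
      rw [e, AddCircle.coe_add]
      have : ((n : ℝ) : UnitAddCircle) = 0 := (AddCircle.coe_eq_zero_iff 1).mpr ⟨n, by simp⟩
      rw [this, add_zero]
    rw [this, UnitAddCircle.norm_eq]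
    rcases le_or_gt (A * v) 0 with h | h
    · rcases eq_or_lt_of_le h with h0 | h0
      · rw [h0, add_zero, le_abs]
        rcases le_or_gt (round (1 / 2 : ℝ)) 0 with h1 | h1
        · left
          have : ((round (1 / 2 : ℝ) : ℤ) : ℝ) ≤ 0 := by exact_mod_cast h1
          linarith
        · right
          have : (1 : ℝ) ≤ ((round (1 / 2 : ℝ) : ℤ) : ℝ) := by exact_mod_cast h1
          linarith
      · have : round (1 / 2 + A * v) = 0 := by
          rw [round_eq, Int.floor_eq_iff]; push_cast; constructor <;> linarith
        rw [this]; push_cast; rw [le_abs]; left; linarith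
    · have : round (1 / 2 + A * v) = 1 := by
        rw [round_eq, Int.floor_eq_iff]; push_cast; constructor <;> linarith
      rw [this]; push_cast; rw [le_abs]; right; linarith
  have hfr : ∀ v : ℝ, |v| < 1 / 4 →
      rep (((1 / 4 : ℝ) : UnitAddCircle) + (v : UnitAddCircle)) < 1 / 2 := by
    intro v hv
    rw [abs_lt] at hv
    rw [← AddCircle.coe_add, rep_coe_of_mem ⟨by linarith, by linarith⟩]
    linarith
  have hnotB : ∀ v : ℝ, |v| < 1 / (4 * A) →
      ((1 / 4 : ℝ) : UnitAddCircle) + (v : UnitAddCircle) ∉ B :=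
    fun v hv hmem => by linarith [hnear v hv, hmem.2]
  refine ⟨φ, ?_, ?_, fun G hG C hC η hη => ?_⟩
  · have hsub :
      {x | (evalWord φ x).2 ≠ x.2} ⊆ (Shear.V (-g)).perm ⁻¹' {x : Torus2 | ‖x.2‖ < κ} := by
      intro x hx
      by_contra hcon
      refine hx ?_
      simp only [Set.mem_preimage, Shear.perm_V, Set.mem_ofPred_eq, PerFun.neg_circ,
        AddCircle.coe_neg, not_lt, ← sub_eq_add_neg] at hcon
      rw [hY, ha2 _ hcon]; simp
    refine (measure_mono hsub).trans ?_
    have hms : MeasurableSet {x : Torus2 | ‖x.2‖ < κ} :=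
      (isOpen_lt continuous_snd.norm continuous_const).measurableSet
    rw [(Shear.V (-g)).measurePreserving_perm.measure_preimage hms.nullMeasurableSet]
    exact (volume_strip_le κ).trans (ENNReal.ofReal_le_ofReal (by linarith))
  · have h := hnear 0 (by rw [abs_zero]; positivity)
    rw [AddCircle.coe_zero, add_zero] at h
    rw [htrack, ha2 _ (by rw [norm_neg]; linarith)]
    simp
  -- split the deviation from the mean into the contributions of the two halves
  set M : ℝ := ∫ x, G x with hM
  have hC0 : 0 ≤ C := (abs_nonneg _).trans (hC 0)
  have hη0 : 0 ≤ η := (abs_nonneg _).trans (hη 0 (by simpa using hε.le))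
  set Da : UnitAddCircle → ℝ := fun u => if rep u < 1 / 2 then G (track φ u) - M else 0 with hDa
  set Db : UnitAddCircle → ℝ := fun u =>
    if rep u < 1 / 2 then 0 else G ((g.f (rep u - 1 / 2) : ℝ) : UnitAddCircle) - M with hDb
  have hsplit : ∀ u, G (track φ u) = Da u + Db u + M := by
    intro u
    simp only [hDa, hDb]
    split_ifs with h
    · ring
    · rw [hright u (not_lt.mp h)]; ring
  have hset : MeasurableSet {u : UnitAddCircle | rep u < 1 / 2} :=
    measurableSet_lt measurable_rep measurable_const
  have mDa : Measurable Da := Measurable.ite hset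
    ((hG.comp (continuous_track φ)).measurable.sub measurable_const) measurable_const
  have mDb : Measurable Db := Measurable.ite hset measurable_const
    (((hG.comp ((AddCircle.continuous_mk' 1).comp g.smooth.continuous)).measurable.comp
      (measurable_rep.sub measurable_const)).sub measurable_const)
  have bDa : ∀ u, |Da u| ≤ C := fun u => by
    simp only [hDa]; split_ifs
    · exact hC _
    · simpa using hC0
  have bDb : ∀ u, |Db u| ≤ C := fun u => by
    simp only [hDb]; split_ifs
    · simpa using hC0
    · exact hC _
  set e : ℝ := |G 0 - M| with he
  have hDaB : ∀ u ∉ B, |Da u| ≤ e + η := fun u hu => by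
    simp only [hDa]
    split_ifs with h
    · have h1 := hη _ (hleft u h hu)
      have h2 := abs_add_le (G (track φ u) - G 0) (G 0 - M)
      rw [sub_add_sub_cancel] at h2
      linarith
    · simpa using by positivity
  have mcoe : Measurable fun v : ℝ => (v : UnitAddCircle) := AddCircle.measurable_mk'
  have iDb : ∀ a b, IntervalIntegrable (fun v : ℝ => Db v) volume a b :=
    intervalIntegrable_of_measurable_of_abs_le (mDb.comp mcoe) (fun v => bDb _)
  have iDa : ∀ a b, IntervalIntegrable (fun v : ℝ => Da v) volume a b :=
    intervalIntegrable_of_measurable_of_abs_le (mDa.comp mcoe) (fun v => bDa _)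
  set c : ℝ := C * (2 / A + 4 * κ') with hc
  have hcε : c * 25 ≤ C * ε / 2 := by
    have h1 : 2 / A ≤ ε / 100 := by
      rw [div_le_iff₀ hA0]; linarith
    have : (2 / A + 4 * κ') * 25 ≤ ε / 2 := by linarith
    calc c * 25 = C * ((2 / A + 4 * κ') * 25) := by rw [hc]; ring
      _ ≤ C * (ε / 2) := by gcongr
      _ = C * ε / 2 := by ring
  -- the primitive of `Db` is small, since the ramp is equidistributed
  have hprim : ∀ x ∈ Set.Icc (0 : ℝ) 1, |∫ v in (0 : ℝ)..x, Db v| ≤ c := by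
    have hzero : ∀ x ∈ Set.Icc (0 : ℝ) (1 / 2), ∫ v in (0 : ℝ)..x, Db v = 0 := by
      intro x hx
      have : ∫ v in (0 : ℝ)..x, Db v = ∫ v in (0 : ℝ)..x, (0 : ℝ) := by
        refine intervalIntegral.integral_congr_ae ?_
        filter_upwards [(measure_eq_zero_iff_ae_notMem.mp
          (measure_singleton (μ := (volume : Measure ℝ)) (1 / 2)))] with v hv hvm
        rw [Set.uIoc_of_le hx.1] at hvm
        have hv' : v < 1 / 2 := lt_of_le_of_ne (hvm.2.trans hx.2) hv
        simp only [hDb, rep_coe_of_mem (⟨hvm.1.le, by linarith⟩ : v ∈ Set.Ico (0 : ℝ) 1), hv',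
          if_true]
      rw [this]; simp
    have hc0 : 0 ≤ c := by positivity
    intro x hx
    rcases le_or_gt x (1 / 2) with h | h
    · rw [hzero x ⟨hx.1, h⟩, abs_zero]; exact hc0
    rw [← intervalIntegral.integral_add_adjacent_intervals (iDb 0 (1 / 2)) (iDb _ x),
      hzero _ ⟨by norm_num, le_rfl⟩, zero_add]
    set D1 : ℝ → ℝ := fun σ => G ((g.f σ : ℝ) : UnitAddCircle) - M with hD1
    set D2 : ℝ → ℝ := fun σ => G ((A * σ : ℝ) : UnitAddCircle) - M with hD2
    have cD1 : Continuous D1 :=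
      (hG.comp ((AddCircle.continuous_mk' 1).comp g.smooth.continuous)).sub continuous_const
    have cD2 : Continuous D2 :=
      (hG.comp ((AddCircle.continuous_mk' 1).comp (continuous_const.mul continuous_id))).sub
        continuous_const
    have e1 : ∫ v in (1 / 2 : ℝ)..x, Db v = ∫ σ in (0 : ℝ)..(x - 1 / 2), D1 σ := by
      have := intervalIntegral.integral_comp_sub_right (a := (1 / 2 : ℝ)) (b := x) D1 (1 / 2)
      rw [sub_self] at this
      rw [← this]
      refine intervalIntegral.integral_congr_ae ?_
      filter_upwards [(measure_eq_zero_iff_ae_notMem.mp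
          (measure_singleton (μ := (volume : Measure ℝ)) 1))] with v hv hvm
      rw [Set.uIoc_of_le h.le] at hvm
      have hv' : v < 1 := lt_of_le_of_ne (hvm.2.trans hx.2) hv
      simp only [hDb, hD1, rep_coe_of_mem (⟨by linarith [hvm.1], hv'⟩ : v ∈ Set.Ico (0 : ℝ) 1),
        not_lt.mpr hvm.1.le, if_false]
    have e2 : |∫ σ in (0 : ℝ)..(x - 1 / 2), D2 σ| ≤ 2 * C / A := by
      have cG : Continuous fun t : ℝ => G (t : UnitAddCircle) :=
          hG.comp (AddCircle.continuous_mk' 1)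
      refine abs_integral_ramp_le (D := fun t : ℝ => G (t : UnitAddCircle) - M)
        (cG.sub continuous_const) (fun t => by simp) (fun t => hC _) ?_ hA0 _ _
      rw [intervalIntegral.integral_sub (cG.intervalIntegrable _ _) intervalIntegrable_const,
        ← integral_circle_eq]
      simp [hM]
    have e3 : |(∫ σ in (0 : ℝ)..(x - 1 / 2), D1 σ) - ∫ σ in (0 : ℝ)..(x - 1 / 2), D2 σ| ≤
        4 * C * κ' := by
      have cD : Continuous fun σ => |D1 σ - D2 σ| := (cD1.sub cD2).abs
      have hi : ∀ a b, IntervalIntegrable (fun σ => |D1 σ - D2 σ|) volume a b :=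
        fun a b => cD.intervalIntegrable a b
      have hb : ∀ σ, |D1 σ - D2 σ| ≤ 2 * C := fun σ => by
        refine (abs_sub _ _).trans ?_
        linarith [hC ((g.f σ : ℝ) : UnitAddCircle), hC ((A * σ : ℝ) : UnitAddCircle)]
      rw [← intervalIntegral.integral_sub (cD1.intervalIntegrable _ _) (cD2.intervalIntegrable _ _)]
      refine (intervalIntegral.abs_integral_le_integral_abs (by linarith)).trans ?_
      refine (intervalIntegral.integral_mono_interval (c := 0) (d := 1 / 2) le_rfl (by linarith)
        (by linarith [hx.2]) (ae_of_all _ fun σ => abs_nonneg _) (hi _ _)).trans ?_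
      rw [← intervalIntegral.integral_add_adjacent_intervals (hi 0 κ') (hi κ' (1 / 2)),
        ← intervalIntegral.integral_add_adjacent_intervals (hi κ' (1 / 2 - κ')) (hi _ (1 / 2))]
      have f1 := intervalIntegral.integral_mono_on hκ'0.le (hi 0 κ')
        (intervalIntegrable_const (c := 2 * C)) (fun σ _ => hb σ)
      have f2 := intervalIntegral.integral_mono_on (by linarith : 1 / 2 - κ' ≤ 1 / 2) (hi _ _)
        (intervalIntegrable_const (c := 2 * C)) (fun σ _ => hb σ)
      have f3 : ∫ σ in κ'..(1 / 2 - κ'), |D1 σ - D2 σ| = 0 := by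
        rw [intervalIntegral.integral_congr (g := fun _ => (0 : ℝ))]
        · simp
        · intro σ hσ
          rw [Set.uIcc_of_le (by linarith)] at hσ
          simp only [hD1, hD2]
          rw [hg1 σ ⟨by linarith [hσ.1], hσ.2⟩]
          simp
      rw [f3]
      simp only [intervalIntegral.integral_const, smul_eq_mul] at f1 f2
      linarith
    rw [e1]
    have := abs_sub_abs_le_abs_sub (∫ σ in (0 : ℝ)..(x - 1 / 2), D1 σ)
      (∫ σ in (0 : ℝ)..(x - 1 / 2), D2 σ)
    have e4 : c = 2 * C / A + 4 * C * κ' := by rw [hc]; ring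
    rw [e4]; linarith
  constructor
  · intro U
    have hUm : Measurable fun w : ℝ => ((1 / 4 : ℝ) : UnitAddCircle) +
        ((U * w : ℝ) : UnitAddCircle) :=
      measurable_const.add (mcoe.comp (by fun_prop))
    have i1 := intervalIntegrable_of_measurable_of_abs_le (mDa.comp hUm) (fun w => bDa _) 0 1
    have i2 := intervalIntegrable_of_measurable_of_abs_le (mDb.comp hUm) (fun w => bDb _) 0 1
    simp only [Function.comp_def] at i1 i2
    simp_rw [hsplit]
    rw [intervalIntegral.integral_add (i1.add i2) intervalIntegrable_const,
      intervalIntegral.integral_add i1 i2]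
    have h1 := abs_window_sub_const_le mDa (C := C) (d := 0) hBm (fun u _ => by simpa using bDa u)
      (e := e + η) (by positivity) (fun u hu => by simpa using hDaB u hu)
      (u₀ := ((1 / 4 : ℝ) : UnitAddCircle)) (ρ := 1 / (4 * A)) (by positivity) hC0 hnotB U
    rw [sub_zero, one_div_one_div] at h1
    have h2 := abs_integral_window_le (D := fun v : ℝ => Db v) (fun v => by simp) iDb hprim
      (u₀ := 1 / 4) (ρ := 1 / 4) ⟨by norm_num, by norm_num⟩ (by norm_num) (fun v hv => by
        have := hfr v hv
        rw [← AddCircle.coe_add] at this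
        simp only [hDb, this, if_true]) U
    simp only [AddCircle.coe_add] at h2
    have h3 : C * ((1 + 4 * A) * (volume B).toReal) ≤ C * (ε / 2) := by gcongr
    norm_num at h2 ⊢
    refine (abs_add_le _ _).trans ?_
    linarith
  · have h1 : ∫ u, G (track φ u) = (∫ v in (0 : ℝ)..1, Da v) + (∫ v in (0 : ℝ)..1, Db v) + M := by
      rw [integral_circle_eq]
      simp_rw [hsplit]
      rw [intervalIntegral.integral_add ((iDa 0 1).add (iDb 0 1)) intervalIntegrable_const,
        intervalIntegral.integral_add (iDa 0 1) (iDb 0 1)]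
      simp
    set χ : UnitAddCircle → ℝ := B.indicator fun _ => 1 with hχ
    have iχ : ∀ a b, IntervalIntegrable (fun v : ℝ => χ v) volume a b :=
      intervalIntegrable_of_measurable_of_abs_le ((measurable_const.indicator hBm).comp mcoe)
        (C := 1) (fun v => by simp only [hχ, Set.indicator]; split_ifs <;> simp)
    have hχ0 : ∀ u, 0 ≤ χ u := fun u => by simp only [hχ, Set.indicator]; split_ifs <;> simp
    have h2 : ∫ v in (1 / 2 : ℝ)..1, Da v = 0 := by
      have : ∫ v in (1 / 2 : ℝ)..1, Da v = ∫ v in (1 / 2 : ℝ)..1, (0 : ℝ) := by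
        refine intervalIntegral.integral_congr_ae ?_
        filter_upwards [(measure_eq_zero_iff_ae_notMem.mp
          (measure_singleton (μ := (volume : Measure ℝ)) 1))] with v hv hvm
        rw [Set.uIoc_of_le (by norm_num)] at hvm
        have hv' : v < 1 := lt_of_le_of_ne hvm.2 hv
        simp only [hDa, rep_coe_of_mem (⟨by linarith [hvm.1], hv'⟩ : v ∈ Set.Ico (0 : ℝ) 1),
          not_lt.mpr hvm.1.le, if_false]
      rw [this]; simp
    have h3 : |∫ v in (0 : ℝ)..(1 / 2), Da v| ≤ (e + η) / 2 + C * (volume B).toReal := by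
      have h4 : |∫ v in (0 : ℝ)..(1 / 2), Da v| ≤
          ∫ v in (0 : ℝ)..(1 / 2), (e + η + C * χ v) := by
        rw [← Real.norm_eq_abs]
        refine intervalIntegral.norm_integral_le_of_norm_le (by norm_num)
          (ae_of_all _ fun v _ => ?_) (intervalIntegrable_const.add ((iχ _ _).const_mul C))
        rw [Real.norm_eq_abs]
        by_cases hu : (v : UnitAddCircle) ∈ B
        · simp only [hχ, Set.indicator_of_mem hu, mul_one]
          have : 0 ≤ e + η := by positivity
          linarith [bDa v]
        · simp only [hχ, Set.indicator_of_notMem hu, mul_zero, add_zero]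
          exact hDaB _ hu
      rw [intervalIntegral.integral_add intervalIntegrable_const ((iχ _ _).const_mul C),
        intervalIntegral.integral_const_mul] at h4
      have h5 : ∫ v in (0 : ℝ)..(1 / 2), χ v ≤ ∫ v in (0 : ℝ)..1, χ v :=
        intervalIntegral.integral_mono_interval le_rfl (by norm_num) (by norm_num)
          (ae_of_all _ fun v => hχ0 _) (iχ _ _)
      have h6 : ∫ v in (0 : ℝ)..1, χ v = (volume B).toReal := by
        rw [← integral_circle_eq, hχ, integral_indicator hBm]
        simp [Measure.real]
      rw [h6] at h5
      have h7 := mul_le_mul_of_nonneg_left h5 hC0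
      simp only [intervalIntegral.integral_const, smul_eq_mul] at h4
      linarith
    have h4 := hprim 1 ⟨zero_le_one, le_rfl⟩
    have h5 : C * (volume B).toReal ≤ C * (ε / 2) := by
      refine mul_le_mul_of_nonneg_left (le_trans ?_ hBv) hC0
      refine le_mul_of_one_le_left ENNReal.toReal_nonneg ?_
      linarith
    rw [h1, ← intervalIntegral.integral_add_adjacent_intervals (iDa 0 (1 / 2)) (iDa _ 1), h2,
      add_zero, add_sub_cancel_right]
    refine (abs_add_le _ _).trans ?_
    have hc0 : 0 ≤ c := by positivity
    linarith

end Sweep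

/-! ### Cells of the circle -/

section Cells

/-- The index of the interval `[j / N, (j + 1) / N)` of the circle that contains `u`. -/
noncomputable def cell (N : ℕ) (u : UnitAddCircle) : ZMod N := (⌊N * rep u⌋ : ZMod N)

lemma cell_coe (N : ℕ) (x : ℝ) : cell N (x : UnitAddCircle) = (⌊N * x⌋ : ZMod N) := by
  have : (N : ℝ) * Int.fract x = N * x - ((N * ⌊x⌋ : ℤ) : ℝ) := by
    rw [← Int.self_sub_floor]; push_cast; ring
  rw [cell, rep_coe, this, Int.floor_sub_intCast]
  simp

lemma cell_add (N : ℕ) [NeZero N] (u : UnitAddCircle) (j : ZMod N) :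
    cell N (u + ZMod.toAddCircle j) = cell N u + j := by
  obtain ⟨m, rfl⟩ := ZMod.intCast_surjective j
  have hN : (N : ℝ) ≠ 0 := by exact_mod_cast NeZero.ne N
  rw [ZMod.toAddCircle_intCast]
  conv_lhs => rw [← coe_rep u, ← AddCircle.coe_add]
  rw [cell_coe]
  have : (N : ℝ) * (rep u + m / N) = N * rep u + m := by field_simp
  rw [this, Int.floor_add_intCast, cell]
  push_cast; rfl

lemma cell_zero (N : ℕ) : cell N 0 = 0 := by
  have := cell_coe N 0
  simpa using this

lemma cell_toAddCircle (N : ℕ) [NeZero N] (j : ZMod N) : cell N (ZMod.toAddCircle j) = j := by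
  have := cell_add N 0 j
  rwa [zero_add, cell_zero, zero_add] at this

lemma measurableSet_cell (N : ℕ) (S : Set (ZMod N)) : MeasurableSet {u | cell N u ∈ S} := by
  have h : Measurable fun u => ⌊(N : ℝ) * rep u⌋ :=
    Int.measurable_floor.comp (measurable_const.mul measurable_rep)
  exact h (MeasurableSet.of_discrete (s := {m : ℤ | (m : ZMod N) ∈ S}))

lemma volume_cell (N : ℕ) [NeZero N] (t : ZMod N) :
    volume {u : UnitAddCircle | cell N u = t} = (N : ENNReal)⁻¹ := by
  have hm : ∀ t : ZMod N, MeasurableSet {u : UnitAddCircle | cell N u = t} := fun t =>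
    measurableSet_cell N {t}
  have heq : ∀ s : ZMod N, volume {u : UnitAddCircle | cell N u = s} =
      volume {u : UnitAddCircle | cell N u = t} := by
    intro s
    rw [← (measurePreserving_add_right volume (ZMod.toAddCircle (t - s))).measure_preimage
      (hm t).nullMeasurableSet]
    congr 1
    ext u
    simp only [Set.mem_preimage, Set.mem_ofPred_eq, cell_add]
    constructor
    · intro h; rw [h]; abel
    · intro h; rw [← sub_eq_zero] at h ⊢; rw [← h]; abel
  have hsum : ∑ s : ZMod N, volume {u : UnitAddCircle | cell N u = s} = 1 := by
    rw [← tsum_fintype (L := SummationFilter.unconditional _), ← measure_iUnion]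
    · have : (⋃ s : ZMod N, {u : UnitAddCircle | cell N u = s}) = Set.univ := by
        ext u; simp
      rw [this, UnitAddCircle.measure_univ]
    · exact fun a b hab => Set.disjoint_left.mpr fun u h1 h2 => hab (h1.symm.trans h2)
    · exact hm
  simp_rw [heq] at hsum
  rw [Finset.sum_const, Finset.card_univ, ZMod.card, nsmul_eq_mul] at hsum
  exact ENNReal.eq_inv_of_mul_eq_one_left (by rwa [mul_comm])

lemma volume_rep_le {S : Set ℝ} (hS : MeasurableSet S) :
    volume {y : UnitAddCircle | rep y ∈ S} ≤ volume S := by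
  have hm : MeasurableSet {y : UnitAddCircle | rep y ∈ S} := measurable_rep hS
  rw [← (UnitAddCircle.measurePreserving_mk 0).measure_preimage hm.nullMeasurableSet,
    Measure.restrict_apply' measurableSet_Ioc]
  have hsub : ((QuotientAddGroup.mk : ℝ → UnitAddCircle) ⁻¹' {y | rep y ∈ S}) ∩ Set.Ioc 0 (0 + 1) ⊆
      S ∪ {1} := by
    rintro x ⟨hx1, hx2⟩
    rw [zero_add] at hx2
    rcases eq_or_lt_of_le hx2.2 with rfl | h
    · right; rfl
    · left
      have : rep (x : UnitAddCircle) = x := rep_coe_of_mem ⟨hx2.1.le, h⟩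
      rw [← this]; exact hx1
  refine (measure_mono hsub).trans ((measure_union_le _ _).trans ?_)
  simp

lemma volume_fst_preimage {A : Set UnitAddCircle} (hA : MeasurableSet A) :
    volume {x : Torus2 | x.1 ∈ A} = volume A :=
  haveI : IsProbabilityMeasure (volume : Measure UnitAddCircle) := ⟨UnitAddCircle.measure_univ⟩
  (measurePreserving_fst (μ := (volume : Measure UnitAddCircle))
    (ν := (volume : Measure UnitAddCircle))).measure_preimage hA.nullMeasurableSet

lemma volume_snd_preimage {A : Set UnitAddCircle} (hA : MeasurableSet A) :
    volume {x : Torus2 | x.2 ∈ A} = volume A :=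
  haveI : IsProbabilityMeasure (volume : Measure UnitAddCircle) := ⟨UnitAddCircle.measure_univ⟩
  (measurePreserving_snd (μ := (volume : Measure UnitAddCircle))
    (ν := (volume : Measure UnitAddCircle))).measure_preimage hA.nullMeasurableSet

end Cells

/-! ### Permutations of grid cells, and their approximation by shears -/

section Grid

/-- The word `φ` agrees with the permutation `P` of the torus up to a set of measure at most `ε`. -/
def AgreesUpTo (ε : ℝ) (φ : List Shear) (P : Equiv.Perm Torus2) : Prop :=
  volume {x | evalWord φ x ≠ P x} ≤ ENNReal.ofReal ε

lemma AgreesUpTo.append {ε δ : ℝ} (hε : 0 ≤ ε) (hδ : 0 ≤ δ) {φ ψ : List Shear}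
    {P Q : Equiv.Perm Torus2} (h1 : AgreesUpTo ε φ P) (h2 : AgreesUpTo δ ψ Q) :
    AgreesUpTo (ε + δ) (φ ++ ψ) (P * Q) := by
  have hsub : {x | evalWord (φ ++ ψ) x ≠ (P * Q) x} ⊆
      (evalWord ψ ⁻¹' {x | evalWord φ x ≠ P x}) ∪ {x | evalWord ψ x ≠ Q x} := by
    intro x hx
    by_contra hcon
    simp only [Set.mem_union, Set.mem_preimage, Set.mem_ofPred_eq, not_or, not_not] at hcon
    refine hx ?_
    rw [evalWord_append, Equiv.Perm.mul_apply, Equiv.Perm.mul_apply, hcon.1, hcon.2]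
  refine (measure_mono hsub).trans ((measure_union_le _ _).trans ?_)
  rw [(measurePreserving_evalWord ψ).measure_preimage_emb (measurableEmbedding_evalWord ψ),
    ENNReal.ofReal_add hε hδ]
  exact add_le_add h1 h2

lemma AgreesUpTo.inv {ε : ℝ} {φ : List Shear} {P : Equiv.Perm Torus2} (h : AgreesUpTo ε φ P) :
    AgreesUpTo ε (invWord φ) P⁻¹ := by
  have hsub : {x | evalWord (invWord φ) x ≠ P⁻¹ x} ⊆
      evalWord (invWord φ) ⁻¹' {x | evalWord φ x ≠ P x} := by
    intro x hx h
    refine hx ?_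
    rw [evalWord_inv] at h ⊢
    have h' : x = P ((evalWord φ)⁻¹ x) := by
      rw [← h]; exact ((evalWord φ).apply_symm_apply x).symm
    rw [eq_comm, Equiv.Perm.inv_eq_iff_eq]
    exact h'
  refine (measure_mono hsub).trans ?_
  rw [(measurePreserving_evalWord _).measure_preimage_emb (measurableEmbedding_evalWord _)]
  exact h

variable {N : ℕ} [NeZero N]

/-- The cell of the grid with `2` columns and `N` rows that contains a point of the torus. -/
noncomputable def gridCell (N : ℕ) (x : Torus2) : ZMod 2 × ZMod N := (cell 2 x.1, cell N x.2)

/-- The translation of the torus by `(i / 2, j / N)`. -/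
noncomputable def gridShift (c : ZMod 2 × ZMod N) : Torus2 :=
  (ZMod.toAddCircle c.1, ZMod.toAddCircle c.2)

lemma gridShift_add (c d : ZMod 2 × ZMod N) : gridShift (c + d) = gridShift c + gridShift d := by
  simp [gridShift]

lemma gridCell_add (x : Torus2) (c : ZMod 2 × ZMod N) :
    gridCell N (x + gridShift c) = gridCell N x + c := by
  simp only [gridCell, gridShift, Prod.fst_add, Prod.snd_add, cell_add]
  rfl

/-- The piecewise translation of the torus that permutes the cells of a grid. -/
noncomputable def gridPerm : Equiv.Perm (ZMod 2 × ZMod N) →* Equiv.Perm Torus2 :=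
  MonoidHom.toHomPerm
    { toFun := fun σ x => x + gridShift (σ (gridCell N x) - gridCell N x)
      map_one' := by
        funext x
        show x + gridShift (_ - _) = x
        simp [gridShift]
      map_mul' := fun σ τ => by
        funext x
        show x + _ = (x + _) + gridShift (_ - _)
        rw [gridCell_add, add_assoc, ← gridShift_add]
        congr 2
        simp }

lemma gridPerm_apply (σ : Equiv.Perm (ZMod 2 × ZMod N)) (x : Torus2) :
    gridPerm σ x = x + gridShift (σ (gridCell N x) - gridCell N x) := rfl

/-- A permutation of the cells is approximable if words of shears agree with it up to sets of
arbitrarily small measure, and fix the circle `x₂ = 0` pointwise except near `x₁ = 0, 1 / 2`. -/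
def Approximable (σ : Equiv.Perm (ZMod 2 × ZMod N)) : Prop :=
  ∀ ε : ℝ, 0 < ε → ∃ φ : List Shear, AgreesUpTo ε φ (gridPerm σ) ∧
    ∀ u : UnitAddCircle, ε ≤ ‖u‖ → ε ≤ ‖u - ((1 / 2 : ℝ) : UnitAddCircle)‖ →
      evalWord φ (u, 0) = (u, 0)

lemma Approximable.one : Approximable (1 : Equiv.Perm (ZMod 2 × ZMod N)) := fun ε _ =>
  ⟨[], by simp [AgreesUpTo], fun u _ _ => rfl⟩

lemma Approximable.mul {σ τ : Equiv.Perm (ZMod 2 × ZMod N)} (hσ : Approximable σ)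
    (hτ : Approximable τ) : Approximable (σ * τ) := fun ε hε => by
  obtain ⟨φ, h1, h2⟩ := hσ (ε / 2) (half_pos hε)
  obtain ⟨ψ, h3, h4⟩ := hτ (ε / 2) (half_pos hε)
  refine ⟨φ ++ ψ, ?_, fun u hu hu' => ?_⟩
  · rw [map_mul]
    simpa using h1.append (half_pos hε).le (half_pos hε).le h3
  · rw [evalWord_append, Equiv.Perm.mul_apply, h4 u (by linarith) (by linarith),
      h2 u (by linarith) (by linarith)]

/-- A step function on the circle, equal to `c` on `[a, b)` and to `0` elsewhere, is approximated by
smooth functions that vanish off `(a, b)`. -/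
lemma exists_smooth_step (c : ℝ) {a b : ℝ} (ha : 0 ≤ a) (hb : b ≤ 1) (hab : a < b) {ε : ℝ}
    (hε : 0 < ε) : ∃ g : PerFun, (∀ u, rep u ∉ Set.Ioo a b → g.circ u = 0) ∧
      (∀ u, rep u ∈ Set.Icc (a + ε) (b - ε) → g.circ u = c) ∧
      volume {u | g.circ u ≠ if rep u ∈ Set.Ico a b then c else 0} ≤ ENNReal.ofReal ε := by
  set κ : ℝ := min (ε / 2) ((b - a) / 4) with hκ
  have hκ0 : 0 < κ := lt_min (by positivity) (by linarith)
  have hκ1 : κ ≤ ε / 2 := min_le_left _ _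
  have hκ2 : κ ≤ (b - a) / 4 := min_le_right _ _
  obtain ⟨g, h1, h2, -⟩ := exists_plateau (m := fun _ => c) contDiff_const ha hb hκ0 (by linarith)
  have h3 : ∀ u, rep u ∉ Set.Ioo a b → g.circ u = 0 := fun u hu => by
    rw [g.circ_eq]; exact h2 _ ⟨(rep_mem u).1, (rep_mem u).2.le⟩ hu
  refine ⟨g, h3, fun u hu => ?_, ?_⟩
  · rw [g.circ_eq]; exact h1 _ ⟨by linarith [hu.1], by linarith [hu.2]⟩
  · have hsub : {u | g.circ u ≠ if rep u ∈ Set.Ico a b then c else 0} ⊆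
        {u | rep u ∈ Set.Icc a (a + κ) ∪ Set.Icc (b - κ) b} := by
      intro u hu
      by_contra hcon
      refine hu ?_
      rw [Set.mem_ofPred_eq, Set.mem_union, not_or] at hcon
      split_ifs with hmem
      · rw [g.circ_eq]
        refine h1 _ ⟨?_, ?_⟩
        · by_contra! h; exact hcon.1 ⟨hmem.1, h.le⟩
        · by_contra! h; exact hcon.2 ⟨h.le, hmem.2.le⟩
      · exact h3 u fun h => hmem ⟨h.1.le, h.2⟩
    refine (measure_mono hsub).trans ((volume_rep_le (measurableSet_Icc.union
      measurableSet_Icc)).trans ((measure_union_le _ _).trans ?_))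
    rw [Real.volume_Icc, Real.volume_Icc, ← ENNReal.ofReal_add (by linarith) (by linarith)]
    exact ENNReal.ofReal_le_ofReal (by linarith)

lemma cell_eq_iff (u : UnitAddCircle) (j : ZMod N) :
    cell N u = j ↔ rep u ∈ Set.Ico ((j.val : ℝ) / N) ((j.val + 1 : ℝ) / N) := by
  have hN : (0 : ℝ) < N := by exact_mod_cast NeZero.pos N
  have h0 := (rep_mem u).1
  have h1 := (rep_mem u).2
  have e1 : 0 ≤ ⌊(N : ℝ) * rep u⌋ := Int.floor_nonneg.mpr (by positivity)
  have e2 : ⌊(N : ℝ) * rep u⌋ < N := by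
    rw [Int.floor_lt]; push_cast; nlinarith
  obtain ⟨n, hn⟩ := Int.eq_ofNat_of_zero_le e1
  have hcell : cell N u = (n : ZMod N) := by rw [cell, hn]; simp
  have hnN : n < N := by rw [hn] at e2; exact_mod_cast e2
  have hfl : (n : ℝ) ≤ N * rep u ∧ N * rep u < n + 1 := by
    have := (Int.floor_eq_iff (a := (N : ℝ) * rep u) (z := (n : ℤ))).mp hn
    exact_mod_cast this
  rw [hcell, Set.mem_Ico, div_le_iff₀ hN, lt_div_iff₀ hN]
  constructor
  · rintro rfl
    rw [ZMod.val_cast_of_lt hnN, mul_comm (rep u)]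
    exact hfl
  · rintro ⟨h2, h3⟩
    have h4 : (j.val : ℝ) < n + 1 := by linarith [hfl.2]
    have h5 : (n : ℝ) < j.val + 1 := by linarith [hfl.1]
    have h6 : j.val = n := by
      have h4' : j.val < n + 1 := by exact_mod_cast h4
      have h5' : n < j.val + 1 := by exact_mod_cast h5
      omega
    rw [← h6, ZMod.natCast_val, ZMod.cast_id]

/-- Exchange of the two cells in row `j`. -/
def rowSwap (j : ZMod N) : Equiv.Perm (ZMod 2 × ZMod N) where
  toFun c := (c.1 + if c.2 = j then 1 else 0, c.2)
  invFun c := (c.1 - if c.2 = j then 1 else 0, c.2)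
  left_inv c := by simp
  right_inv c := by simp

/-- Cyclic shift by `d` of the cells in the left column. -/
def columnShift (d : ZMod N) : Equiv.Perm (ZMod 2 × ZMod N) where
  toFun c := (c.1, c.2 + if c.1 = 0 then d else 0)
  invFun c := (c.1, c.2 - if c.1 = 0 then d else 0)
  left_inv c := by simp
  right_inv c := by simp

lemma rowSwap_eq_swap {N : ℕ} (j : ZMod N) : rowSwap j = Equiv.swap (0, j) (1, j) := by
  ext1 ⟨i, k⟩
  rcases eq_or_ne k j with rfl | h
  · have : i = 0 ∨ i = 1 := by revert i; decide
    rcases this with rfl | rfl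
    · simp [rowSwap]
    · simp [rowSwap]; decide
  · rw [Equiv.swap_apply_of_ne_of_ne] <;> simp [rowSwap, h]

lemma exists_agreesUpTo_rowSwap (j : ZMod N) {ε : ℝ} (hε : 0 < ε) : ∃ a : PerFun,
    (∀ y, cell N y ≠ j → a.circ y = 0) ∧ AgreesUpTo ε [.W a] (gridPerm (rowSwap j)) := by
  have hN : (0 : ℝ) < N := by exact_mod_cast NeZero.pos N
  have hj : (j.val : ℝ) + 1 ≤ N := by exact_mod_cast j.val_lt
  obtain ⟨a, h1, -, h3⟩ := exists_smooth_step (1 / 2) (a := (j.val : ℝ) / N)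
      (b := (j.val + 1 : ℝ) / N)
    (by positivity) (by rwa [div_le_one hN]) (by gcongr; linarith) hε
  refine ⟨a, fun y hy => h1 y fun h => hy ((cell_eq_iff y j).mpr ⟨h.1.le, h.2⟩), ?_⟩
  have hm : MeasurableSet {u | a.circ u ≠ if rep u ∈ Set.Ico ((j.val : ℝ) / N) ((j.val + 1 : ℝ) / N)
      then 1 / 2 else 0} := by
    refine (measurableSet_eq_fun a.continuous_circ.measurable ?_).compl
    exact Measurable.ite (measurable_rep measurableSet_Ico) measurable_const measurable_const
  rw [← volume_snd_preimage hm] at h3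
  refine (measure_mono fun x hx => ?_).trans h3
  rw [Set.mem_ofPred_eq, Set.mem_ofPred_eq]
  intro hcon
  refine hx ?_
  have e :
      gridPerm (rowSwap j) x = x + gridShift (N := N) (if cell N x.2 = j then 1 else 0, 0) := by
    rw [gridPerm_apply]; congr 2; simp [rowSwap, gridCell]
  rw [e]
  simp_rw [← cell_eq_iff x.2 j] at hcon
  simp only [evalWord_cons, evalWord_nil, mul_one, Shear.perm_W, hcon]
  split_ifs with h
  · have : ZMod.toAddCircle (N := 2) 1 = ((1 / 2 : ℝ) : UnitAddCircle) := by
      have := ZMod.toAddCircle_intCast (N := 2) 1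
      push_cast at this
      simpa using this
    simp [gridShift, Prod.ext_iff, this]
  · simp [gridShift, Prod.ext_iff]

lemma cell_two_eq_zero_iff (u : UnitAddCircle) :
    cell 2 u = 0 ↔ rep u ∈ Set.Ico (0 : ℝ) (1 / 2) := by
  rw [cell_eq_iff (N := 2) u 0]; simp

lemma exists_agreesUpTo_columnShift (d : ZMod N) {ε : ℝ} (hε : 0 < ε) : ∃ g : PerFun,
    (∀ u, ε ≤ ‖u‖ → ε ≤ ‖u - ((1 / 2 : ℝ) : UnitAddCircle)‖ →
      ((g.circ u : ℝ) : UnitAddCircle) = ZMod.toAddCircle d ∨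
        ((g.circ u : ℝ) : UnitAddCircle) = 0) ∧
    AgreesUpTo ε [.V g] (gridPerm (columnShift d)) := by
  obtain ⟨g, h1, h2, h3⟩ := exists_smooth_step ((d.val : ℝ) / N) (a := 0) (b := 1 / 2)
    le_rfl (by norm_num) (by norm_num) hε
  have hd : (((d.val : ℝ) / N : ℝ) : UnitAddCircle) = ZMod.toAddCircle d := by
    have := ZMod.toAddCircle_intCast (N := N) d.val
    push_cast at this
    rw [← this, ZMod.natCast_val, ZMod.cast_id]
  refine ⟨g, fun u hu hu' => ?_, ?_⟩
  · by_cases h : rep u ∈ Set.Ioo (0 : ℝ) (1 / 2)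
    · left
      rw [h2 u, hd]
      have e1 : ‖u‖ ≤ rep u := by
        have := norm_coe_circle_le (rep u)
        rwa [coe_rep, abs_of_nonneg h.1.le] at this
      have e2 : ‖u - ((1 / 2 : ℝ) : UnitAddCircle)‖ ≤ 1 / 2 - rep u := by
        have := norm_coe_circle_le (rep u - 1 / 2)
        rwa [AddCircle.coe_sub, coe_rep, abs_of_nonpos (by linarith [h.2]), neg_sub] at this
      constructor <;> linarith
    · right; rw [h1 u h]; simp
  have hm : MeasurableSet {u | g.circ u ≠ if rep u ∈ Set.Ico (0 : ℝ) (1 / 2)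
      then (d.val : ℝ) / N else 0} := by
    refine (measurableSet_eq_fun g.continuous_circ.measurable ?_).compl
    exact Measurable.ite (measurable_rep measurableSet_Ico) measurable_const measurable_const
  rw [← volume_fst_preimage hm] at h3
  refine (measure_mono fun x hx => ?_).trans h3
  rw [Set.mem_ofPred_eq, Set.mem_ofPred_eq]
  intro hcon
  refine hx ?_
  have e : gridPerm (columnShift d) x = x + gridShift (0, if cell 2 x.1 = 0 then d else 0) := by
    rw [gridPerm_apply]; congr 2; simp [columnShift, gridCell]
  rw [e]
  simp_rw [← cell_two_eq_zero_iff] at hcon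
  simp only [evalWord_cons, evalWord_nil, mul_one, Shear.perm_V, hcon]
  split_ifs with h
  · rw [hd]; simp [gridShift, Prod.ext_iff]
  · simp [gridShift, Prod.ext_iff]

/-- The exchange of a left cell and a right cell, neither of them in row `0`, is the conjugate of a
row exchange by a column shift. -/
lemma approximable_swap_left_right {i j : ZMod N} (hi : i ≠ 0) (hj : j ≠ 0) :
    Approximable (Equiv.swap ((0 : ZMod 2), i) (1, j)) := by
  intro ε hε
  obtain ⟨g, hg1, hg2⟩ := exists_agreesUpTo_columnShift (i - j) (half_pos (half_pos hε))
  obtain ⟨a, ha1, ha2⟩ := exists_agreesUpTo_rowSwap j (half_pos hε)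
  have e : Equiv.swap ((0 : ZMod 2), i) (1, j) =
      columnShift (i - j) * rowSwap j * (columnShift (i - j))⁻¹ := by
    rw [rowSwap_eq_swap, ← Equiv.swap_apply_apply]
    simp [columnShift]
  refine ⟨[.V g] ++ [.W a] ++ invWord [.V g], ?_, fun u hu hu' => ?_⟩
  · rw [e, map_mul, map_mul, map_inv]
    have := (hg2.append (by positivity) (by positivity) ha2).append (by positivity) (by positivity)
      hg2.inv
    refine le_trans this (le_of_eq ?_)
    congr 1; ring
  · have h0 : ∀ y : UnitAddCircle, y = ZMod.toAddCircle (i - j) ∨ y = 0 → a.circ (-y) = 0 := by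
      rintro y (rfl | rfl)
      · refine ha1 _ ?_
        rw [← map_neg, cell_toAddCircle]
        intro h
        apply hi
        have : i = 0 := by linear_combination -h
        exact this
      · refine ha1 _ ?_
        rw [neg_zero, cell_zero]
        exact hj.symm
    have := h0 _ (hg1 u (by linarith) (by linarith))
    simp [invWord, Shear.inv, this]

/-- The permutation of the cells that permutes the right column by `τ`. -/
def rightColumn : Equiv.Perm (ZMod N) →* Equiv.Perm (ZMod 2 × ZMod N) :=
  MonoidHom.toHomPerm
    { toFun := fun τ c => (c.1, if c.1 = 0 then c.2 else τ c.2)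
      map_one' := by funext c; simp; rfl
      map_mul' := fun σ τ => by
        funext c
        show (_, _) = (_, _)
        by_cases h : c.1 = 0 <;> simp [h] }

lemma rightColumn_apply {N : ℕ} (τ : Equiv.Perm (ZMod N)) (c : ZMod 2 × ZMod N) :
    rightColumn τ c = (c.1, if c.1 = 0 then c.2 else τ c.2) := rfl

lemma approximable_rightColumn_swap {i j : ZMod N} (hi : i ≠ 0) (hj : j ≠ 0) (hij : i ≠ j) :
    Approximable (rightColumn (Equiv.swap i j)) := by
  have e : rightColumn (Equiv.swap i j) = Equiv.swap ((0 : ZMod 2), i) (1, i) *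
      Equiv.swap ((0 : ZMod 2), i) (1, j) * (Equiv.swap ((0 : ZMod 2), i) (1, i))⁻¹ := by
    rw [← Equiv.swap_apply_apply, Equiv.swap_apply_left,
      Equiv.swap_apply_of_ne_of_ne (by simp) (by simpa using hij.symm)]
    ext1 ⟨a, b⟩
    have : a = 0 ∨ a = 1 := by revert a; decide
    rw [rightColumn_apply]
    rcases this with rfl | rfl
    · rw [Equiv.swap_apply_of_ne_of_ne (fun h => zero_ne_one (congrArg Prod.fst h))
        (fun h => zero_ne_one (congrArg Prod.fst h))]
      simp
    · have h1 : (1 : ZMod 2) ≠ 0 := by decide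
      simp only [h1, if_false, Equiv.swap_apply_def, Prod.mk.injEq, true_and]
      split_ifs <;> rfl
  rw [e, Equiv.swap_inv]
  exact ((approximable_swap_left_right hi hi).mul (approximable_swap_left_right hi hj)).mul
    (approximable_swap_left_right hi hi)

/-- Every permutation of the right column that fixes row `0` is approximable. -/
lemma approximable_rightColumn {τ : Equiv.Perm (ZMod N)} (hτ : τ 0 = 0) :
    Approximable (rightColumn τ) := by
  have hp : ∀ j : ZMod N, τ j ≠ 0 ↔ j ≠ 0 := fun j => by
    rw [not_iff_not]
    constructor
    · intro h; rw [← hτ] at h; exact τ.injective h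
    · rintro rfl; exact hτ
  have key : ∀ σ : Equiv.Perm {j : ZMod N // j ≠ 0},
      Approximable (rightColumn (Equiv.Perm.ofSubtype σ)) := by
    intro σ
    induction σ using Equiv.Perm.swap_induction_on with
    | one => rw [map_one, map_one]; exact Approximable.one
    | swap_mul f x y hxy ih =>
      rw [map_mul, map_mul, Equiv.Perm.ofSubtype_swap_eq]
      exact (approximable_rightColumn_swap x.2 y.2 (fun h => hxy (Subtype.ext h))).mul ih
  have e : Equiv.Perm.ofSubtype (τ.subtypePerm hp) = τ :=
    Equiv.Perm.ofSubtype_subtypePerm (p := fun j => j ≠ 0) hp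
      (fun j hj (h0 : j = 0) => hj (by rw [h0, hτ]))
  rw [← e]
  exact key _

end Grid

/-! ### Strips of the torus -/

instance : IsProbabilityMeasure (volume : Measure UnitAddCircle) := ⟨UnitAddCircle.measure_univ⟩

instance : IsProbabilityMeasure (volume : Measure Torus2) :=
  inferInstanceAs (IsProbabilityMeasure ((volume : Measure UnitAddCircle).prod volume))

instance : (volume : Measure Torus2).IsAddRightInvariant :=
  inferInstanceAs (((volume : Measure UnitAddCircle).prod volume).IsAddRightInvariant)

lemma integrable_of_measurable_of_abs_le {X : Type*} [MeasurableSpace X] {μ : Measure X}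
    [IsFiniteMeasure μ] {f : X → ℝ} (hf : Measurable f) {C : ℝ} (hC : ∀ x, |f x| ≤ C) :
    Integrable f μ :=
  Integrable.of_bound hf.aestronglyMeasurable C (Eventually.of_forall hC)

/-- Integrals of functions that are close off a small set are close. -/
lemma abs_integral_sub_integral_le {X : Type*} [MeasurableSpace X] {μ : Measure X}
    [IsProbabilityMeasure μ] {f g : X → ℝ} (hf : Integrable f μ) (hg : Integrable g μ) {B : Set X}
    {e C : ℝ} (he : 0 ≤ e) (h : ∀ x ∉ B, |f x - g x| ≤ e) (hC : ∀ x, |f x - g x| ≤ C) :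
    |(∫ x, f x ∂μ) - ∫ x, g x ∂μ| ≤ e + C * μ.real B := by
  rw [← integral_sub hf hg]
  set B' := toMeasurable μ B
  have hB' : MeasurableSet B' := measurableSet_toMeasurable μ B
  have hi : Integrable (fun x => e + B'.indicator (fun _ => C) x) μ :=
    (integrable_const e).add ((integrable_const C).indicator hB')
  have h1 : |∫ x, (f x - g x) ∂μ| ≤ ∫ x, e + B'.indicator (fun _ => C) x ∂μ := by
    rw [← Real.norm_eq_abs]
    refine norm_integral_le_of_norm_le hi (Eventually.of_forall fun x => ?_)
    rw [Real.norm_eq_abs]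
    by_cases hx : x ∈ B'
    · rw [Set.indicator_of_mem hx]
      exact (hC x).trans (by linarith)
    · rw [Set.indicator_of_notMem hx, add_zero]
      exact h x fun hxB => hx (subset_toMeasurable μ B hxB)
  refine h1.trans (le_of_eq ?_)
  rw [integral_add (integrable_const e) ((integrable_const C).indicator hB'), integral_const,
    integral_indicator_const C hB']
  simp [Measure.real, B', measure_toMeasurable, mul_comm]

lemma abs_integral_prob_sub_const_le {X : Type*} [MeasurableSpace X] {μ : Measure X}
    [IsProbabilityMeasure μ] {f : X → ℝ} (hf : Integrable f μ) {c e : ℝ}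
    (h : ∀ x, |f x - c| ≤ e) : |(∫ x, f x ∂μ) - c| ≤ e := by
  have h0 : 0 ≤ e := by
    obtain ⟨x⟩ := μ.nonempty_of_neZero
    exact (abs_nonneg _).trans (h x)
  have := abs_integral_sub_integral_le hf (integrable_const c) (B := ∅) (μ := μ) h0
      (fun x _ => h x) h
  simpa using this

section Strip

variable {r : ℕ} [NeZero r]

open Classical in
/-- The restriction of a function to the strip of points with height in the cell `t`. -/
noncomputable def onStrip (t : ZMod r) (f : UnitAddCircle → ℝ) (y : UnitAddCircle) : ℝ :=
  if cell r y = t then f y else 0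

lemma measurable_onStrip {r : ℕ} (t : ZMod r) {f : UnitAddCircle → ℝ} (hf : Measurable f) :
    Measurable (onStrip t f) :=
  Measurable.ite (measurableSet_cell r {t}) hf measurable_const

lemma abs_onStrip_le {r : ℕ} (t : ZMod r) {f : UnitAddCircle → ℝ} {C : ℝ} (hC : ∀ y, |f y| ≤ C)
    (y : UnitAddCircle) : |onStrip t f y| ≤ C := by
  rw [onStrip]
  split_ifs
  · exact hC y
  · rw [abs_zero]; exact (abs_nonneg _).trans (hC y)

lemma cell_strip (t : ZMod r) {v : ℝ} (hv : v ∈ Set.Ico (0 : ℝ) 1) :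
    cell r (((t.val + v) / r : ℝ) : UnitAddCircle) = t := by
  have hr : (r : ℝ) ≠ 0 := by exact_mod_cast NeZero.ne r
  rw [cell_coe, mul_div_cancel₀ _ hr]
  have : ⌊(t.val : ℝ) + v⌋ = t.val := by
    rw [Int.floor_eq_iff]; push_cast; constructor <;> linarith [hv.1, hv.2]
  rw [this]; simp

lemma integral_congr_Ico {f g : ℝ → ℝ} (h : ∀ v ∈ Set.Ico (0 : ℝ) 1, f v = g v) :
    ∫ v in (0 : ℝ)..1, f v = ∫ v in (0 : ℝ)..1, g v := by
  rw [intervalIntegral.integral_of_le zero_le_one, intervalIntegral.integral_of_le zero_le_one,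
    integral_Ioc_eq_integral_Ioo, integral_Ioc_eq_integral_Ioo]
  exact setIntegral_congr_fun measurableSet_Ioo fun v hv => h v ⟨hv.1.le, hv.2⟩

/-- Integration over a strip in the coordinate `y = (t + v) / r`. -/
lemma integral_onStrip (t : ZMod r) {f : UnitAddCircle → ℝ} (hf : Measurable f) {C : ℝ}
    (hC : ∀ y, |f y| ≤ C) : ∫ y, onStrip t f y =
      (r : ℝ)⁻¹ * ∫ v in (0 : ℝ)..1, f (((t.val + v) / r : ℝ) : UnitAddCircle) := by
  have hm : Measurable fun x : ℝ => onStrip t f (x : UnitAddCircle) :=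
    (measurable_onStrip t hf).comp (AddCircle.measurable_mk')
  rw [integral_circle_eq, integral_unit_eq_sum (fun a b =>
      intervalIntegrable_of_measurable_of_abs_le
    hm (fun x => abs_onStrip_le t hC _) a b) r (NeZero.pos r),
    Finset.sum_eq_single_of_mem t.val (Finset.mem_range.mpr t.val_lt)]
  · congr 1
    refine integral_congr_Ico fun v hv => ?_
    rw [onStrip, if_pos (cell_strip t hv)]
  · intro i hi hit
    have hz : ∫ v in (0 : ℝ)..1, onStrip t f (((i + v) / r : ℝ) : UnitAddCircle) =
        ∫ v in (0 : ℝ)..1, (0 : ℝ) := by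
      refine integral_congr_Ico fun v hv => ?_
      rw [onStrip, if_neg]
      have hiv : (i : ZMod r).val = i := ZMod.val_cast_of_lt (Finset.mem_range.mp hi)
      have := cell_strip (i : ZMod r) hv
      rw [hiv] at this
      rw [this]
      rintro rfl
      exact hit hiv.symm
    rw [hz]; simp

lemma integral_torus_eq (f : Torus2 → ℝ) (hf : Integrable f) :
    ∫ x, f x = ∫ y, ∫ s, f (s, y) := integral_prod_symm f hf

lemma integral_onStrip_torus {r : ℕ} (t : ZMod r) {F : Torus2 → ℝ} (hF : Continuous F) :
    ∫ x : Torus2, onStrip t (fun y => F (x.1, y)) x.2 = ∫ y, onStrip t (fiberMean F) y := by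
  obtain ⟨C, hC0, hC⟩ := exists_abs_le_torus hF
  have hm : Measurable fun x : Torus2 => onStrip t (fun y => F (x.1, y)) x.2 :=
    Measurable.ite (measurable_snd (measurableSet_cell r {t})) hF.measurable measurable_const
  rw [integral_torus_eq _ (integrable_of_measurable_of_abs_le hm
    (fun x => abs_onStrip_le t (fun y => hC (x.1, y)) _))]
  refine integral_congr_ae (Eventually.of_forall fun y => ?_)
  simp only [onStrip, fiberMean]
  split_ifs with h <;> simp

/-- A steep shear in the horizontal direction makes every vertical segment across a strip
equidistributed in the strip. -/
lemma exists_equalizing_shear (r : ℕ) [NeZero r] {ε : ℝ} (hε : 0 < ε) : ∃ b : PerFun, b.circ 0 = 0 ∧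
    ∀ F : Torus2 → ℝ, Continuous F → ∀ C, (∀ x, |F x| ≤ C) → ∀ η,
      (∀ x y, dist x y ≤ ε → |F x - F y| ≤ η) → ∀ (t : ZMod r) (s : UnitAddCircle),
      |(∫ y, onStrip t (fun y => F (s + (b.circ y : ℝ), y)) y) -
        ∫ x : Torus2, onStrip t (fun y => F (x.1, y)) x.2| ≤ η + C * ε := by
  have hr : (0 : ℝ) < r := by exact_mod_cast NeZero.pos r
  have hr1 : (1 : ℝ) ≤ r := by exact_mod_cast NeZero.pos r
  obtain ⟨K, hK⟩ := exists_nat_gt (1 / ε)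
  have hK0 : (0 : ℝ) < K := lt_trans (by positivity) hK
  have hK1 : 1 ≤ K := by exact_mod_cast hK0
  have hKε : (K : ℝ)⁻¹ ≤ ε := by
    rw [inv_le_comm₀ hK0 hε]; rw [one_div] at hK; exact hK.le
  set κ : ℝ := min (ε / 4) (1 / 4) with hκ
  have hκ0 : 0 < κ := lt_min (by positivity) (by norm_num)
  have hκ1 : κ ≤ ε / 4 := min_le_left _ _
  have hκ2 : κ ≤ 1 / 4 := min_le_right _ _
  obtain ⟨b, hb1, hb2, -⟩ := exists_plateau (m := fun x => (r * K : ℝ) * x)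
    (contDiff_const.mul contDiff_id) (le_refl (0 : ℝ)) (le_refl (1 : ℝ)) hκ0 (by linarith)
  refine ⟨b, ?_, ?_⟩
  · have := hb2 0 ⟨le_rfl, zero_le_one⟩ (by simp)
    rw [← this, ← PerFun.circ_coe]; simp
  intro F hF C hC η hη t s
  have hη0 : 0 ≤ η := by simpa using (abs_nonneg _).trans (hη 0 0 (by simp [hε.le]))
  have hC0 : 0 ≤ C := (abs_nonneg _).trans (hC 0)
  have hmF1 : Measurable fun y => F (s + (b.circ y : ℝ), y) := by
    refine hF.measurable.comp (Continuous.measurable ?_)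
    exact (continuous_const.add ((AddCircle.continuous_mk' 1).comp b.continuous_circ)).prodMk
      continuous_id
  have hmF2 : Measurable fun y => F (s + ((r * K * rep y : ℝ) : UnitAddCircle), y) := by
    refine hF.measurable.comp (Measurable.prodMk ?_ measurable_id)
    exact measurable_const.add (AddCircle.measurable_mk'.comp (measurable_const.mul measurable_rep))
  have h1 : |(∫ y, onStrip t (fun y => F (s + (b.circ y : ℝ), y)) y) -
      ∫ y, onStrip t (fun y => F (s + ((r * K * rep y : ℝ) : UnitAddCircle), y)) y| ≤
      0 + 2 * C * (volume : Measure UnitAddCircle).real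
        {y | rep y ∈ Set.Icc 0 κ ∪ Set.Icc (1 - κ) 1} := by
    refine abs_integral_sub_integral_le
      (integrable_of_measurable_of_abs_le (measurable_onStrip t hmF1)
        (abs_onStrip_le t fun y => hC _))
      (integrable_of_measurable_of_abs_le (measurable_onStrip t hmF2)
        (abs_onStrip_le t fun y => hC _)) le_rfl (fun y hy => ?_) (fun y => ?_)
    · rw [Set.mem_ofPred_eq, Set.mem_union, not_or, Set.mem_Icc, Set.mem_Icc] at hy
      have hy1 := rep_mem y
      have : b.circ y = r * K * rep y := by
        rw [b.circ_eq]
        refine hb1 _ ⟨?_, ?_⟩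
        · by_contra! h; exact hy.1 ⟨hy1.1, by linarith⟩
        · by_contra! h; exact hy.2 ⟨h.le, hy1.2.le⟩
      simp [onStrip, this]
    · refine (abs_sub _ _).trans ?_
      linarith [abs_onStrip_le t (f := fun y => F (s + (b.circ y : ℝ), y)) (fun y => hC _) y,
        abs_onStrip_le t (f := fun y => F (s + ((r * K * rep y : ℝ) : UnitAddCircle), y))
          (fun y => hC _) y]
  have h2 : (volume : Measure UnitAddCircle).real
      {y | rep y ∈ Set.Icc 0 κ ∪ Set.Icc (1 - κ) 1} ≤ ε / 2 := by
    refine ENNReal.toReal_le_of_le_ofReal (by positivity) ?_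
    refine (volume_rep_le (measurableSet_Icc.union measurableSet_Icc)).trans
      ((measure_union_le _ _).trans ?_)
    rw [Real.volume_Icc, Real.volume_Icc, ← ENNReal.ofReal_add (by linarith) (by linarith)]
    exact ENNReal.ofReal_le_ofReal (by linarith)
  -- in the strip coordinate, the steep function is `K v` modulo `1`
  have h3 : ∫ y, onStrip t (fun y => F (s + ((r * K * rep y : ℝ) : UnitAddCircle), y)) y =
      (r : ℝ)⁻¹ * ∫ v in (0 : ℝ)..1, F (s + ((K * v : ℝ) : UnitAddCircle),
        (((t.val + v) / r : ℝ) : UnitAddCircle)) := by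
    rw [integral_onStrip t hmF2 (fun y => hC _)]
    congr 1
    refine integral_congr_Ico fun v hv => ?_
    have ht : (t.val : ℝ) + 1 ≤ r := by exact_mod_cast t.val_lt
    have h0 : 0 ≤ (t.val + v) / (r : ℝ) := div_nonneg
        (by linarith [hv.1, (t.val).cast_nonneg (α := ℝ)]) hr.le
    have h1 : (t.val + v) / (r : ℝ) < 1 := by rw [div_lt_one hr]; linarith [hv.2]
    rw [rep_coe_of_mem ⟨h0, h1⟩]
    have : (r * K * ((t.val + v) / r) : ℝ) = K * v + ((K * t.val : ℕ) : ℝ) := by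
      push_cast; field_simp; ring
    rw [this, AddCircle.coe_add]
    have h0 : (((K * t.val : ℕ) : ℝ) : UnitAddCircle) = 0 := by
      have := AddCircle.coe_period (1 : ℝ)
      rw [← nsmul_one, AddCircle.coe_nsmul, this, smul_zero]
    rw [h0, add_zero]
  have hmK : Continuous fun p : ℝ × ℝ => F (s + ((p.2 : ℝ) : UnitAddCircle),
      (((t.val + p.1) / r : ℝ) : UnitAddCircle)) := by
    refine hF.comp ?_
    exact (continuous_const.add ((AddCircle.continuous_mk' 1).comp continuous_snd)).prodMk
      ((AddCircle.continuous_mk' 1).comp ((continuous_const.add continuous_fst).div_const _))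
  have h4 := abs_integral_fast_sub_le (K := fun v u => F (s + ((u : ℝ) : UnitAddCircle),
    (((t.val + v) / r : ℝ) : UnitAddCircle))) (C := C) hmK.measurable (fun v u => hC _)
    (fun v u => by
      have h11 : ((u + 1 : ℝ) : UnitAddCircle) = u := AddCircle.coe_add_period 1 u
      simp only [h11]) hK1 (η := η) (fun v _ v' _ hvv u => by
      refine hη _ _ ?_
      rw [Prod.dist_eq]
      refine max_le (by simp [hε.le]) ?_
      rw [dist_eq_norm, ← AddCircle.coe_sub]
      refine (norm_coe_circle_le _).trans ?_
      rw [← sub_div, abs_div, abs_of_pos hr, add_sub_add_left_eq_sub]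
      exact (div_le_self (abs_nonneg _) hr1).trans (hvv.trans hKε))
  have h5 : ∫ x : Torus2, onStrip t (fun y => F (x.1, y)) x.2 = (r : ℝ)⁻¹ *
      ∫ v in (0 : ℝ)..1, ∫ u in (0 : ℝ)..1, F (s + ((u : ℝ) : UnitAddCircle),
        (((t.val + v) / r : ℝ) : UnitAddCircle)) := by
    rw [integral_onStrip_torus t hF,
      integral_onStrip t (continuous_fiberMean hF).measurable (abs_fiberMean_le hC)]
    congr 2
    funext v
    rw [← integral_circle_eq fun u => F (s + u, (((t.val + v) / r : ℝ) : UnitAddCircle)),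
      integral_add_left_eq_self (fun u => F (u, (((t.val + v) / r : ℝ) : UnitAddCircle))) s]
    rfl
  rw [h5]
  rw [h3] at h1
  have h6 := mul_le_mul_of_nonneg_left h4 (inv_nonneg.mpr hr.le)
  have hinv : (r : ℝ)⁻¹ ≤ 1 := inv_le_one_of_one_le₀ hr1
  have h7 : (r : ℝ)⁻¹ * η ≤ η := by nlinarith
  have h8 : 2 * C * (volume : Measure UnitAddCircle).real
      {y | rep y ∈ Set.Icc 0 κ ∪ Set.Icc (1 - κ) 1} ≤ C * ε := by nlinarith
  rw [← abs_of_pos (inv_pos.mpr hr), ← abs_mul, mul_sub] at h6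
  rw [abs_of_pos (inv_pos.mpr hr)] at h6
  have := abs_sub_le (∫ y, onStrip t (fun y => F (s + (b.circ y : ℝ), y)) y)
    ((r : ℝ)⁻¹ * ∫ v in (0 : ℝ)..1, F (s + ((K * v : ℝ) : UnitAddCircle),
        (((t.val + v) / r : ℝ) : UnitAddCircle))) ((r : ℝ)⁻¹ *
      ∫ v in (0 : ℝ)..1, ∫ u in (0 : ℝ)..1, F (s + ((u : ℝ) : UnitAddCircle),
        (((t.val + v) / r : ℝ) : UnitAddCircle)))
  linarith

end Strip

/-! ### Exchange of digits, and the mixing word -/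

section Digits

/-- With `n = t k² + a k + b`, where `a, b < k`, this is `t k² + b k + a`. -/
def swapDigits (k n : ℕ) : ℕ := n / (k * k) * (k * k) + (n % k * k + n / k % k)

lemma swapDigits_eq {k t a b : ℕ} (ha : a < k) (hb : b < k) :
    swapDigits k (t * (k * k) + (a * k + b)) = t * (k * k) + (b * k + a) := by
  have hk : 0 < k := by omega
  have hlt : a * k + b < k * k := by nlinarith
  have h1 : (t * (k * k) + (a * k + b)) / (k * k) = t := by
    rw [add_comm, Nat.add_mul_div_right _ _ (by positivity), Nat.div_eq_of_lt hlt, zero_add]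
  have e : t * (k * k) + (a * k + b) = b + (t * k + a) * k := by ring
  have h2 : (t * (k * k) + (a * k + b)) % k = b := by
    rw [e, Nat.add_mul_mod_self_right, Nat.mod_eq_of_lt hb]
  have h3 : (t * (k * k) + (a * k + b)) / k % k = a := by
    rw [e, Nat.add_mul_div_right _ _ hk, Nat.div_eq_of_lt hb, zero_add, add_comm,
      Nat.add_mul_mod_self_right, Nat.mod_eq_of_lt ha]
  rw [swapDigits, h1, h2, h3]

lemma exists_digits {k : ℕ} (hk : 0 < k) (n : ℕ) : ∃ t a b, a < k ∧ b < k ∧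
    n = t * (k * k) + (a * k + b) := by
  refine ⟨n / k / k, n / k % k, n % k, Nat.mod_lt _ hk, Nat.mod_lt _ hk, ?_⟩
  have h1 := Nat.div_add_mod n k
  have h2 := Nat.div_add_mod (n / k) k
  calc n = k * (n / k) + n % k := h1.symm
    _ = k * (k * (n / k / k) + n / k % k) + n % k := by rw [h2]
    _ = _ := by ring

lemma swapDigits_lt {k r n : ℕ} (hk : 0 < k) (hn : n < r * (k * k)) :
    swapDigits k n < r * (k * k) := by
  obtain ⟨t, a, b, ha, hb, rfl⟩ := exists_digits hk n
  rw [swapDigits_eq ha hb]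
  have ht : t < r := by
    by_contra! h
    have := Nat.mul_le_mul_right (k * k) h
    omega
  have h1 : b * k + a < k * k := by nlinarith
  have h2 := Nat.mul_le_mul_right (k * k) (Nat.succ_le_of_lt ht)
  rw [Nat.succ_mul] at h2
  omega

lemma swapDigits_swapDigits {k : ℕ} (hk : 0 < k) (n : ℕ) : swapDigits k (swapDigits k n) = n := by
  obtain ⟨t, a, b, ha, hb, rfl⟩ := exists_digits hk n
  rw [swapDigits_eq ha hb, swapDigits_eq hb ha]

/-- The exchange of the last two digits as a permutation of the rows of a grid. -/
def digitPerm (r k : ℕ) [NeZero r] [NeZero k] : Equiv.Perm (ZMod (r * (k * k))) :=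
  Function.Involutive.toPerm (fun j => (swapDigits k j.val : ZMod (r * (k * k)))) fun j => by
    have hk := NeZero.pos k
    show ((swapDigits k ((swapDigits k j.val : ZMod (r * (k * k)))).val : ℕ) : ZMod (r * (k * k))) =
        j
    rw [ZMod.val_cast_of_lt (swapDigits_lt hk j.val_lt), swapDigits_swapDigits hk, ZMod.natCast_val,
      ZMod.cast_id]

lemma digitPerm_natCast {r k n : ℕ} [NeZero r] [NeZero k] (hn : n < r * (k * k)) :
    digitPerm r k (n : ZMod (r * (k * k))) = (swapDigits k n : ZMod (r * (k * k))) := by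
  show ((swapDigits k (n : ZMod (r * (k * k))).val : ℕ) : ZMod (r * (k * k))) = _
  rw [ZMod.val_cast_of_lt hn]

lemma digitPerm_zero (r k : ℕ) [NeZero r] [NeZero k] : digitPerm r k 0 = 0 := by
  have := digitPerm_natCast (r := r) (k := k) (n := 0) (NeZero.pos _)
  simpa [swapDigits] using this

/-- The piecewise translation of the circle that permutes `N` intervals by `τ`. -/
noncomputable def cellMove {N : ℕ} [NeZero N] (τ : Equiv.Perm (ZMod N)) (y : UnitAddCircle) :
    UnitAddCircle := y + ZMod.toAddCircle (τ (cell N y) - cell N y)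

lemma measurable_cellMove {N : ℕ} [NeZero N] (τ : Equiv.Perm (ZMod N)) :
    Measurable (cellMove τ) := by
  have h : Measurable fun y : UnitAddCircle => cell N y := fun S _ => measurableSet_cell N S
  exact measurable_id.add ((measurable_of_finite
    fun j : ZMod N => ZMod.toAddCircle (τ j - j)).comp h)

/-- On the strip `t`, in the strip coordinate `v`, the exchange of the last two digits is close to
`v ↦ k v` modulo `1`. -/
lemma exists_cellMove_digitPerm_eq {r k : ℕ} [NeZero r] [NeZero k] (t : ZMod r) {v : ℝ}
    (hv : v ∈ Set.Ico (0 : ℝ) 1) : ∃ w ∈ Set.Ico (0 : ℝ) 1, |w - Int.fract (k * v)| ≤ (k : ℝ)⁻¹ ∧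
      cellMove (digitPerm r k) (((t.val + v) / r : ℝ) : UnitAddCircle) =
        (((t.val + w) / r : ℝ) : UnitAddCircle) := by
  have hk : 0 < k := NeZero.pos k
  have hkR : (0 : ℝ) < k := by exact_mod_cast hk
  have hr : (0 : ℝ) < r := by exact_mod_cast NeZero.pos r
  set m : ℕ := ⌊(k * k : ℝ) * v⌋₊ with hm
  have hm1 : (m : ℝ) ≤ k * k * v := Nat.floor_le (by have := hv.1; positivity)
  have hm2 : (k * k : ℝ) * v < m + 1 := Nat.lt_floor_add_one _
  have hmk : m < k * k := by
    have : (m : ℝ) < (k * k : ℕ) := by push_cast; nlinarith [hv.2, mul_pos hkR hkR]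
    exact_mod_cast this
  set ρ : ℝ := k * k * v - m with hρ
  set a := m / k with ha
  set b := m % k with hb
  have hbk : b < k := Nat.mod_lt _ hk
  have hak : a < k := Nat.div_lt_of_lt_mul hmk
  have hmab : m = a * k + b := by rw [ha, hb, mul_comm]; exact (Nat.div_add_mod m k).symm
  have hmabR : (m : ℝ) = a * k + b := by rw [hmab]; push_cast; rfl
  have hak' : (a : ℝ) + 1 ≤ k := by exact_mod_cast hak
  have hbk' : (b : ℝ) + 1 ≤ k := by exact_mod_cast hbk
  have ha0 : (0 : ℝ) ≤ a := a.cast_nonneg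
  have hb0 : (0 : ℝ) ≤ b := b.cast_nonneg
  have hfr : Int.fract ((k : ℝ) * v) = (b + ρ) / k := by
    rw [Int.fract_eq_iff]
    refine ⟨by apply div_nonneg <;> linarith, by rw [div_lt_one hkR]; linarith, a, ?_⟩
    rw [hρ, hmabR]; push_cast; field_simp; ring
  refine ⟨(b * k + a + ρ) / (k * k), ⟨by apply div_nonneg <;> nlinarith, ?_⟩, ?_, ?_⟩
  · rw [div_lt_one (by positivity)]; nlinarith
  · rw [hfr]
    have e : (b * k + a + ρ) / (k * k) - (b + ρ) / k = (a + ρ - k * ρ) / (k * k : ℝ) := by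
      field_simp; ring
    have e2 : (k : ℝ)⁻¹ = k / (k * k) := by field_simp
    rw [e, e2, abs_div, abs_of_pos (mul_pos hkR hkR)]
    refine div_le_div_of_nonneg_right (abs_le.mpr ⟨?_, ?_⟩) (by positivity) <;> nlinarith
  · have hlt : t.val * (k * k) + m < r * (k * k) := by
      have h2 := Nat.mul_le_mul_right (k * k) (Nat.succ_le_of_lt t.val_lt)
      rw [Nat.succ_mul] at h2
      omega
    have hcell : cell (r * (k * k)) (((t.val + v) / r : ℝ) : UnitAddCircle) =
        ((t.val * (k * k) + m : ℕ) : ZMod (r * (k * k))) := by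
      rw [cell_coe]
      have e : ((r * (k * k) : ℕ) : ℝ) * ((t.val + v) / r) =
          k * k * v + ((t.val * (k * k) : ℕ) : ℤ) := by
        push_cast; field_simp; ring
      have e3 : ⌊(k * k : ℝ) * v⌋ = (m : ℤ) := by
        rw [Int.floor_eq_iff]; push_cast; exact ⟨hm1, hm2⟩
      rw [e, Int.floor_add_intCast, e3]
      push_cast; ring
    have hmove : digitPerm r k ((t.val * (k * k) + m : ℕ) : ZMod (r * (k * k))) -
        ((t.val * (k * k) + m : ℕ) : ZMod (r * (k * k))) =
        (((t.val * (k * k) + (b * k + a) : ℕ) - (t.val * (k * k) + m : ℕ) : ℤ) :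
          ZMod (r * (k * k))) := by
      rw [digitPerm_natCast hlt, hmab, swapDigits_eq hak hbk]
      push_cast; rfl
    rw [cellMove, hcell, hmove, ZMod.toAddCircle_intCast, ← AddCircle.coe_add]
    congr 1
    push_cast
    rw [hρ, hmabR]
    field_simp
    ring

lemma cell_cellMove_digitPerm {r k : ℕ} [NeZero r] [NeZero k] (y : UnitAddCircle) :
    cell r (cellMove (digitPerm r k) y) = cell r y := by
  have hr : (0 : ℝ) < r := by exact_mod_cast NeZero.pos r
  have h := (cell_eq_iff y (cell r y)).mp rfl
  obtain ⟨w, hw, -, e⟩ := exists_cellMove_digitPerm_eq (k := k) (cell r y)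
    (v := r * rep y - (cell r y).val) ⟨by
      have := h.1; rw [div_le_iff₀ hr] at this; linarith, by
      have := h.2; rw [lt_div_iff₀ hr] at this; linarith⟩
  have e2 : (((cell r y).val + (r * rep y - (cell r y).val)) / r : ℝ) = rep y := by
    field_simp; ring
  rw [e2, coe_rep] at e
  rw [e, cell_strip _ hw]

end Digits

section MixingWord

/-- The height of the image of a point under a word. -/
noncomputable def heightAfter (φ : List Shear) (x : Torus2) : UnitAddCircle := (evalWord φ x).2

lemma continuous_heightAfter (φ : List Shear) : Continuous (heightAfter φ) :=
  continuous_snd.comp (continuous_evalWord φ)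

variable {r k : ℕ} [NeZero r] [NeZero k]

/-- On each strip, a point and its image under the exchange of the digits are nearly independent. -/
lemma integral_mul_cellMove (t : ZMod r) {f g : UnitAddCircle → ℝ} (hf : Continuous f)
    (hg : Continuous g) {C η δ : ℝ} (hfC : ∀ y, |f y| ≤ C) (hgC : ∀ y, |g y| ≤ C)
    (hfη : ∀ x y, dist x y ≤ δ → |f x - f y| ≤ η) (hgη : ∀ x y, dist x y ≤ δ → |g x - g y| ≤ η)
    (hkδ : (k : ℝ)⁻¹ ≤ δ) :
    |(∫ y, onStrip t (fun y => f y * g (cellMove (digitPerm r k) y)) y) -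
      r * ((∫ y, onStrip t f y) * ∫ y, onStrip t g y)| ≤ 2 * C * η := by
  have hr : (0 : ℝ) < r := by exact_mod_cast NeZero.pos r
  have hr1 : (1 : ℝ) ≤ r := by exact_mod_cast NeZero.pos r
  have hk1 : 1 ≤ k := NeZero.pos k
  have hC0 : 0 ≤ C := (abs_nonneg _).trans (hfC 0)
  have hδ0 : 0 ≤ δ := le_trans (by positivity) hkδ
  have hη0 : 0 ≤ η := by simpa using (abs_nonneg _).trans (hfη 0 0 (by simpa using hδ0))
  have hcoe : Measurable ((↑) : ℝ → UnitAddCircle) := AddCircle.measurable_mk'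
  -- the two coordinates on the strip
  set f' : ℝ → ℝ := fun v => f (((t.val + v) / r : ℝ) : UnitAddCircle) with hf'
  set g' : ℝ → ℝ := fun v => g (((t.val + v) / r : ℝ) : UnitAddCircle) with hg'
  have hmf : Measurable f' :=
    hf.measurable.comp (hcoe.comp ((measurable_const.add measurable_id).div_const _))
  have hmg : Measurable g' :=
    hg.measurable.comp (hcoe.comp ((measurable_const.add measurable_id).div_const _))
  have hdist : ∀ (h : UnitAddCircle → ℝ), (∀ x y, dist x y ≤ δ → |h x - h y| ≤ η) → ∀ v v' : ℝ,
      |v - v'| ≤ (k : ℝ)⁻¹ → |h (((t.val + v) / r : ℝ) : UnitAddCircle) -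
        h (((t.val + v') / r : ℝ) : UnitAddCircle)| ≤ η := by
    intro h hh v v' hvv
    refine hh _ _ ?_
    rw [dist_eq_norm, ← AddCircle.coe_sub]
    refine (norm_coe_circle_le _).trans ?_
    rw [← sub_div, abs_div, abs_of_pos hr, add_sub_add_left_eq_sub]
    exact (div_le_self (abs_nonneg _) hr1).trans (hvv.trans hkδ)
  have hmC : ∀ (p q : ℝ), |p| ≤ C → |q| ≤ C → |p * q| ≤ C * C := fun p q hp hq => by
    rw [abs_mul]; exact mul_le_mul hp hq (abs_nonneg _) hC0
  have hmove : Measurable fun y => f y * g (cellMove (digitPerm r k) y) :=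
    hf.measurable.mul (hg.measurable.comp (measurable_cellMove _))
  rw [integral_onStrip t hmove (C := C * C) (fun y => hmC _ _ (hfC _) (hgC _)),
    integral_onStrip t hf.measurable hfC, integral_onStrip t hg.measurable hgC]
  have h1 : |(∫ v in (0 : ℝ)..1, f' v *
      g (cellMove (digitPerm r k) (((t.val + v) / r : ℝ) : UnitAddCircle))) -
      ∫ v in (0 : ℝ)..1, f' v * g' (Int.fract (k * v))| ≤ C * η := by
    have hz : ∀ a b : ℝ, IntervalIntegrable (fun v : ℝ => f' v *
        g (cellMove (digitPerm r k) (((t.val + v) / r : ℝ) : UnitAddCircle))) volume a b :=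
            fun a b =>
      intervalIntegrable_of_measurable_of_abs_le (C := C * C) (hmf.mul (hg.measurable.comp
        ((measurable_cellMove _).comp
          (hcoe.comp ((measurable_const.add measurable_id).div_const _)))))
        (fun v => hmC _ _ (hfC _) (hgC _)) a b
    have hz' : ∀ a b : ℝ, IntervalIntegrable (fun v : ℝ => f' v * g' (Int.fract (k * v)))
        volume a b := fun a b =>
      intervalIntegrable_of_measurable_of_abs_le (C := C * C) (hmf.mul (hmg.comp
        (measurable_fract.comp (measurable_const.mul measurable_id))))
        (fun v => hmC _ _ (hfC _) (hgC _)) a b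
    rw [← intervalIntegral.integral_sub (hz 0 1) (hz' 0 1), ← Real.norm_eq_abs]
    have e0 : C * η = C * η * |(1 : ℝ) - 0| := by simp
    rw [e0, intervalIntegral.integral_of_le zero_le_one, integral_Ioc_eq_integral_Ioo,
      ← integral_Ioc_eq_integral_Ioo, ← intervalIntegral.integral_of_le zero_le_one]
    refine intervalIntegral.norm_integral_le_of_norm_le_const_ae ?_
    have hne : ∀ᵐ v : ℝ, v ≠ 1 := by simp [ae_iff]
    filter_upwards [hne] with v hv1 hv
    rw [Set.uIoc_of_le zero_le_one] at hv
    obtain ⟨w, hw, hw2, e⟩ := exists_cellMove_digitPerm_eq (k := k) t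
      (v := v) ⟨hv.1.le, lt_of_le_of_ne hv.2 hv1⟩
    rw [e, Real.norm_eq_abs, ← mul_sub, abs_mul]
    exact mul_le_mul (hfC _) (hdist g hgη _ _ hw2) (abs_nonneg _) hC0
  have h2 := abs_integral_fast_sub_le (K := fun v u => f' v * g' (Int.fract u)) (C := C * C)
    ((hmf.comp measurable_fst).mul (hmg.comp (measurable_fract.comp measurable_snd)))
    (fun v u => hmC _ _ (hfC _) (hgC _)) (fun v u => by simp) hk1 (η := η * C)
    (fun v _ v' _ hvv u => by
      rw [← sub_mul, abs_mul]
      exact mul_le_mul (hdist f hfη _ _ hvv) (hgC _) (abs_nonneg _) hη0)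
  have h3 : ∫ v in (0 : ℝ)..1, ∫ u in (0 : ℝ)..1, f' v * g' (Int.fract u) =
      (∫ v in (0 : ℝ)..1, f' v) * ∫ v in (0 : ℝ)..1, g' v := by
    rw [← intervalIntegral.integral_mul_const]
    congr 1
    funext v
    rw [intervalIntegral.integral_const_mul]
    congr 1
    refine integral_congr_Ico fun u hu => ?_
    rw [Int.fract_eq_self.mpr ⟨hu.1, hu.2⟩]
  rw [h3] at h2
  have h4 := (abs_sub_le _ _ _).trans (add_le_add h1 h2)
  have e : ∀ X A B : ℝ, (r : ℝ)⁻¹ * X - r * ((r : ℝ)⁻¹ * A * ((r : ℝ)⁻¹ * B)) =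
      (r : ℝ)⁻¹ * (X - A * B) := by
    intro X A B; field_simp
  rw [e, abs_mul, abs_of_pos (inv_pos.mpr hr)]
  have hinv : (r : ℝ)⁻¹ ≤ 1 := inv_le_one_of_one_le₀ hr1
  have h5 := mul_le_mul hinv h4 (abs_nonneg _) zero_le_one
  linarith

/-- A word that preserves the strips up to a small set, does not move the circle `x₂ = 0` vertically
except near two points, and mixes inside each strip the points at distance `1 / 2` horizontally. -/
lemma exists_mixing_word (r : ℕ) [NeZero r] {ε : ℝ} (hε : 0 < ε) : ∃ φ : List Shear,
    volume {x | cell r (heightAfter φ x) ≠ cell r x.2} ≤ ENNReal.ofReal ε ∧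
    (∀ u : UnitAddCircle, ε ≤ ‖u‖ → ε ≤ ‖u - ((1 / 2 : ℝ) : UnitAddCircle)‖ → track φ u = 0) ∧
    ∀ f g : UnitAddCircle → ℝ, Continuous f → Continuous g → ∀ C, (∀ y, |f y| ≤ C) →
      (∀ y, |g y| ≤ C) → ∀ η, (∀ x y, dist x y ≤ ε → |f x - f y| ≤ η) →
      (∀ x y, dist x y ≤ ε → |g x - g y| ≤ η) → ∀ t : ZMod r,
      |(∫ x : Torus2, onStrip t (fun _ => f (heightAfter φ x) *
          g (heightAfter φ (x + (((1 / 2 : ℝ) : UnitAddCircle), 0)))) x.2) -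
        r * ((∫ y, onStrip t f y) * ∫ y, onStrip t g y)| ≤ 2 * C * η + 4 * C * C * ε := by
  obtain ⟨k, hk⟩ := exists_nat_gt (1 / ε)
  have hk0 : (0 : ℝ) < k := lt_trans (by positivity) hk
  have : NeZero k := ⟨by rintro rfl; simp at hk0⟩
  have hkε : (k : ℝ)⁻¹ ≤ ε := by
    rw [inv_le_comm₀ hk0 hε]; rw [one_div] at hk; exact hk.le
  set σ := rightColumn (digitPerm r k) with hσ
  set Y : Torus2 → UnitAddCircle := fun x => (gridPerm σ x).2 with hY
  have hYe : ∀ x, Y x = if cell 2 x.1 = 0 then x.2 else cellMove (digitPerm r k) x.2 := by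
    intro x
    rw [hY]
    simp only [gridPerm_apply, hσ, rightColumn_apply, gridCell, gridShift, Prod.snd_add,
        Prod.snd_sub,
      cellMove]
    split_ifs <;> simp
  obtain ⟨φ, h1, h2⟩ := approximable_rightColumn (digitPerm_zero r k) ε hε
  have hYφ : ∀ x, evalWord φ x = gridPerm σ x → heightAfter φ x = Y x := fun x hx => by
    rw [heightAfter, hx]
  refine ⟨φ, (measure_mono fun x hx => ?_).trans h1, fun u hu hu' => by rw [track, h2 u hu hu'], ?_⟩
  · rw [Set.mem_ofPred_eq] at hx ⊢
    intro h
    apply hx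
    rw [hYφ x h, hYe]
    split_ifs
    · rfl
    · exact cell_cellMove_digitPerm _
  intro f g hf hg C hfC hgC η hfη hgη t
  have hC0 : 0 ≤ C := (abs_nonneg _).trans (hfC 0)
  set c : Torus2 := (((1 / 2 : ℝ) : UnitAddCircle), 0) with hc
  set B : Set Torus2 := {x | evalWord φ x ≠ gridPerm σ x} with hB
  have hmC : ∀ (p q : ℝ), |p| ≤ C → |q| ≤ C → |p * q| ≤ C * C := fun p q hp hq => by
    rw [abs_mul]; exact mul_le_mul hp hq (abs_nonneg _) hC0
  have hmY : Measurable Y := by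
    have : Y = fun x => if cell 2 x.1 = 0 then x.2 else cellMove (digitPerm r k) x.2 := funext hYe
    rw [this]
    exact Measurable.ite (measurable_fst (measurableSet_cell 2 {0})) measurable_snd
      ((measurable_cellMove _).comp measurable_snd)
  have hadd : Measurable fun x : Torus2 => x + c := measurable_id.add_const c
  have hms : ∀ {F : Torus2 → ℝ}, Measurable F → Measurable fun x : Torus2 =>
      onStrip t (fun _ => F x) x.2 := fun hF =>
    Measurable.ite (measurable_snd (measurableSet_cell r {t})) hF measurable_const
  have hm1 : Measurable fun x : Torus2 => onStrip t (fun _ => f (heightAfter φ x) *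
      g (heightAfter φ (x + c))) x.2 := hms <|
    (hf.measurable.comp (continuous_heightAfter φ).measurable).mul
      (hg.measurable.comp ((continuous_heightAfter φ).measurable.comp hadd))
  have hm2 : Measurable fun x : Torus2 => onStrip t (fun _ => f (Y x) * g (Y (x + c))) x.2 := hms <|
    (hf.measurable.comp hmY).mul (hg.measurable.comp (hmY.comp hadd))
  have hi2 := integrable_of_measurable_of_abs_le (μ := volume) hm2 (C := C * C)
    (fun x => abs_onStrip_le t (fun _ => hmC _ _ (hfC _) (hgC _)) _)
  have hbad : (volume : Measure Torus2).real (B ∪ (fun x => x + c) ⁻¹' B) ≤ 2 * ε := by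
    refine ENNReal.toReal_le_of_le_ofReal (by positivity) ((measure_union_le _ _).trans ?_)
    have hemb : MeasurableEmbedding fun x : Torus2 => x + c := measurableEmbedding_addRight c
    rw [(measurePreserving_add_right (volume : Measure Torus2) c).measure_preimage_emb hemb,
      two_mul, ENNReal.ofReal_add hε.le hε.le]
    exact add_le_add h1 h1
  have h3 := abs_integral_sub_integral_le (B := B ∪ (fun x => x + c) ⁻¹' B) (e := 0)
    (C := 2 * (C * C)) (integrable_of_measurable_of_abs_le (μ := volume) hm1 (C := C * C)
    (fun x => abs_onStrip_le t (fun _ => hmC _ _ (hfC _) (hgC _)) _)) hi2 le_rfl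
    (fun x hx => by
      rw [Set.mem_union, not_or] at hx
      have e1 := hYφ x (not_not.mp hx.1)
      have e2 := hYφ (x + c) (not_not.mp hx.2)
      simp only [e1, e2, sub_self, abs_zero, le_refl])
    (fun x => by
      refine (abs_sub _ _).trans ?_
      rw [two_mul]
      exact add_le_add (abs_onStrip_le t (fun _ => hmC _ _ (hfC _) (hgC _)) _)
        (abs_onStrip_le t (fun _ => hmC _ _ (hfC _) (hgC _)) _))
  have h4 : |(∫ x : Torus2, onStrip t (fun _ => f (Y x) * g (Y (x + c))) x.2) -
      r * ((∫ y, onStrip t f y) * ∫ y, onStrip t g y)| ≤ 2 * C * η := by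
    have hi2' : Integrable (fun x : Torus2 => onStrip t (fun _ => f (Y x) * g (Y (x + c))) x.2)
        ((volume : Measure UnitAddCircle).prod volume) := hi2
    have hprod : ∫ x : Torus2, onStrip t (fun _ => f (Y x) * g (Y (x + c))) x.2 =
        ∫ u, ∫ y, onStrip t (fun _ => f (Y (u, y)) * g (Y ((u, y) + c))) y :=
      integral_prod _ hi2'
    rw [hprod]
    refine abs_integral_prob_sub_const_le hi2'.integral_prod_left fun u => ?_
    have hhalf : cell 2 (u + ((1 / 2 : ℝ) : UnitAddCircle)) = cell 2 u + 1 := by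
      have e := ZMod.toAddCircle_intCast (N := 2) 1
      have e' : ((1 / 2 : ℝ) : UnitAddCircle) = ZMod.toAddCircle (N := 2) 1 := by
        push_cast at e; simpa using e.symm
      rw [e', cell_add]
    have hYs : ∀ y, Y ((u, y) + c) =
        if cell 2 u + 1 = 0 then y else cellMove (digitPerm r k) y := fun y => by
      rw [hYe]
      show (if cell 2 (u + ((1 / 2 : ℝ) : UnitAddCircle)) = 0 then y + 0 else
        cellMove (digitPerm r k) (y + 0)) = _
      rw [hhalf, add_zero]
    -- exactly one of the points `x` and `x + c` is in the right half, where
    -- the digits are exchanged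
    have hcases : cell 2 u = 0 ∨ cell 2 u = 1 := by generalize cell 2 u = i; revert i; decide
    have hY0 : ∀ y, Y (u, y) = if cell 2 u = 0 then y else cellMove (digitPerm r k) y := fun y => by
      rw [hYe]
    simp only [hYs, hY0]
    rcases hcases with h | h
    · have h10 : ¬ (0 + 1 : ZMod 2) = 0 := by decide
      simp only [h, if_true, h10, if_false]
      exact integral_mul_cellMove t hf hg hfC hgC hfη hgη hkε
    · have h10 : (1 + 1 : ZMod 2) = 0 := by decide
      have h1' : ¬ (1 : ZMod 2) = 0 := by decide
      simp only [h, if_true, h10, h1', if_false]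
      have := integral_mul_cellMove (k := k) t hg hf hgC hfC hgη hfη hkε
      rw [mul_comm (∫ y, onStrip t f y)]
      simp only [mul_comm (f _)]
      exact this
  have h5 := (abs_sub_le _ _ _).trans (add_le_add h3 h4)
  refine h5.trans ?_
  nlinarith [mul_le_mul_of_nonneg_left hbad (show 0 ≤ 2 * (C * C) by positivity)]

end MixingWord

/-! ### Conjugates of the translation, and fast coverings -/

section Conjugates

/-- The conjugate `H ∘ S_α ∘ H⁻¹`, where `H` is given by a word. -/
noncomputable def conjPerm (α : ℝ) (H : List Shear) : Equiv.Perm Torus2 :=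
  evalWord H * torusTranslation α * (evalWord H)⁻¹

lemma conjPerm_evalWord (α : ℝ) (H : List Shear) (x : Torus2) :
    conjPerm α H (evalWord H x) = evalWord H (x + ((α : UnitAddCircle), 0)) := by
  show evalWord H ((evalWord H).symm (evalWord H x) + ((α : UnitAddCircle), 0)) = _
  rw [Equiv.symm_apply_apply]

lemma conjPerm_iterate (α : ℝ) (H : List Shear) (m : ℕ) (x : Torus2) :
    (conjPerm α H)^[m] (evalWord H x) = evalWord H (x + (((m * α : ℝ) : UnitAddCircle), 0)) := by
  induction m with
  | zero => simp [← Prod.zero_eq_mk]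
  | succ m ih =>
    have e : ((((m + 1 : ℕ) * α : ℝ) : UnitAddCircle), (0 : UnitAddCircle)) =
        (((m * α : ℝ) : UnitAddCircle), 0) + ((α : UnitAddCircle), 0) := by
      rw [Prod.mk_add_mk, add_zero, ← AddCircle.coe_add]
      push_cast
      rw [add_mul, one_mul]
    rw [Function.iterate_succ_apply', ih, conjPerm_evalWord, add_assoc, e]

lemma continuous_conjPerm (α : ℝ) (H : List Shear) : Continuous (conjPerm α H) :=
  (continuous_evalWord H).comp ((continuous_add_const _).comp (continuous_evalWord_inv H))

lemma measurePreserving_conjPerm (α : ℝ) (H : List Shear) :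
    MeasurePreserving (conjPerm α H) (volume : Measure Torus2) volume :=
  (measurePreserving_evalWord H).comp
    ((measurePreserving_add_right volume _).comp (measurePreserving_evalWord_inv H))

lemma integral_comp_evalWord (H : List Shear) (f : Torus2 → ℝ) :
    ∫ x, f (evalWord H x) = ∫ x, f x :=
  (measurePreserving_evalWord H).integral_comp (measurableEmbedding_evalWord H) f

/-- Composition with a `q`-fold covering word is close to a change of the height alone. -/
lemma eventually_scaleWord_close {F : Torus2 → ℝ} (hF : Continuous F) (φ : List Shear) {η : ℝ}
    (hη : 0 < η) : ∀ᶠ q : ℕ in atTop, ∀ x : Torus2,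
      |F (evalWord (scaleWord q φ) x) - F (x.1, heightAfter φ (q • x.1, x.2))| ≤ η := by
  obtain ⟨δ, hδ, h⟩ := exists_dist_torus_le hF hη
  obtain ⟨C, hC⟩ := exists_dist_scaleWord_fst φ
  have ht : Tendsto (fun q : ℕ => C * (q : ℝ)⁻¹) atTop (𝓝 0) := by
    simpa using (tendsto_inv_atTop_nhds_zero_nat (𝕜 := ℝ)).const_mul C
  filter_upwards [ht.eventually_le_const hδ, eventually_ge_atTop 1] with q h1 h2 x
  refine h _ _ ?_
  rw [Prod.dist_eq]
  refine max_le ((hC q x).trans h1) ?_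
  rw [heightAfter, ← scaleWord_snd q (by omega), dist_self]
  exact hδ.le

lemma dist_coe_circle_le (a b : ℝ) : dist (a : UnitAddCircle) b ≤ |a - b| := by
  rw [dist_eq_norm, ← AddCircle.coe_sub]
  exact norm_coe_circle_le _

/-- The points `s` and `q s` of the circle behave like independent variables. -/
lemma abs_integral_circle_fast_le {K : UnitAddCircle → UnitAddCircle → ℝ}
    (hK : Measurable (Function.uncurry K)) {C : ℝ} (hC : ∀ s u, |K s u| ≤ C) {q : ℕ} (hq : 1 ≤ q)
    {η : ℝ} (hη : ∀ s s', dist s s' ≤ (q : ℝ)⁻¹ → ∀ u, |K s u - K s' u| ≤ η) :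
    |(∫ s, K s (q • s)) - ∫ s, ∫ u, K s u| ≤ η := by
  have hcoe : Measurable ((↑) : ℝ → UnitAddCircle) := AddCircle.measurable_mk'
  have h := abs_integral_fast_sub_le (K := fun v u => K (v : UnitAddCircle) (u : UnitAddCircle))
    (hK.comp ((hcoe.comp measurable_fst).prodMk (hcoe.comp measurable_snd))) (C := C)
    (fun v u => hC _ _) (fun v u => by
      have h11 : ((u + 1 : ℝ) : UnitAddCircle) = u := AddCircle.coe_add_period 1 u
      simp only [h11]) hq (η := η) (fun v _ v' _ hvv u =>
          hη _ _ ((dist_coe_circle_le v v').trans hvv) _)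
  rw [integral_circle_eq, integral_circle_eq]
  simp only [integral_circle_eq (K _)]
  have e : ∀ v : ℝ, ((q * v : ℝ) : UnitAddCircle) = q • (v : UnitAddCircle) := fun v => by
    rw [← AddCircle.coe_nsmul, nsmul_eq_mul]
  simpa only [e] using h

/-- The points `x` and `(q x₁, x₂)` of the torus behave like independent variables, up to the common
second coordinate. -/
lemma abs_integral_torus_fast_le {K : UnitAddCircle → Torus2 → ℝ}
    (hK : Measurable (Function.uncurry K)) {C : ℝ} (hC : ∀ s x, |K s x| ≤ C) {q : ℕ} (hq : 1 ≤ q)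
    {η : ℝ} (hη : ∀ s s', dist s s' ≤ (q : ℝ)⁻¹ → ∀ x, |K s x - K s' x| ≤ η) :
    |(∫ x : Torus2, K x.1 (q • x.1, x.2)) - ∫ s, ∫ x, K s x| ≤ η := by
  have hm1 : Measurable fun x : Torus2 => K x.1 (q • x.1, x.2) :=
    hK.comp (measurable_fst.prodMk
      ((continuous_fst.nsmul q).measurable.prodMk measurable_snd))
  have hKs : ∀ s, Measurable (K s) := fun s => hK.comp (measurable_const.prodMk measurable_id)
  have hm2 : Measurable fun z : UnitAddCircle × UnitAddCircle => ∫ u, K z.1 (u, z.2) := by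
    have : Measurable (Function.uncurry fun (z : UnitAddCircle × UnitAddCircle) u => K z.1
        (u, z.2)) :=
      hK.comp ((measurable_fst.comp measurable_fst).prodMk
        (measurable_snd.prodMk (measurable_snd.comp measurable_fst)))
    exact (this.stronglyMeasurable.integral_prod_right (ν := volume)).measurable
  have hb2 : ∀ z : UnitAddCircle × UnitAddCircle, |∫ u, K z.1 (u, z.2)| ≤ C := fun z => by
    have := norm_integral_le_of_norm_le_const (μ := (volume : Measure UnitAddCircle))
      (Eventually.of_forall fun u => (Real.norm_eq_abs _).le.trans (hC z.1 (u, z.2)))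
    simpa using this
  have hi2 := integrable_of_measurable_of_abs_le
    (μ := (volume : Measure UnitAddCircle).prod volume) hm2 hb2
  have e1 : ∫ s, ∫ x, K s x = ∫ p, ∫ s, ∫ u, K s (u, p) := by
    rw [← integral_integral_swap (f := fun s p => ∫ u, K s (u, p)) hi2]
    refine integral_congr_ae (Eventually.of_forall fun s => ?_)
    exact integral_torus_eq _ (integrable_of_measurable_of_abs_le (hKs s) (hC s))
  rw [e1, integral_torus_eq _ (integrable_of_measurable_of_abs_le hm1 fun x => hC _ _)]
  have hi3 : Integrable fun p => ∫ s, K s (q • s, p) :=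
    Integrable.integral_prod_right (f := fun x : UnitAddCircle × UnitAddCircle => K x.1
        (q • x.1, x.2))
      (integrable_of_measurable_of_abs_le
        (μ := (volume : Measure UnitAddCircle).prod volume) hm1 fun x => hC _ _)
  have hi4 : Integrable fun p => ∫ s, ∫ u, K s (u, p) := hi2.integral_prod_right
  rw [← integral_sub hi3 hi4]
  have := norm_integral_le_of_norm_le_const (μ := (volume : Measure UnitAddCircle)) (C := η)
    (f := fun p => (∫ s, K s (q • s, p)) - ∫ s, ∫ u, K s (u, p)) (Eventually.of_forall fun p => by
      rw [Real.norm_eq_abs]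
      exact abs_integral_circle_fast_le (K := fun s u => K s (u, p))
        (hK.comp (measurable_fst.prodMk (measurable_snd.prodMk measurable_const)))
        (fun s u => hC _ _) hq fun s s' hs u => hη s s' hs _)
  simpa using this

end Conjugates

/-! ### The effect of one step on the orbit of the base point -/

section Orbit

/-- How far the image of the circle `x₂ = 0` is from being equidistributed, as seen by `f`. -/
noncomputable def deviation (H : List Shear) (f : Torus2 → ℝ) : ℝ :=
  |fiberMean (fun x => f (evalWord H x)) 0 - ∫ x, f x|

lemma deviation_nonneg (H : List Shear) (f : Torus2 → ℝ) : 0 ≤ deviation H f := abs_nonneg _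

lemma continuous_comp_evalWord {f : Torus2 → ℝ} (hf : Continuous f) (H : List Shear) :
    Continuous fun x => f (evalWord H x) := hf.comp (continuous_evalWord H)

lemma eventually_inv_le {δ : ℝ} (hδ : 0 < δ) : ∀ᶠ q : ℕ in atTop, (q : ℝ)⁻¹ ≤ δ :=
  (tendsto_inv_atTop_nhds_zero_nat (𝕜 := ℝ)).eventually_le_const hδ

/-- After one step, the circle `x₂ = 0` is distributed like its image in the covering torus. -/
lemma eventually_deviation_le {f : Torus2 → ℝ} (hf : Continuous f) (H φ : List Shear) {η : ℝ}
    (hη : 0 < η) : ∀ᶠ q : ℕ in atTop, deviation (H ++ scaleWord q φ) f ≤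
      |(∫ u, fiberMean (fun x => f (evalWord H x)) (track φ u)) - ∫ x, f x| + η := by
  set F : Torus2 → ℝ := fun x => f (evalWord H x) with hFdef
  have hF : Continuous F := continuous_comp_evalWord hf H
  obtain ⟨C, hC0, hC⟩ := exists_abs_le_torus hF
  obtain ⟨δ, hδ, hδF⟩ := exists_dist_torus_le hF (half_pos hη)
  filter_upwards [eventually_scaleWord_close hF φ (half_pos hη), eventually_inv_le hδ,
    eventually_ge_atTop 1] with q h1 h2 h3
  have hmK : Continuous fun z : UnitAddCircle × UnitAddCircle => F (z.1, track φ z.2) :=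
    hF.comp (continuous_fst.prodMk ((continuous_track φ).comp continuous_snd))
  have h4 := abs_integral_circle_fast_le (K := fun s u => F (s, track φ u)) hmK.measurable (C := C)
    (fun s u => hC _) h3 (η := η / 2) (fun s s' hs u => hδF _ _ (by
      rw [Prod.dist_eq]; exact max_le (hs.trans h2) (by simpa using hδ.le)))
  have e1 : ∫ s, ∫ u, F (s, track φ u) = ∫ u, fiberMean F (track φ u) :=
    integral_integral_swap (integrable_of_measurable_of_abs_le
      (μ := (volume : Measure UnitAddCircle).prod volume) hmK.measurable fun z => hC _)
  have hc1 : Continuous fun s : UnitAddCircle => F (evalWord (scaleWord q φ) (s, 0)) :=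
    hF.comp ((continuous_evalWord _).comp (continuous_id.prodMk continuous_const))
  have hc2 : Continuous fun s : UnitAddCircle => F (s, track φ (q • s)) :=
    hmK.comp (continuous_id.prodMk (continuous_id.nsmul q))
  have h5 : |(∫ s, F (evalWord (scaleWord q φ) (s, 0))) - ∫ s, F (s, track φ (q • s))| ≤ η / 2 := by
    have := abs_integral_sub_integral_le (μ := (volume : Measure UnitAddCircle)) (B := ∅)
      (integrable_of_measurable_of_abs_le hc1.measurable fun s => hC _)
      (integrable_of_measurable_of_abs_le hc2.measurable fun s => hC _) (half_pos hη).le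
      (fun s _ => h1 (s, 0)) fun s => h1 (s, 0)
    simpa using this
  rw [e1] at h4
  have e2 : deviation (H ++ scaleWord q φ) f =
      |(∫ s, F (evalWord (scaleWord q φ) (s, 0))) - ∫ x, f x| := by
    rw [deviation, fiberMean]; simp [hFdef]
  rw [e2]
  have h6 := abs_sub_le (∫ s, F (evalWord (scaleWord q φ) (s, 0))) (∫ s, F (s, track φ (q • s)))
    (∫ x, f x)
  have h7 := abs_sub_le (∫ s, F (s, track φ (q • s))) (∫ u, fiberMean F (track φ u)) (∫ x, f x)
  linarith

/-- Long Birkhoff averages along the orbit of the base point, after one step. The necessary length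
depends only on the word `H` before the step. -/
lemma exists_average_length {α : ℝ} (hα : Irrational α) {q : ℕ → ℕ} {p : ℕ → ℤ}
    (hqp : FastApprox α q p) {f : Torus2 → ℝ} (hf : Continuous f) (H : List Shear) {η : ℝ}
    (hη : 0 < η) : ∃ N₀ : ℕ, ∀ φ : List Shear, ∀ e : ℝ,
      (∀ U : ℝ, |(∫ w in (0 : ℝ)..1, fiberMean (fun x => f (evalWord H x))
        (track φ (((1 / 4 : ℝ) : UnitAddCircle) + ((U * w : ℝ) : UnitAddCircle)))) -
          ∫ x, f x| ≤ e) →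
      ∀ᶠ n in atTop, ∀ z : UnitAddCircle, q n • z = ((1 / 4 : ℝ) : UnitAddCircle) → ∀ N, N₀ ≤ N →
        |birkhoffAverage ℝ (conjPerm α (H ++ scaleWord (q n) φ)) f N
          (evalWord (H ++ scaleWord (q n) φ) (z, 0)) - ∫ x, f x| ≤ e + η := by
  set F : Torus2 → ℝ := fun x => f (evalWord H x) with hFdef
  have hF : Continuous F := continuous_comp_evalWord hf H
  have hη3 : 0 < η / 3 := by positivity
  obtain ⟨N₀, hN₀, h0⟩ := exists_average_sub_fiberMean_le hα hF hη3
  refine ⟨N₀, fun φ e he => ?_⟩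
  obtain ⟨τ₁, hτ₁, h1⟩ := h0 (track φ) (continuous_track φ)
  obtain ⟨τ₂, hτ₂, h2⟩ := exists_slow_average_close
    ((continuous_fiberMean hF).comp (continuous_track φ)) hη3
  have hfast := hqp.fast 1
  simp only [pow_one] at hfast
  filter_upwards [hqp.q_tendsto.eventually (eventually_scaleWord_close hF φ hη3),
    hfast.eventually_le_const hτ₁, hfast.eventually_le_const hτ₂] with n h3 h4 h5 z hz N hN
  have hq0 : (0 : ℝ) < q n := by exact_mod_cast hqp.q_pos n
  -- the `q n`-fold covering turns the rotation by `α` into the slow rotation by `τ`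
  set τ : ℝ := q n * α - p n with hτ
  have habs : |τ| = q n * |α - p n / q n| := by
    rw [← abs_of_pos hq0, ← abs_mul, abs_of_pos hq0, hτ]
    congr 1; field_simp
  have hmul : ∀ k : ℕ, q n • ((k * α : ℝ) : UnitAddCircle) = ((k * τ : ℝ) : UnitAddCircle) := by
    intro k
    have e1 : (k * τ : ℝ) = q n • (k * α) - ((k * p n : ℤ) : ℝ) := by
      rw [hτ, nsmul_eq_mul]; push_cast; ring
    have e2 : (((k * p n : ℤ) : ℝ) : UnitAddCircle) = 0 := by
      rw [AddCircle.coe_eq_zero_iff]; exact ⟨k * p n, by simp⟩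
    rw [e1, AddCircle.coe_sub, e2, sub_zero, AddCircle.coe_nsmul]
  have hN1 : 1 ≤ N := hN₀.trans hN
  have e1 : birkhoffAverage ℝ (conjPerm α (H ++ scaleWord (q n) φ)) f N
      (evalWord (H ++ scaleWord (q n) φ) (z, 0)) =
      ∑ k ∈ Finset.range N, (N : ℝ)⁻¹ *
        F (evalWord (scaleWord (q n) φ) (z + ((k * α : ℝ) : UnitAddCircle), 0)) := by
    rw [birkhoffAverage, birkhoffSum, smul_eq_mul, Finset.mul_sum]
    refine Finset.sum_congr rfl fun k _ => ?_
    rw [conjPerm_iterate, evalWord_append]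
    simp [hFdef]
  have h6 := abs_inv_mul_sum_le (d := N) hN1 (η := η / 3)
    (a := fun k => F (evalWord (scaleWord (q n) φ) (z + ((k * α : ℝ) : UnitAddCircle), 0)) -
      F (z + ((k * α : ℝ) : UnitAddCircle),
        track φ (((1 / 4 : ℝ) : UnitAddCircle) + ((k * τ : ℝ) : UnitAddCircle)))) (fun k _ => by
      have := h3 (z + ((k * α : ℝ) : UnitAddCircle), 0)
      rwa [smul_add, hz, hmul] at this)
  simp only [mul_sub, Finset.sum_sub_distrib] at h6
  -- average over the fibres, then over the time; the whole orbit segment becomes the window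
  -- from `1 / 4` to `1 / 4 + N τ`
  have h7 := h1 τ (by rw [habs]; exact h4) N hN z ((1 / 4 : ℝ) : UnitAddCircle)
  have h8 := h2 τ (by rw [habs]; exact h5) N hN1 ((1 / 4 : ℝ) : UnitAddCircle)
  have h9 := he (N * τ)
  rw [e1]
  simp only [Finset.mul_sum, Function.comp_apply] at h7 h8
  set A := ∑ k ∈ Finset.range N, (N : ℝ)⁻¹ *
        F (evalWord (scaleWord (q n) φ) (z + ((k * α : ℝ) : UnitAddCircle), 0))
  have t1 := abs_sub_le A _ _ |>.trans (add_le_add h6 h7)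
  have t2 := abs_sub_le A _ _ |>.trans (add_le_add t1 h8)
  have t3 := abs_sub_le A _ _ |>.trans (add_le_add t2 h9)
  linarith

lemma exists_nsmul_eq_near {q : ℕ} (hq : 1 ≤ q) (z u : UnitAddCircle) :
    ∃ z' : UnitAddCircle, q • z' = u ∧ dist z' z ≤ (q : ℝ)⁻¹ := by
  have hq0 : (0 : ℝ) < q := by exact_mod_cast hq
  obtain ⟨t, ht, e⟩ := exists_rep_mem_Ico u (q * rep z)
  refine ⟨((t / q : ℝ) : UnitAddCircle), ?_, ?_⟩
  · rw [← AddCircle.coe_nsmul, nsmul_eq_mul, mul_div_cancel₀ _ hq0.ne', e]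
  · conv_lhs => rw [← coe_rep z]
    refine (dist_coe_circle_le _ _).trans ?_
    have e2 : t / q - rep z = (t - q * rep z) / q := by field_simp
    rw [e2, abs_div, abs_of_pos hq0, abs_of_nonneg (by linarith [ht.1]), inv_eq_one_div]
    exact div_le_div_of_nonneg_right (by linarith [ht.2]) hq0.le

/-- The base point hardly moves in one step. -/
lemma eventually_dist_basePoint_le (H φ : List Shear)
    (hφ : track φ ((1 / 4 : ℝ) : UnitAddCircle) = 0) (z : UnitAddCircle) {η : ℝ} (hη : 0 < η) :
    ∀ᶠ q : ℕ in atTop, ∃ z' : UnitAddCircle, q • z' = ((1 / 4 : ℝ) : UnitAddCircle) ∧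
      dist (evalWord (H ++ scaleWord q φ) (z', 0)) (evalWord H (z, 0)) ≤ η := by
  obtain ⟨δ, hδ, hδH⟩ := Metric.uniformContinuous_iff.mp
    (CompactSpace.uniformContinuous_of_continuous (continuous_evalWord H)) η hη
  obtain ⟨C, hC⟩ := exists_dist_scaleWord_fst φ
  have ht : Tendsto (fun q : ℕ => C * (q : ℝ)⁻¹) atTop (𝓝 0) := by
    simpa using (tendsto_inv_atTop_nhds_zero_nat (𝕜 := ℝ)).const_mul C
  filter_upwards [ht.eventually_lt_const (half_pos hδ),
      eventually_inv_le (δ := δ / 4) (by linarith),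
    eventually_ge_atTop 1] with q h1 h2 h3
  obtain ⟨z', hz', hd⟩ := exists_nsmul_eq_near h3 z ((1 / 4 : ℝ) : UnitAddCircle)
  refine ⟨z', hz', ?_⟩
  rw [evalWord_append, Equiv.Perm.mul_apply]
  refine (hδH ?_).le
  have e : (evalWord (scaleWord q φ) (z', 0)).2 = 0 := by
    rw [scaleWord_snd q (by omega)]; simpa [hz', track] using hφ
  rw [Prod.dist_eq, e, dist_self]
  refine max_lt ?_ hδ
  have := dist_triangle (evalWord (scaleWord q φ) (z', 0)).1 z' z
  have := hC q (z', 0)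
  simp only at this
  linarith

end Orbit

/-! ### The effect of one step on the strips -/

section StripImages

variable {r : ℕ}

/-- The image of a strip under a word. -/
def stripImage (H : List Shear) (t : ZMod r) : Set Torus2 := evalWord H '' {x | cell r x.2 = t}

lemma measurableSet_strip (t : ZMod r) : MeasurableSet {x : Torus2 | cell r x.2 = t} :=
  measurable_snd (measurableSet_cell r {t})

lemma measurableSet_stripImage (H : List Shear) (t : ZMod r) : MeasurableSet (stripImage H t) :=
  (measurableEmbedding_evalWord H).measurableSet_image' (measurableSet_strip t)

lemma volume_image_evalWord (H : List Shear) (A : Set Torus2) :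
    volume (evalWord H '' A) = volume A := by
  rw [← (measurePreserving_evalWord H).measure_preimage_emb (measurableEmbedding_evalWord H),
    Set.preimage_image_eq _ (evalWord H).injective]

lemma volume_stripImage [NeZero r] (H : List Shear) (t : ZMod r) :
    volume (stripImage H t) = (r : ENNReal)⁻¹ := by
  rw [stripImage, volume_image_evalWord]
  exact (volume_snd_preimage (measurableSet_cell r {t})).trans (volume_cell r t)

lemma disjoint_stripImage (H : List Shear) {s t : ZMod r} (h : s ≠ t) :
    Disjoint (stripImage H s) (stripImage H t) :=
  (Set.disjoint_image_iff (evalWord H).injective).mpr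
    (Set.disjoint_left.mpr fun _ h1 h2 => h (h1.symm.trans h2))

lemma setIntegral_stripImage (H : List Shear) (t : ZMod r) (f : Torus2 → ℝ) :
    ∫ x in stripImage H t, f x =
      ∫ x : Torus2, onStrip t (fun y => f (evalWord H (x.1, y))) x.2 := by
  rw [stripImage, (measurePreserving_evalWord H).setIntegral_image_emb
    (measurableEmbedding_evalWord H), ← integral_indicator (measurableSet_strip t)]
  refine integral_congr_ae (Eventually.of_forall fun x => ?_)
  simp [onStrip, Set.indicator_apply]

lemma measurePreserving_nsmul_fst {q : ℕ} (hq : 1 ≤ q) :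
    MeasurePreserving (fun x : Torus2 => (q • x.1, x.2)) volume volume := by
  have h : MeasurePreserving (fun u : UnitAddCircle => q • u) volume volume := by
    rcases hq.eq_or_lt with rfl | hq
    · simp only [one_smul]
      exact MeasurePreserving.id (volume : Measure UnitAddCircle)
    · exact (AddCircle.ergodic_nsmul hq).toMeasurePreserving
  exact h.prod (MeasurePreserving.id volume)

/-- The strips move in one step as little as they do in the covering torus. -/
lemma volume_symmDiff_stripImage_le [NeZero r] (H φ : List Shear) {q : ℕ} (hq : 1 ≤ q)
    (t : ZMod r) :
    volume (symmDiff (stripImage (H ++ scaleWord q φ) t) (stripImage H t)) ≤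
      volume {x | cell r (heightAfter φ x) ≠ cell r x.2} := by
  have hsub : symmDiff (stripImage (H ++ scaleWord q φ) t) (stripImage H t) ⊆
      evalWord (H ++ scaleWord q φ) '' ((fun x : Torus2 => (q • x.1, x.2)) ⁻¹'
        {x | cell r (heightAfter φ x) ≠ cell r x.2}) := by
    intro y hy
    obtain ⟨x, rfl⟩ := (evalWord (H ++ scaleWord q φ)).surjective y
    refine ⟨x, ?_, rfl⟩
    have h1 : evalWord (H ++ scaleWord q φ) x ∈ stripImage (H ++ scaleWord q φ) t ↔
        cell r x.2 = t := (evalWord _).injective.mem_set_image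
    have h2 : evalWord (H ++ scaleWord q φ) x ∈ stripImage H t ↔
        cell r (heightAfter φ (q • x.1, x.2)) = t := by
      rw [evalWord_append, Equiv.Perm.mul_apply, heightAfter, ← scaleWord_snd q (by omega)]
      exact (evalWord _).injective.mem_set_image
    rw [Set.mem_preimage, Set.mem_ofPred_eq]
    intro h
    rw [Set.mem_symmDiff, h1, h2, h] at hy
    tauto
  refine (measure_mono hsub).trans ?_
  rw [volume_image_evalWord]
  have hm : MeasurableSet {x | cell r (heightAfter φ x) ≠ cell r x.2} := by
    have e : {x : Torus2 | cell r (heightAfter φ x) ≠ cell r x.2} =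
        (⋃ s : ZMod r, {x : Torus2 | cell r (heightAfter φ x) = s} ∩ {x | cell r x.2 = s})ᶜ := by
      ext x; simp [eq_comm]
    rw [e]
    refine (MeasurableSet.iUnion fun s => MeasurableSet.inter ?_ (measurableSet_strip s)).compl
    exact (continuous_heightAfter φ).measurable (measurableSet_cell r {s})
  rw [(measurePreserving_nsmul_fst hq).measure_preimage hm.nullMeasurableSet]

end StripImages

/-! ### The three kinds of steps -/

section Quiet

lemma norm_coe_of_abs_le {t : ℝ} (ht : |t| ≤ 1 / 2) : ‖(t : UnitAddCircle)‖ = |t| := by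
  rw [AddCircle.norm_coe_eq_abs_iff (1 : ℝ) one_ne_zero]
  simpa using ht

/-- If the image of the circle `x₂ = 0` stays at height `0` off a small set, away from `u = 1 / 4`,
then averages along it are close to values at height `0`. -/
lemma average_track_le {φ : List Shear} {B : Set UnitAddCircle} (hB : MeasurableSet B)
    (hφ : ∀ u ∉ B, track φ u = 0) {δ : ℝ} (hδ : 0 ≤ δ) (hvol : volume B ≤ ENNReal.ofReal δ)
    (hquarter : ∀ v : ℝ, |v| < 1 / 8 → ((1 / 4 : ℝ) : UnitAddCircle) + (v : UnitAddCircle) ∉ B)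
    {G : UnitAddCircle → ℝ} (hG : Continuous G) (hG1 : ∀ y, |G y| ≤ 1) (m : ℝ) :
    (∀ U : ℝ, |(∫ w in (0 : ℝ)..1, G (track φ (((1 / 4 : ℝ) : UnitAddCircle) +
      ((U * w : ℝ) : UnitAddCircle)))) - m| ≤ |G 0 - m| + 18 * δ) ∧
    |(∫ u, G (track φ u)) - m| ≤ |G 0 - m| + 2 * δ := by
  have hD : Continuous fun u => G (track φ u) := hG.comp (continuous_track φ)
  have hvolR : (volume : Measure UnitAddCircle).real B ≤ δ :=
    ENNReal.toReal_le_of_le_ofReal hδ hvol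
  have h2 : ∀ u, |G (track φ u) - G 0| ≤ 2 := fun u => by
    refine (abs_sub _ _).trans ?_
    linarith [hG1 (track φ u), hG1 0]
  have h0 : ∀ u ∉ B, |G (track φ u) - G 0| ≤ 0 := fun u hu => by rw [hφ u hu]; simp
  constructor
  · intro U
    have h1 := abs_window_sub_const_le hD.measurable hB (fun u _ => h2 u) le_rfl h0
      (by norm_num : (0 : ℝ) < 1 / 8) zero_le_two hquarter U
    have h3 := abs_sub_le (∫ w in (0 : ℝ)..1, G (track φ (((1 / 4 : ℝ) : UnitAddCircle) +
      ((U * w : ℝ) : UnitAddCircle)))) (G 0) m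
    have h4 : (volume B).toReal ≤ δ := hvolR
    linarith
  · have h1 := abs_integral_sub_integral_le (μ := (volume : Measure UnitAddCircle))
      (integrable_of_measurable_of_abs_le hD.measurable fun u => hG1 _) (integrable_const (G 0))
      le_rfl h0 h2
    rw [integral_const] at h1
    simp only [probReal_univ, smul_eq_mul, one_mul, zero_add] at h1
    have h3 := abs_sub_le (∫ u, G (track φ u)) (G 0) m
    linarith

lemma integral_fiberMean_comp_evalWord {f : Torus2 → ℝ} (hf : Continuous f) (H : List Shear) :
    ∫ y, fiberMean (fun x => f (evalWord H x)) y = ∫ x, f x := by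
  rw [integral_fiberMean (continuous_comp_evalWord hf H), integral_comp_evalWord]

end Quiet

section Rotation

/-- Forward orbits of an irrational rotation are uniformly dense. -/
lemma exists_rotation_dense {α : ℝ} (hα : Irrational α) {δ : ℝ} (hδ : 0 < δ) :
    ∃ K : ℕ, ∀ s w : UnitAddCircle, ∃ k ≤ K, dist (s + ((k * α : ℝ) : UnitAddCircle)) w ≤ δ := by
  set F : Torus2 → ℝ := fun x => max 0 (δ - ‖x.1 - x.2‖) with hFdef
  have hF : Continuous F :=
    continuous_const.max (continuous_const.sub (continuous_fst.sub continuous_snd).norm)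
  set ψ : UnitAddCircle → ℝ := fun s => max 0 (δ - ‖s‖) with hψdef
  have hψ : Continuous ψ := continuous_const.max (continuous_const.sub continuous_norm)
  have hpos : 0 < ∫ s, ψ s := by
    refine hψ.integral_pos_of_hasCompactSupport_nonneg_nonzero (.of_compactSpace _)
      (fun s => le_max_left _ _) (x := 0) ?_
    simp [hψdef, hδ.ne', hδ.le]
  have hmean : ∀ y, fiberMean F y = ∫ s, ψ s := fun y => by
    rw [fiberMean, ← integral_sub_right_eq_self ψ y]
  obtain ⟨L, hL, h⟩ := exists_uniform_average hα hF (half_pos hpos)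
  refine ⟨L, fun s w => ?_⟩
  by_contra! hcon
  have h1 := h s w
  rw [hmean, Finset.sum_eq_zero, zero_sub, abs_neg, abs_of_pos hpos] at h1
  · linarith
  · intro l hl
    have := hcon l (Finset.mem_range.mp hl).le
    rw [dist_eq_norm] at this
    simp only [hFdef]
    rw [max_eq_left (by linarith), mul_zero]

end Rotation

section Sweep

/-- The step that halves the deviation. -/
lemma exists_sweeping_word (r : ℕ) (f : ℕ → Torus2 → ℝ) (hf : ∀ i, Continuous (f i))
    (hf1 : ∀ i x, |f i x| ≤ 1) (n : ℕ) (H : List Shear) {ε : ℝ} (hε : 0 < ε) : ∃ φ : List Shear,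
    volume {x | cell r (heightAfter φ x) ≠ cell r x.2} ≤ ENNReal.ofReal ε ∧
    track φ ((1 / 4 : ℝ) : UnitAddCircle) = 0 ∧ ∀ i ≤ n,
      (∀ U : ℝ, |(∫ w in (0 : ℝ)..1, fiberMean (fun x => f i (evalWord H x))
        (track φ (((1 / 4 : ℝ) : UnitAddCircle) + ((U * w : ℝ) : UnitAddCircle)))) - ∫ x, f i x| ≤
          deviation H (f i) + ε) ∧
      |(∫ u, fiberMean (fun x => f i (evalWord H x)) (track φ u)) - ∫ x, f i x| ≤
        deviation H (f i) / 2 + ε := by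
  have hG : ∀ i, Continuous (fiberMean fun x => f i (evalWord H x)) := fun i =>
    continuous_fiberMean (continuous_comp_evalWord (hf i) H)
  have hδ : ∃ δ > 0, ∀ i ≤ n, ∀ x y, dist x y ≤ δ → |fiberMean (fun x => f i (evalWord H x)) x -
      fiberMean (fun x => f i (evalWord H x)) y| ≤ ε / 2 := by
    have hc : Continuous fun y => fun i : Fin (n + 1) =>
        fiberMean (fun x => f i (evalWord H x)) y :=
      continuous_pi fun i => hG i
    obtain ⟨δ, hδ, h⟩ := Metric.uniformContinuous_iff.mp
      (CompactSpace.uniformContinuous_of_continuous hc) (ε / 2) (by positivity)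
    refine ⟨δ / 2, by positivity, fun i hi x y hxy => ?_⟩
    have := (dist_pi_lt_iff (by positivity)).mp (h (lt_of_le_of_lt hxy (by linarith)))
      ⟨i, by omega⟩
    exact this.le
  obtain ⟨δ, hδ, hδG⟩ := hδ
  have hm : 0 < min δ (ε / 4) := lt_min hδ (by positivity)
  obtain ⟨φ, h1, h2, h3⟩ := exists_sweep hm
  refine ⟨φ, (measure_mono fun x hx => ?_).trans (h1.trans (ENNReal.ofReal_le_ofReal
    ((min_le_right _ _).trans (by linarith)))), h2, fun i hi => ?_⟩
  · rw [Set.mem_ofPred_eq] at hx ⊢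
    intro h
    exact hx (by rw [heightAfter, h])
  · have hint := integral_fiberMean_comp_evalWord (hf i) H
    have hC : ∀ y, |fiberMean (fun x => f i (evalWord H x)) y -
        ∫ x, fiberMean (fun x => f i (evalWord H x)) x| ≤ 2 := fun y => by
      refine (abs_sub _ _).trans ?_
      have e1 := abs_fiberMean_le (F := fun x => f i (evalWord H x)) (fun x => hf1 i _) y
      have e2 : |∫ x, f i x| ≤ 1 := by
        have := norm_integral_le_of_norm_le_const (μ := (volume : Measure Torus2))
          (Eventually.of_forall fun x => (Real.norm_eq_abs _).le.trans (hf1 i x))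
        simpa using this
      rw [hint]; linarith
    have := h3 _ (hG i) 2 hC (ε / 2) fun y hy => hδG i hi y 0
      (by rw [dist_zero_right]; exact hy.trans (min_le_left _ _))
    rw [hint] at this
    have hmin := min_le_right δ (ε / 4)
    unfold deviation
    exact ⟨fun U => (this.1 U).trans (by linarith), this.2.trans (by linarith)⟩

end Sweep

section Cover

/-- The step that makes every orbit `ε`-dense. -/
lemma exists_covering_word {α : ℝ} (hα : Irrational α) (r : ℕ) (f : ℕ → Torus2 → ℝ)
    (hf : ∀ i, Continuous (f i)) (hf1 : ∀ i x, |f i x| ≤ 1) (H : List Shear) {ε : ℝ} (hε : 0 < ε) :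
    ∃ φ : List Shear,
    volume {x | cell r (heightAfter φ x) ≠ cell r x.2} ≤ ENNReal.ofReal ε ∧
    track φ ((1 / 4 : ℝ) : UnitAddCircle) = 0 ∧ (∀ i,
      (∀ U : ℝ, |(∫ w in (0 : ℝ)..1, fiberMean (fun x => f i (evalWord H x))
        (track φ (((1 / 4 : ℝ) : UnitAddCircle) + ((U * w : ℝ) : UnitAddCircle)))) - ∫ x, f i x| ≤
          deviation H (f i) + ε) ∧
      |(∫ u, fiberMean (fun x => f i (evalWord H x)) (track φ u)) - ∫ x, f i x| ≤
        deviation H (f i) + ε) ∧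
    ∀ᶠ q : ℕ in atTop, ∃ K : ℕ, ∀ x w, ∃ k ≤ K,
      dist ((conjPerm α (H ++ scaleWord q φ))^[k] x) w ≤ ε := by
  set δ : ℝ := min (ε / 18) (1 / 8) with hδdef
  have hδ : 0 < δ := lt_min (by positivity) (by norm_num)
  have hδ1 : δ ≤ ε / 18 := min_le_left _ _
  have hδ2 : δ ≤ 1 / 8 := min_le_right _ _
  obtain ⟨g, hg1, hg2⟩ := exists_covering_bump hδ (by linarith)
  set B : Set UnitAddCircle := {u | rep u ∈ Set.Icc 0 δ} with hB
  have hmB : MeasurableSet B := measurable_rep measurableSet_Icc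
  have hvB : volume B ≤ ENNReal.ofReal δ := by
    refine (volume_rep_le measurableSet_Icc).trans ?_
    rw [Real.volume_Icc, sub_zero]
  have hgB : ∀ u ∉ B, g.circ u = 0 := fun u hu => by
    rw [g.circ_eq]
    refine hg1 _ ⟨?_, (rep_mem u).2.le⟩
    by_contra! h
    exact hu ⟨(rep_mem u).1, h.le⟩
  have htB : ∀ u ∉ B, track [.V g] u = 0 := fun u hu => by simp [track, hgB u hu]
  have hqB : ∀ v : ℝ, |v| < 1 / 8 → ((1 / 4 : ℝ) : UnitAddCircle) + (v : UnitAddCircle) ∉ B := by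
    intro v hv hcon
    rw [abs_lt] at hv
    rw [hB, Set.mem_ofPred_eq, ← AddCircle.coe_add,
        rep_coe_of_mem ⟨by linarith, by linarith⟩] at hcon
    linarith [hcon.2]
  refine ⟨[.V g], ?_, ?_, fun i => ?_, ?_⟩
  · refine (measure_mono (t := {x | x.1 ∈ B}) fun x hx => ?_).trans
      ((volume_fst_preimage hmB).le.trans (hvB.trans (ENNReal.ofReal_le_ofReal (by linarith))))
    by_contra h
    exact hx (by simp [heightAfter, hgB x.1 h])
  · have := hqB 0 (by norm_num)
    rw [AddCircle.coe_zero, add_zero] at this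
    exact htB _ this
  · have h := average_track_le hmB htB hδ.le hvB hqB
      (continuous_fiberMean (continuous_comp_evalWord (hf i) H))
      (abs_fiberMean_le fun x => hf1 i _) (∫ x, f i x)
    exact ⟨fun U => (h.1 U).trans (by rw [deviation]; linarith),
      h.2.trans (by rw [deviation]; linarith)⟩
  · obtain ⟨δ₁, hδ₁, h1⟩ := Metric.uniformContinuous_iff.mp
      (CompactSpace.uniformContinuous_of_continuous (continuous_evalWord H)) (ε / 2) (by positivity)
    filter_upwards [eventually_inv_le (half_pos hδ₁), eventually_ge_atTop 1] with q hq hq1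
    obtain ⟨δ₂, hδ₂, h2⟩ := Metric.uniformContinuous_iff.mp
      (CompactSpace.uniformContinuous_of_continuous (continuous_evalWord (H ++ scaleWord q [.V g])))
      (ε / 2) (by positivity)
    obtain ⟨K, hK⟩ := exists_rotation_dense hα (half_pos hδ₂)
    refine ⟨K, fun x w => ?_⟩
    obtain ⟨y, rfl⟩ := (evalWord (H ++ scaleWord q [.V g])).surjective x
    obtain ⟨v, rfl⟩ := (evalWord H).surjective w
    -- the shear `V g` covers all heights, so near `v₁` there is a point of the right height
    obtain ⟨u, hu⟩ := hg2 (v.2 - y.2)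
    obtain ⟨s, hs, hsv⟩ := exists_nsmul_eq_near hq1 v.1 (u : UnitAddCircle)
    obtain ⟨k, hk, hks⟩ := hK y.1 s
    refine ⟨k, hk, ?_⟩
    rw [conjPerm_iterate]
    have e1 : evalWord (H ++ scaleWord q [.V g]) (s, y.2) = evalWord H (s, v.2) := by
      rw [evalWord_append, Equiv.Perm.mul_apply]
      congr 1
      simp [scaleWord, Shear.scale, hs, hu]
    have d1 : dist (evalWord (H ++ scaleWord q [.V g]) (y + (((k * α : ℝ) : UnitAddCircle), 0)))
        (evalWord (H ++ scaleWord q [.V g]) (s, y.2)) < ε / 2 := by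
      refine h2 ?_
      rw [Prod.dist_eq]
      refine max_lt (lt_of_le_of_lt hks (by linarith)) ?_
      simpa using hδ₂
    have d2 : dist (evalWord H (s, v.2)) (evalWord H v) < ε / 2 := by
      refine h1 ?_
      rw [Prod.dist_eq]
      refine max_lt (lt_of_le_of_lt (hsv.trans hq) (by linarith)) ?_
      simpa using hδ₁
    rw [e1] at d1
    linarith [dist_triangle (evalWord (H ++ scaleWord q [.V g])
        (y + (((k * α : ℝ) : UnitAddCircle), 0)))
      (evalWord H (s, v.2)) (evalWord H v)]

end Cover

section Mix

variable {r : ℕ} [NeZero r]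

/-- Every vertical segment across a strip is equidistributed in the image of the strip, up to `ε`,
as seen by the functions `f 0, …, f n`. -/
def Equalized (r : ℕ) (f : ℕ → Torus2 → ℝ) (n : ℕ) (H : List Shear) (ε : ℝ) : Prop :=
  ∀ i ≤ n, ∀ (t : ZMod r) (s : UnitAddCircle),
    |(∫ y, onStrip t (fun y => f i (evalWord H (s, y))) y) - ∫ x in stripImage H t, f i x| ≤ ε

lemma exists_forall_le_dist_torus_le {f : ℕ → Torus2 → ℝ} (hf : ∀ i, Continuous (f i)) (n : ℕ)
    {ε : ℝ} (hε : 0 < ε) : ∃ δ > 0, ∀ i ≤ n, ∀ x y, dist x y ≤ δ → |f i x - f i y| ≤ ε := by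
  have hc : Continuous fun y => fun i : Fin (n + 1) => f i y := continuous_pi fun i => hf i
  obtain ⟨δ, hδ, h⟩ := Metric.uniformContinuous_iff.mp
    (CompactSpace.uniformContinuous_of_continuous hc) ε hε
  refine ⟨δ / 2, by positivity, fun i hi x y hxy => ?_⟩
  have := (dist_pi_lt_iff hε).mp (h (lt_of_le_of_lt hxy (by linarith))) ⟨i, by omega⟩
  exact this.le

lemma stripImage_append_horizontal {r : ℕ} (H : List Shear) (b : PerFun) (t : ZMod r) :
    stripImage (H ++ [.W b]) t = stripImage H t := by
  rw [stripImage, evalWord_append, Equiv.Perm.coe_mul, Set.image_comp]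
  congr 1
  ext x
  constructor
  · rintro ⟨y, hy, rfl⟩
    simpa using hy
  · intro hx
    exact ⟨(evalWord [.W b]).symm x, by
      obtain ⟨y, rfl⟩ := (evalWord [.W b]).surjective x
      rw [Equiv.symm_apply_apply]
      simpa using hx, Equiv.apply_symm_apply _ _⟩

/-- A word is made equalized by a horizontal shear. -/
lemma exists_equalized {f : ℕ → Torus2 → ℝ} (hf : ∀ i, Continuous (f i))
    (hf1 : ∀ i x, |f i x| ≤ 1) (n : ℕ) (H : List Shear) {ε : ℝ} (hε : 0 < ε) :
    ∃ b : PerFun, b.circ 0 = 0 ∧ Equalized r f n (H ++ [.W b]) ε := by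
  obtain ⟨δ, hδ, h⟩ := exists_forall_le_dist_torus_le
    (fun i => continuous_comp_evalWord (hf i) H) n (half_pos hε)
  have hm : 0 < min δ (ε / 2) := lt_min hδ (by positivity)
  obtain ⟨b, hb, h1⟩ := exists_equalizing_shear r hm
  refine ⟨b, hb, fun i hi t s => ?_⟩
  have h2 := h1 (fun x => f i (evalWord H x)) (continuous_comp_evalWord (hf i) H) 1
      (fun x => hf1 i _)
    (ε / 2) (fun x y hxy => h i hi x y (hxy.trans (min_le_left _ _))) t s
  rw [stripImage_append_horizontal, setIntegral_stripImage]
  have e : (fun y => f i (evalWord (H ++ [.W b]) (s, y))) =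
      fun y => f i (evalWord H (s + (b.circ y : ℝ), y)) := by
    funext y; simp
  rw [e]
  linarith [min_le_right δ (ε / 2)]

lemma integral_stripImage_mul_iterate {r : ℕ} (α : ℝ) (H : List Shear) (t : ZMod r)
    (f g : Torus2 → ℝ)
    (m : ℕ) : ∫ x in stripImage H t, f x * g ((conjPerm α H)^[m] x) =
      ∫ x : Torus2, onStrip t (fun _ => f (evalWord H x) *
        g (evalWord H (x + (((m * α : ℝ) : UnitAddCircle), 0)))) x.2 := by
  rw [setIntegral_stripImage]
  refine integral_congr_ae (Eventually.of_forall fun x => ?_)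
  simp only [onStrip, conjPerm_iterate]

lemma abs_mul_sub_mul_le {a b a' b' e e' : ℝ} (ha : |a| ≤ 1) (hb' : |b'| ≤ 1) (h1 : |a - a'| ≤ e)
    (h2 : |b - b'| ≤ e') : |a * b - a' * b'| ≤ e + e' := by
  have e : a * b - a' * b' = a * (b - b') + (a - a') * b' := by ring
  rw [e]
  refine (abs_add_le _ _).trans ?_
  rw [abs_mul, abs_mul]
  have := mul_le_mul ha h2 (abs_nonneg _) zero_le_one
  have := mul_le_mul h1 hb' (abs_nonneg _) ((abs_nonneg _).trans h1)
  linarith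

/-- Translation by `c`, where `c` is small but `q c` is close to `1 / 2`, acts after one step like
translation by `1 / 2` in the covering torus. -/
lemma exists_half_translation {r : ℕ} {f g : Torus2 → ℝ} (hf : Continuous f) (hg : Continuous g)
    (hf1 : ∀ x, |f x| ≤ 1) (hg1 : ∀ x, |g x| ≤ 1) (φ : List Shear) {η : ℝ} (hη : 0 < η) :
    ∃ ρ > 0, ∀ᶠ q : ℕ in atTop, ∀ c : UnitAddCircle, ‖c‖ ≤ ρ →
      ‖q • c - ((1 / 2 : ℝ) : UnitAddCircle)‖ ≤ ρ → ∀ t : ZMod r,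
      |(∫ x : Torus2, onStrip t (fun _ => f (evalWord (scaleWord q φ) x) *
          g (evalWord (scaleWord q φ) (x + (c, 0)))) x.2) -
        ∫ s, ∫ x : Torus2, onStrip t (fun _ => f (s, heightAfter φ x) *
          g (s, heightAfter φ (x + (((1 / 2 : ℝ) : UnitAddCircle), 0)))) x.2| ≤ η := by
  have hη5 : 0 < η / 5 := by positivity
  obtain ⟨δf, hδf, hf2⟩ := exists_dist_torus_le hf hη5
  obtain ⟨δg, hδg, hg2⟩ := exists_dist_torus_le hg hη5
  obtain ⟨ρ, hρ, hρ2⟩ := Metric.uniformContinuous_iff.mp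
    (CompactSpace.uniformContinuous_of_continuous (continuous_heightAfter φ)) δg hδg
  refine ⟨min (ρ / 2) δg, lt_min (half_pos hρ) hδg, ?_⟩
  filter_upwards [eventually_scaleWord_close hf φ hη5, eventually_scaleWord_close hg φ hη5,
    eventually_inv_le hδf, eventually_inv_le hδg, eventually_ge_atTop 1] with
    q h1 h2 h3 h4 h5 c hc hqc t
  set c₂ : Torus2 := (((1 / 2 : ℝ) : UnitAddCircle), 0) with hc₂
  have hhm := (continuous_heightAfter φ).measurable
  have hms : ∀ {F : Torus2 → ℝ}, Measurable F → Measurable fun x : Torus2 =>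
      onStrip t (fun _ => F x) x.2 := fun hF =>
    Measurable.ite (measurable_snd (measurableSet_cell r {t})) hF measurable_const
  have hprod : ∀ {a b : ℝ}, |a| ≤ 1 → |b| ≤ 1 → |a * b| ≤ 1 := fun ha hb => by
    rw [abs_mul]; exact mul_le_one₀ ha (abs_nonneg _) hb
  have hK : Measurable (Function.uncurry fun (s : UnitAddCircle) (x : Torus2) =>
      onStrip t (fun _ => f (s, heightAfter φ x) * g (s, heightAfter φ (x + c₂))) x.2) := by
    refine Measurable.ite (measurable_snd.comp measurable_snd (measurableSet_cell r {t})) ?_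
      measurable_const
    exact (hf.measurable.comp (measurable_fst.prodMk (hhm.comp measurable_snd))).mul
      (hg.measurable.comp (measurable_fst.prodMk (hhm.comp (measurable_snd.add_const c₂))))
  have h6 := abs_integral_torus_fast_le hK (C := 1)
    (fun s x => abs_onStrip_le t (fun _ => hprod (hf1 _) (hg1 _)) _) h5 (η := η / 5 + η / 5)
    (fun s s' hs x => by
      rw [onStrip, onStrip]
      split_ifs
      · refine abs_mul_sub_mul_le (hf1 _) (hg1 _) (hf2 _ _ ?_) (hg2 _ _ ?_)
        · rw [Prod.dist_eq]; exact max_le (hs.trans h3) (by simpa using hδf.le)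
        · rw [Prod.dist_eq]; exact max_le (hs.trans h4) (by simpa using hδg.le)
      · simpa using hη5.le)
  have hqm : Measurable fun x : Torus2 => (q • x.1, x.2) :=
    ((continuous_fst.nsmul q).prodMk continuous_snd).measurable
  have hsm := (continuous_evalWord (scaleWord q φ)).measurable
  -- replace the word by the change of height, and then the translation by the one by `1 / 2`
  have h7 : |(∫ x : Torus2, onStrip t (fun _ => f (evalWord (scaleWord q φ) x) *
      g (evalWord (scaleWord q φ) (x + (c, 0)))) x.2) -
      ∫ x : Torus2, onStrip t (fun _ => f (x.1, heightAfter φ (q • x.1, x.2)) *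
        g (x.1, heightAfter φ ((q • x.1, x.2) + c₂))) x.2| ≤ η / 5 + (η / 5 + η / 5) := by
    have hpt : ∀ x : Torus2, |onStrip t (fun _ => f (evalWord (scaleWord q φ) x) *
        g (evalWord (scaleWord q φ) (x + (c, 0)))) x.2 -
        onStrip t (fun _ => f (x.1, heightAfter φ (q • x.1, x.2)) *
          g (x.1, heightAfter φ ((q • x.1, x.2) + c₂))) x.2| ≤ η / 5 + (η / 5 + η / 5) := by
      intro x
      rw [onStrip, onStrip]
      split_ifs
      · refine abs_mul_sub_mul_le (hf1 _) (hg1 _) (h1 x) ?_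
        refine (abs_sub_le _ _ _).trans (add_le_add (h2 (x + (c, 0))) (hg2 _ _ ?_))
        rw [Prod.dist_eq]
        refine max_le ?_ (hρ2 ?_).le
        · simpa [dist_eq_norm] using hc.trans (min_le_right _ _)
        · have e : dist (q • (x + (c, 0)).1, (x + (c, 0)).2) ((q • x.1, x.2) + c₂) =
              ‖q • c - ((1 / 2 : ℝ) : UnitAddCircle)‖ := by
            rw [Prod.dist_eq]
            have e1 : dist (q • (x + (c, 0)).1) ((q • x.1, x.2) + c₂).1 =
                ‖q • c - ((1 / 2 : ℝ) : UnitAddCircle)‖ := by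
              rw [dist_eq_norm]
              congr 1
              simp only [hc₂, Prod.fst_add, smul_add]
              abel
            have e2 : dist (x + (c, 0)).2 ((q • x.1, x.2) + c₂).2 = 0 := by simp [hc₂]
            rw [e1, e2]
            exact max_eq_left (norm_nonneg _)
          rw [e]
          exact lt_of_le_of_lt (hqc.trans (min_le_left _ _)) (by linarith)
      · rw [sub_self, abs_zero]; positivity
    have := abs_integral_sub_integral_le (μ := (volume : Measure Torus2)) (B := ∅)
      (integrable_of_measurable_of_abs_le (hms ((hf.measurable.comp hsm).mul
        (hg.measurable.comp (hsm.comp (measurable_id.add_const _)))))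
        fun x => abs_onStrip_le t (fun _ => hprod (hf1 _) (hg1 _)) _)
      (integrable_of_measurable_of_abs_le (hms ((hf.measurable.comp
        (measurable_fst.prodMk (hhm.comp hqm))).mul (hg.measurable.comp
        (measurable_fst.prodMk (hhm.comp (hqm.add_const _))))))
        fun x => abs_onStrip_le t (fun _ => hprod (hf1 _) (hg1 _)) _)
      (by positivity) (fun x _ => hpt x) hpt
    simpa using this
  have := (abs_sub_le _ _ _).trans (add_le_add h7 h6)
  linarith

lemma exists_pos_forall_le {ι : Type*} (S : Finset ι) (g : ι → ℝ) (hg : ∀ i, 0 < g i) :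
    ∃ δ > 0, ∀ i ∈ S, δ ≤ g i := by
  classical
  obtain ⟨M, hM⟩ := Finset.exists_le (S.image fun i => (g i)⁻¹)
  have hM1 : 0 < max M 1 := lt_of_lt_of_le one_pos (le_max_right _ _)
  exact ⟨(max M 1)⁻¹, inv_pos.mpr hM1, fun i hi => inv_le_of_inv_le₀ (hg i)
    ((hM _ (Finset.mem_image_of_mem _ hi)).trans (le_max_left _ _))⟩

/-- The step that mixes each of the strips. The first coordinate `s` and the point of the covering
torus are asymptotically independent; for fixed `s` the mixing word makes the heights of a point and
of its translate independent in the strip, and since the segments `{s} × strip` are equidistributed,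
this suffices. -/
lemma exists_mixing_step {α : ℝ} (hα : Irrational α) {f : ℕ → Torus2 → ℝ}
    (hf : ∀ i, Continuous (f i)) (hf1 : ∀ i x, |f i x| ≤ 1) (n : ℕ) (H : List Shear) {δ : ℝ}
    (hH : Equalized r f n H δ) {ε : ℝ} (hε : 0 < ε) : ∃ φ : List Shear,
    volume {x | cell r (heightAfter φ x) ≠ cell r x.2} ≤ ENNReal.ofReal ε ∧
    track φ ((1 / 4 : ℝ) : UnitAddCircle) = 0 ∧ (∀ i,
      (∀ U : ℝ, |(∫ w in (0 : ℝ)..1, fiberMean (fun x => f i (evalWord H x))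
        (track φ (((1 / 4 : ℝ) : UnitAddCircle) + ((U * w : ℝ) : UnitAddCircle)))) - ∫ x, f i x| ≤
          deviation H (f i) + ε) ∧
      |(∫ u, fiberMean (fun x => f i (evalWord H x)) (track φ u)) - ∫ x, f i x| ≤
        deviation H (f i) + ε) ∧
    ∀ᶠ q : ℕ in atTop, ∃ m ≥ n, ∀ i ≤ n, ∀ j ≤ n, ∀ t : ZMod r,
      |(∫ x in stripImage (H ++ scaleWord q φ) t,
          f i x * f j ((conjPerm α (H ++ scaleWord q φ))^[m] x)) -
        r * ((∫ x in stripImage H t, f i x) * ∫ x in stripImage H t, f j x)| ≤ ε + 2 * r * δ := by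
  have hF : ∀ i, Continuous fun x => f i (evalWord H x) := fun i =>
      continuous_comp_evalWord (hf i) H
  obtain ⟨δ', hδ', hmod⟩ := exists_forall_le_dist_torus_le hF n (show 0 < ε / 8 by positivity)
  set ε' : ℝ := min (min δ' (ε / 72)) (1 / 8) with hε'def
  have hε' : 0 < ε' := lt_min (lt_min hδ' (by positivity)) (by norm_num)
  have hε'1 : ε' ≤ δ' := (min_le_left _ _).trans (min_le_left _ _)
  have hε'2 : ε' ≤ ε / 72 := (min_le_left _ _).trans (min_le_right _ _)
  have hε'3 : ε' ≤ 1 / 8 := min_le_right _ _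
  obtain ⟨φ, h1, h2, h3⟩ := exists_mixing_word r hε'
  set B : Set UnitAddCircle :=
    Metric.ball 0 ε' ∪ Metric.ball ((1 / 2 : ℝ) : UnitAddCircle) ε' with hB
  have hmB : MeasurableSet B := measurableSet_ball.union measurableSet_ball
  have hball : ∀ c : UnitAddCircle, volume (Metric.ball c ε') ≤ ENNReal.ofReal (2 * ε') := fun c =>
    (measure_mono Metric.ball_subset_closedBall).trans (by
      rw [AddCircle.volume_closedBall]
      exact ENNReal.ofReal_le_ofReal (min_le_right _ _))
  have hvB : volume B ≤ ENNReal.ofReal (4 * ε') := by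
    refine (measure_union_le _ _).trans ((add_le_add (hball _) (hball _)).trans ?_)
    rw [← ENNReal.ofReal_add (by positivity) (by positivity)]
    exact ENNReal.ofReal_le_ofReal (by linarith)
  have htB : ∀ u ∉ B, track φ u = 0 := fun u hu => by
    rw [hB, Set.mem_union, not_or, Metric.mem_ball, Metric.mem_ball, dist_zero_right, not_lt,
        not_lt,
      dist_eq_norm] at hu
    exact h2 u hu.1 hu.2
  have hqB : ∀ v : ℝ, |v| < 1 / 8 → ((1 / 4 : ℝ) : UnitAddCircle) + (v : UnitAddCircle) ∉ B := by
    intro v hv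
    rw [abs_lt] at hv
    rw [hB, Set.mem_union, not_or, Metric.mem_ball, Metric.mem_ball, dist_zero_right, not_lt,
        not_lt,
      dist_eq_norm, ← AddCircle.coe_add, ← AddCircle.coe_sub,
      norm_coe_of_abs_le (by rw [abs_le]; constructor <;> linarith),
      norm_coe_of_abs_le (by rw [abs_le]; constructor <;> linarith)]
    refine ⟨le_abs.mpr (Or.inl (by linarith)), le_abs.mpr (Or.inr (by linarith))⟩
  refine ⟨φ, h1.trans (ENNReal.ofReal_le_ofReal (by linarith)), ?_, fun i => ?_, ?_⟩
  · have := hqB 0 (by norm_num)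
    rw [AddCircle.coe_zero, add_zero] at this
    exact htB _ this
  · have h := average_track_le hmB htB (by positivity) hvB hqB
      (continuous_fiberMean (continuous_comp_evalWord (hf i) H))
      (abs_fiberMean_le fun x => hf1 i _) (∫ x, f i x)
    exact ⟨fun U => (h.1 U).trans (by rw [deviation]; linarith),
      h.2.trans (by rw [deviation]; linarith)⟩
  -- one tolerance for the translation that serves all pairs `i, j ≤ n`
  choose ρ hρ hρq using fun ij : ℕ × ℕ => exists_half_translation (r := r) (hF ij.1) (hF ij.2)
    (fun x => hf1 _ _) (fun x => hf1 _ _) φ (half_pos hε)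
  obtain ⟨κ, hκ, hκρ⟩ := exists_pos_forall_le (Finset.range (n + 1) ×ˢ Finset.range (n + 1)) ρ hρ
  filter_upwards [(Filter.eventually_all_finset (Finset.range (n + 1) ×ˢ Finset.range (n + 1))).mpr
    fun ij _ => hρq ij, eventually_inv_le hκ, eventually_ge_atTop 1] with q h4 h5 h6
  have hq0 : (0 : ℝ) < q := by exact_mod_cast h6
  have hq1 : (1 : ℝ) ≤ q := by exact_mod_cast h6
  -- the mixing time is chosen so that `m α` is close to `1 / (2 q)`
  obtain ⟨K, hK⟩ := exists_rotation_dense hα (show 0 < κ / 2 * (q : ℝ)⁻¹ by positivity)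
  set w : UnitAddCircle := ((1 / 2 * (q : ℝ)⁻¹ : ℝ) : UnitAddCircle) with hw
  obtain ⟨k, -, hk⟩ := hK ((n * α : ℝ) : UnitAddCircle) w
  rw [← AddCircle.coe_add, ← add_mul, ← Nat.cast_add, dist_eq_norm] at hk
  refine ⟨n + k, Nat.le_add_right _ _, fun i hi j hj t => ?_⟩
  set c : UnitAddCircle := (((n + k : ℕ) * α : ℝ) : UnitAddCircle) with hc
  have hinv : (q : ℝ)⁻¹ ≤ 1 := inv_le_one_of_one_le₀ hq1
  have hc1 : ‖c‖ ≤ κ := by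
    have e1 : ‖c‖ ≤ ‖c - w‖ + ‖w‖ := by simpa using norm_add_le (c - w) w
    have e2 : ‖w‖ ≤ 1 / 2 * (q : ℝ)⁻¹ := by
      have := norm_coe_circle_le (1 / 2 * (q : ℝ)⁻¹)
      rwa [abs_of_nonneg (by positivity)] at this
    nlinarith
  have hc2 : ‖q • c - ((1 / 2 : ℝ) : UnitAddCircle)‖ ≤ κ := by
    have e1 : ((1 / 2 : ℝ) : UnitAddCircle) = q • w := by
      rw [hw, ← AddCircle.coe_nsmul, nsmul_eq_mul]
      congr 1; field_simp
    rw [e1, ← smul_sub]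
    refine (norm_nsmul_le).trans ((mul_le_mul_of_nonneg_left hk hq0.le).trans ?_)
    have : (q : ℝ) * (κ / 2 * (q : ℝ)⁻¹) = κ / 2 := by field_simp
    rw [this]; linarith
  have hmem : (i, j) ∈ Finset.range (n + 1) ×ˢ Finset.range (n + 1) := by
    simp [hi, hj]
  have h7 := h4 (i, j) hmem c (hc1.trans (hκρ _ hmem)) (hc2.trans (hκρ _ hmem)) t
  rw [integral_stripImage_mul_iterate]
  simp only [evalWord_append, Equiv.Perm.mul_apply]
  set c₂ : Torus2 := (((1 / 2 : ℝ) : UnitAddCircle), 0) with hc₂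
  set E : ℕ → ℝ := fun i => ∫ x in stripImage H t, f i x with hE
  have hr : (0 : ℝ) ≤ r := r.cast_nonneg
  have hE1 : ∀ i, |E i| ≤ 1 := fun i => by
    have hv : volume (stripImage H t) ≤ 1 := prob_le_one
    have := norm_setIntegral_le_of_norm_le_const (μ := volume) (s := stripImage H t) (f := f i)
      (C := 1) (lt_of_le_of_lt hv ENNReal.one_lt_top) (fun x _ => hf1 i x)
    rw [one_mul] at this
    exact this.trans (ENNReal.toReal_le_of_le_ofReal zero_le_one (by simpa using hv))
  -- for each `s`, the mixing word separates the two factors, and `hH` evaluates both of them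
  have hin : ∀ s, |(∫ x : Torus2, onStrip t (fun _ => f i (evalWord H (s, heightAfter φ x)) *
      f j (evalWord H (s, heightAfter φ (x + c₂)))) x.2) - r * (E i * E j)| ≤
        ε / 2 + 2 * r * δ := by
    intro s
    have hmods : ∀ i ≤ n, ∀ x y : UnitAddCircle, dist x y ≤ ε' →
        |f i (evalWord H (s, x)) - f i (evalWord H (s, y))| ≤ ε / 8 := fun i hi x y hxy => by
      refine hmod i hi _ _ ?_
      rw [Prod.dist_eq, dist_self]
      exact max_le hδ'.le (hxy.trans hε'1)
    have hcs : ∀ i, Continuous fun y : UnitAddCircle => f i (evalWord H (s, y)) := fun i =>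
      (hF i).comp (continuous_const.prodMk continuous_id)
    have e1 := h3 _ _ (hcs i) (hcs j) 1 (fun y => hf1 _ _) (fun y => hf1 _ _) (ε / 8)
      (hmods i hi) (hmods j hj) t
    have e2 := abs_mul_sub_mul_le (a := ∫ y, onStrip t (fun y => f i (evalWord H (s, y))) y)
      (b := ∫ y, onStrip t (fun y => f j (evalWord H (s, y))) y) (by
        have := norm_integral_le_of_norm_le_const (μ := (volume : Measure UnitAddCircle))
          (f := onStrip t fun y => f i (evalWord H (s, y))) (C := 1)
          (Eventually.of_forall fun y => abs_onStrip_le t (fun y => hf1 i _) y)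
        simpa using this) (hE1 j) (hH i hi t s) (hH j hj t s)
    have e3 := mul_le_mul_of_nonneg_left e2 hr
    rw [← abs_of_nonneg hr, ← abs_mul, abs_of_nonneg hr, mul_sub] at e3
    have := (abs_sub_le _ _ _).trans (add_le_add e1 e3)
    linarith
  have hhm := (continuous_heightAfter φ).measurable
  have hK : Measurable (Function.uncurry fun (s : UnitAddCircle) (x : Torus2) =>
      onStrip t (fun _ => f i (evalWord H (s, heightAfter φ x)) *
        f j (evalWord H (s, heightAfter φ (x + c₂)))) x.2) := by
    refine Measurable.ite (measurable_snd.comp measurable_snd (measurableSet_cell r {t})) ?_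
      measurable_const
    exact ((hF i).measurable.comp (measurable_fst.prodMk (hhm.comp measurable_snd))).mul
      ((hF j).measurable.comp (measurable_fst.prodMk (hhm.comp (measurable_snd.add_const c₂))))
  have hb : ∀ s (x : Torus2), ‖onStrip t (fun _ => f i (evalWord H (s, heightAfter φ x)) *
        f j (evalWord H (s, heightAfter φ (x + c₂)))) x.2‖ ≤ 1 := fun s x =>
    abs_onStrip_le t (fun _ => by
      rw [abs_mul]; exact mul_le_one₀ (hf1 _ _) (abs_nonneg _) (hf1 _ _)) _
  have h8 := abs_integral_prob_sub_const_le (μ := (volume : Measure UnitAddCircle))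
    (integrable_of_measurable_of_abs_le
      (hK.stronglyMeasurable.integral_prod_right (ν := (volume : Measure Torus2))).measurable
          (C := 1)
      fun s => by
        have := norm_integral_le_of_norm_le_const (μ := (volume : Measure Torus2))
          (Eventually.of_forall (hb s))
        simpa using this) hin
  have := (abs_sub_le _ _ _).trans (add_le_add h7 h8)
  linarith

end Mix

/-! ### The inductive step -/

section Horizontal

/-! A horizontal shear commutes with the translation, so that it does not change the conjugate. -/

lemma conjPerm_append_horizontal (α : ℝ) (H : List Shear) (b : PerFun) :
    conjPerm α (H ++ [.W b]) = conjPerm α H := by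
  ext1 x
  obtain ⟨y, rfl⟩ := (evalWord (H ++ [.W b])).surjective x
  rw [conjPerm_evalWord, evalWord_append, Equiv.Perm.mul_apply, Equiv.Perm.mul_apply,
    conjPerm_evalWord]
  congr 1
  simp [add_right_comm]

lemma conjLift_append_horizontal (α : ℝ) (H : List Shear) (b : PerFun) :
    conjLift (H ++ [.W b]) α = conjLift H α := by
  funext x
  simp only [conjLift, invWord_append, liftWord_append, Function.comp_apply, invWord, liftWord,
    List.nil_append, Shear.inv, Shear.lift]
  congr 1
  refine Prod.ext ?_ (by simp)
  simp only [PerFun.neg_f, id_eq, Prod.fst_add, Prod.snd_add, add_zero]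
  ring

lemma evalWord_append_horizontal_zero (H : List Shear) {b : PerFun} (hb : b.circ 0 = 0)
    (z : UnitAddCircle) : evalWord (H ++ [.W b]) (z, 0) = evalWord H (z, 0) := by
  simp [hb]

lemma deviation_append_horizontal (H : List Shear) {b : PerFun} (hb : b.circ 0 = 0)
    (f : Torus2 → ℝ) : deviation (H ++ [.W b]) f = deviation H f := by
  simp only [deviation, fiberMean, evalWord_append_horizontal_zero H hb]

end Horizontal

section Shadowing

/-- Finite orbit segments depend continuously on the point and on the map. -/
lemma exists_shadowing {X : Type*} [MetricSpace X] [CompactSpace X] {T : X → X} (hT : Continuous T)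
    (K : ℕ) {δ : ℝ} (hδ : 0 < δ) : ∃ ε > 0, ∀ S : X → X, (∀ x, dist (S x) (T x) ≤ ε) →
      ∀ x y, dist x y ≤ ε → ∀ k ≤ K, dist (S^[k] x) (T^[k] y) ≤ δ := by
  induction K generalizing δ with
  | zero =>
    refine ⟨δ, hδ, fun S _ x y hxy k hk => ?_⟩
    obtain rfl : k = 0 := by omega
    exact hxy
  | succ K ih =>
    obtain ⟨κ, hκ, h⟩ := Metric.uniformContinuous_iff.mp
      (CompactSpace.uniformContinuous_of_continuous hT) (δ / 2) (half_pos hδ)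
    obtain ⟨ε, hε, h1⟩ := ih (show 0 < min (κ / 2) δ from lt_min (half_pos hκ) hδ)
    refine ⟨min ε (δ / 2), lt_min hε (half_pos hδ), fun S hS x y hxy k hk => ?_⟩
    have h2 := h1 S (fun x => (hS x).trans (min_le_left _ _)) x y (hxy.trans (min_le_left _ _))
    rcases Nat.lt_or_ge K k with hk' | hk'
    · obtain rfl : k = K + 1 := by omega
      rw [Function.iterate_succ_apply', Function.iterate_succ_apply']
      have h3 := h (lt_of_le_of_lt ((h2 K le_rfl).trans (min_le_left _ _)) (by linarith))
      have h4 := (hS (S^[K] x)).trans (min_le_right _ _)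
      linarith [dist_triangle (S (S^[K] x)) (T (S^[K] x)) (T (T^[K] y))]
    · exact (h2 k hk').trans (min_le_right _ _)

lemma abs_birkhoffAverage_sub_le {X : Type*} {S T : X → X} {g : X → ℝ} {x y : X} {ε : ℝ}
    (hε : 0 ≤ ε) {N : ℕ} (h : ∀ k < N, |g (S^[k] x) - g (T^[k] y)| ≤ ε) :
    |birkhoffAverage ℝ S g N x - birkhoffAverage ℝ T g N y| ≤ ε := by
  rcases Nat.eq_zero_or_pos N with rfl | hN
  · simpa [birkhoffAverage] using hε
  · rw [birkhoffAverage, birkhoffAverage, ← smul_sub, birkhoffSum, birkhoffSum,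
      ← Finset.sum_sub_distrib, smul_eq_mul, Finset.mul_sum]
    exact abs_inv_mul_sum_le hN h

lemma abs_setIntegral_le_of_abs_le {f : Torus2 → ℝ} {C : ℝ} (hC : ∀ x, |f x| ≤ C)
    (A : Set Torus2) : |∫ x in A, f x| ≤ C * volume.real A := by
  rw [← Real.norm_eq_abs]
  exact norm_setIntegral_le_of_norm_le_const (measure_lt_top _ _) fun x _ => hC x

lemma abs_setIntegral_mul_sub_le {f g h : Torus2 → ℝ} (hf : Continuous f) (hf1 : ∀ x, |f x| ≤ 1)
    (hg : Continuous g) (hh : Continuous h) (hg1 : ∀ x, |g x| ≤ 1) (hh1 : ∀ x, |h x| ≤ 1) {ε : ℝ}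
    (hgh : ∀ x, |g x - h x| ≤ ε) (A : Set Torus2) :
    |(∫ x in A, f x * g x) - ∫ x in A, f x * h x| ≤ ε := by
  have hi : ∀ {g : Torus2 → ℝ}, Continuous g → (∀ x, |g x| ≤ 1) →
      Integrable (fun x => f x * g x) (volume.restrict A) := fun hg hg1 =>
    integrable_of_measurable_of_abs_le (hf.mul hg).measurable (C := 1) fun x => by
      rw [abs_mul]; exact mul_le_one₀ (hf1 _) (abs_nonneg _) (hg1 _)
  have hε : 0 ≤ ε := (abs_nonneg _).trans (hgh 0)
  rw [← integral_sub (hi hg hg1) (hi hh hh1)]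
  refine (abs_setIntegral_le_of_abs_le (C := ε) (fun x => ?_) A).trans ?_
  · rw [← mul_sub, abs_mul]
    have := mul_le_mul (hf1 x) (hgh x) (abs_nonneg _) zero_le_one
    linarith
  · exact mul_le_of_le_one_right hε measureReal_le_one

end Shadowing

section Step

/-- The data of a stage of the construction: the conjugating word, the first coordinate of the
preimage of the base point, and the size of later perturbations. -/
structure Stage where
  /-- The conjugating word. -/
  word : List Shear
  /-- The base point is the image of `(base, 0)` under the word. -/
  base : UnitAddCircle
  /-- A bound for later perturbations. -/
  tol : ℝ

/-- The base point of a stage. -/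
noncomputable def Stage.point (s : Stage) : Torus2 := evalWord s.word (s.base, 0)

/-- The relation between consecutive stages `n` and `n + 1`. The statements about maps `S` hold for
all maps close to the map of stage `n + 1`, hence for the limit; `len n H` is the length from which
on Birkhoff averages are controlled when the word of stage `n` is `H`. -/
structure IsStep (α : ℝ) (r : ℕ) (f : ℕ → Torus2 → ℝ) (len : ℕ → List Shear → ℕ) (n : ℕ)
    (s s' : Stage) : Prop where
  tol_le : s'.tol ≤ s.tol / 2
  close : ∀ j ≤ n, ∀ x, ‖iteratedFDeriv ℝ j
    (fun y => conjLift s'.word α y - conjLift s.word α y) x‖ ≤ s.tol / 2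
  close_neg : ∀ j ≤ n, ∀ x, ‖iteratedFDeriv ℝ j
    (fun y => conjLift s'.word (-α) y - conjLift s.word (-α) y) x‖ ≤ s.tol / 2
  strip : ∀ t : ZMod r, volume (symmDiff (stripImage s'.word t) (stripImage s.word t)) ≤
    ENNReal.ofReal s.tol
  point : dist s'.point s.point ≤ s.tol / 2
  deviation_le : ∀ i ≤ n, deviation s'.word (f i) ≤ deviation s.word (f i) + 2 * s.tol
  average : ∀ S : Torus2 → Torus2, (∀ x, dist (S x) (conjPerm α s'.word x) ≤ s'.tol) →
    ∀ y, dist y s'.point ≤ s'.tol → ∀ i ≤ n, ∀ N, len n s.word ≤ N → N ≤ len (n + 1) s'.word →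
      |birkhoffAverage ℝ S (f i) N y - ∫ x, f i x| ≤
        deviation s.word (f i) + 2 * s.tol + ((n : ℝ) + 1)⁻¹
  halving : n % 3 = 0 → ∀ i ≤ n, deviation s'.word (f i) ≤ deviation s.word (f i) / 2 + 2 * s.tol
  dense : n % 3 = 1 → ∃ K : ℕ, ∀ S : Torus2 → Torus2,
    (∀ x, dist (S x) (conjPerm α s'.word x) ≤ s'.tol) →
      ∀ x w, ∃ k ≤ K, dist (S^[k] x) w ≤ 2 * s.tol
  mixing : n % 3 = 2 → ∃ m ≥ n, ∀ S : Torus2 → Torus2, Continuous S →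
    (∀ x, dist (S x) (conjPerm α s'.word x) ≤ s'.tol) → ∀ i ≤ n, ∀ j ≤ n, ∀ t : ZMod r,
      |(∫ x in stripImage s'.word t, f i x * f j (S^[m] x)) -
        r * ((∫ x in stripImage s.word t, f i x) * ∫ x in stripImage s.word t, f j x)| ≤
        2 * s.tol + 2 * r * ((n : ℝ) + 1)⁻¹

/-- What is assumed of a stage in order to make the next one. -/
structure Stage.IsGood (r : ℕ) (f : ℕ → Torus2 → ℝ) (n : ℕ) (s : Stage) : Prop where
  tol_pos : 0 < s.tol
  equalized : Equalized r f n s.word ((n : ℝ) + 1)⁻¹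

variable {α : ℝ} {f : ℕ → Torus2 → ℝ}

/-- Lengths from which on Birkhoff averages are controlled, chosen before the next word `φ`. -/
lemma exists_len (hα : Irrational α) {q : ℕ → ℕ} {p : ℕ → ℤ} (hqp : FastApprox α q p)
    (hf : ∀ i, Continuous (f i)) : ∃ len : ℕ → List Shear → ℕ, (∀ n H, n ≤ len n H) ∧
      ∀ n H, ∀ i ≤ n, ∀ φ : List Shear, ∀ e : ℝ,
      (∀ U : ℝ, |(∫ w in (0 : ℝ)..1, fiberMean (fun x => f i (evalWord H x))
        (track φ (((1 / 4 : ℝ) : UnitAddCircle) + ((U * w : ℝ) : UnitAddCircle)))) -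
          ∫ x, f i x| ≤ e) →
      ∀ᶠ l in atTop, ∀ z : UnitAddCircle, q l • z = ((1 / 4 : ℝ) : UnitAddCircle) →
        ∀ N, len n H ≤ N →
        |birkhoffAverage ℝ (conjPerm α (H ++ scaleWord (q l) φ)) (f i) N
          (evalWord (H ++ scaleWord (q l) φ) (z, 0)) - ∫ x, f i x| ≤ e + ((n : ℝ) + 1)⁻¹ := by
  have h := fun (n : ℕ) (H : List Shear) (i : ℕ) => exists_average_length hα hqp (hf i) H
    (show 0 < ((n : ℝ) + 1)⁻¹ by positivity)
  choose N₀ hN₀ using h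
  refine ⟨fun n H => max n ((Finset.range (n + 1)).sup (N₀ n H)), fun n H => le_max_left _ _,
    fun n H i hi φ e he => ?_⟩
  filter_upwards [hN₀ n H i φ e he] with l hl z hz N hN
  refine hl z hz N (le_trans ?_ hN)
  exact (Finset.le_sup (f := N₀ n H) (Finset.mem_range.mpr (by omega))).trans (le_max_right _ _)

/-- The words that drive the steps: sweeping, covering and mixing words in turn. -/
lemma exists_driving_word (hα : Irrational α) (r : ℕ) [NeZero r] (hf : ∀ i, Continuous (f i))
    (hf1 : ∀ i x, |f i x| ≤ 1) (n : ℕ) (H : List Shear)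
    (hH : Equalized r f n H ((n : ℝ) + 1)⁻¹) {ε : ℝ} (hε : 0 < ε) : ∃ φ : List Shear,
    volume {x | cell r (heightAfter φ x) ≠ cell r x.2} ≤ ENNReal.ofReal ε ∧
    track φ ((1 / 4 : ℝ) : UnitAddCircle) = 0 ∧
    (∀ i ≤ n, ∀ U : ℝ, |(∫ w in (0 : ℝ)..1, fiberMean (fun x => f i (evalWord H x))
        (track φ (((1 / 4 : ℝ) : UnitAddCircle) + ((U * w : ℝ) : UnitAddCircle)))) - ∫ x, f i x| ≤
          deviation H (f i) + ε) ∧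
    (∀ i ≤ n, |(∫ u, fiberMean (fun x => f i (evalWord H x)) (track φ u)) - ∫ x, f i x| ≤
        deviation H (f i) + ε) ∧
    (n % 3 = 0 → ∀ i ≤ n, |(∫ u, fiberMean (fun x => f i (evalWord H x)) (track φ u)) -
      ∫ x, f i x| ≤ deviation H (f i) / 2 + ε) ∧
    ∀ᶠ q : ℕ in atTop, (n % 3 = 1 → ∃ K : ℕ, ∀ x w, ∃ k ≤ K,
        dist ((conjPerm α (H ++ scaleWord q φ))^[k] x) w ≤ ε) ∧
      (n % 3 = 2 → ∃ m ≥ n, ∀ i ≤ n, ∀ j ≤ n, ∀ t : ZMod r,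
        |(∫ x in stripImage (H ++ scaleWord q φ) t,
            f i x * f j ((conjPerm α (H ++ scaleWord q φ))^[m] x)) -
          r * ((∫ x in stripImage H t, f i x) * ∫ x in stripImage H t, f j x)| ≤
          ε + 2 * r * ((n : ℝ) + 1)⁻¹) := by
  have hcases : n % 3 = 0 ∨ n % 3 = 1 ∨ n % 3 = 2 := by omega
  rcases hcases with h | h | h <;> simp only [h]
  · obtain ⟨φ, h1, h2, h3⟩ := exists_sweeping_word r f hf hf1 n H hε
    exact ⟨φ, h1, h2, fun i hi => (h3 i hi).1,
      fun i hi => (h3 i hi).2.trans (by linarith [deviation_nonneg H (f i)]),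
      fun _ i hi => (h3 i hi).2, by simp⟩
  · obtain ⟨φ, h1, h2, h3, h4⟩ := exists_covering_word hα r f hf hf1 H hε
    refine ⟨φ, h1, h2, fun i _ => (h3 i).1, fun i _ => (h3 i).2, by simp, ?_⟩
    filter_upwards [h4] with q hq
    exact ⟨fun _ => hq, by simp⟩
  · obtain ⟨φ, h1, h2, h3, h4⟩ := exists_mixing_step hα hf hf1 n H hH hε
    refine ⟨φ, h1, h2, fun i _ => (h3 i).1, fun i _ => (h3 i).2, by simp, ?_⟩
    filter_upwards [h4] with q hq
    exact ⟨by simp, fun _ => hq⟩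

set_option maxHeartbeats 600000 in
/-- Every good stage has a successor. The driving word `φ` is lifted to a `q`-fold covering with `q`
a large denominator of a rational approximation of `α`, and a horizontal shear is added, which does
not change the conjugate of the translation but prepares the next mixing step. -/
lemma exists_step (hα : Irrational α) {q : ℕ → ℕ} {p : ℕ → ℤ} (hqp : FastApprox α q p) (r : ℕ)
    [NeZero r] (hf : ∀ i, Continuous (f i)) (hf1 : ∀ i x, |f i x| ≤ 1)
    {len : ℕ → List Shear → ℕ}
    (hlen : ∀ n H, ∀ i ≤ n, ∀ φ : List Shear, ∀ e : ℝ,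
      (∀ U : ℝ, |(∫ w in (0 : ℝ)..1, fiberMean (fun x => f i (evalWord H x))
        (track φ (((1 / 4 : ℝ) : UnitAddCircle) + ((U * w : ℝ) : UnitAddCircle)))) -
          ∫ x, f i x| ≤ e) →
      ∀ᶠ l in atTop, ∀ z : UnitAddCircle, q l • z = ((1 / 4 : ℝ) : UnitAddCircle) →
        ∀ N, len n H ≤ N →
        |birkhoffAverage ℝ (conjPerm α (H ++ scaleWord (q l) φ)) (f i) N
          (evalWord (H ++ scaleWord (q l) φ) (z, 0)) - ∫ x, f i x| ≤ e + ((n : ℝ) + 1)⁻¹)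
    (n : ℕ) (s : Stage) (hs : s.IsGood r f n) :
    ∃ s' : Stage, s'.IsGood r f (n + 1) ∧ IsStep α r f len n s s' := by
  obtain ⟨H, z, ε⟩ := s
  obtain ⟨hε, hH⟩ := hs
  simp only at hε hH
  obtain ⟨φ, h1, h2, h3, h4, h5, h6⟩ := exists_driving_word hα r hf hf1 n H hH hε
  have e1 := fun i (hi : i ∈ Finset.range (n + 1)) =>
    hlen n H i (by simpa [Nat.lt_succ_iff] using hi) φ _
        (h3 i (by simpa [Nat.lt_succ_iff] using hi))
  have e2 := fun i (_ : i ∈ Finset.range (n + 1)) =>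
    hqp.q_tendsto.eventually (eventually_deviation_le (hf i) H φ hε)
  obtain ⟨l, g1, g2, g3, g4, g5, g6⟩ := (((Filter.eventually_all_finset _).mpr e1).and
    (((Filter.eventually_all_finset _).mpr e2).and
    ((hqp.eventually_conjLift_close H φ n (half_pos hε)).and
    ((hqp.neg.eventually_conjLift_close H φ n (half_pos hε)).and
    ((hqp.q_tendsto.eventually (eventually_dist_basePoint_le H φ h2 z (half_pos hε))).and
    (hqp.q_tendsto.eventually h6)))))).exists
  obtain ⟨z', hz', hd⟩ := g5
  obtain ⟨g6, g7⟩ := g6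
  obtain ⟨b, hb, hE⟩ := exists_equalized (r := r) hf hf1 (n + 1) (H ++ scaleWord (q l) φ)
    (show 0 < (((n + 1 : ℕ) : ℝ) + 1)⁻¹ by positivity)
  set H' := H ++ scaleWord (q l) φ with hH'
  -- bounds on the lengths of the orbit segments that have to be shadowed
  obtain ⟨K, hK⟩ : ∃ K : ℕ, n % 3 = 1 → ∀ x w, ∃ k ≤ K, dist ((conjPerm α H')^[k] x) w ≤ ε := by
    by_cases h : n % 3 = 1
    · obtain ⟨K, hK⟩ := g6 h; exact ⟨K, fun _ => hK⟩
    · exact ⟨0, fun h' => absurd h' h⟩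
  obtain ⟨m, hmn, hm⟩ : ∃ m ≥ n, n % 3 = 2 → ∀ i ≤ n, ∀ j ≤ n, ∀ t : ZMod r,
      |(∫ x in stripImage H' t, f i x * f j ((conjPerm α H')^[m] x)) -
        r * ((∫ x in stripImage H t, f i x) * ∫ x in stripImage H t, f j x)| ≤
        ε + 2 * r * ((n : ℝ) + 1)⁻¹ := by
    by_cases h : n % 3 = 2
    · obtain ⟨m, hmn, hm⟩ := g7 h; exact ⟨m, hmn, fun _ => hm⟩
    · exact ⟨n, le_rfl, fun h' => absurd h' h⟩
  obtain ⟨δ, hδ, hfδ⟩ := exists_forall_le_dist_torus_le hf n hε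
  obtain ⟨κ, hκ, hsh⟩ := exists_shadowing (continuous_conjPerm α H')
    (max (len (n + 1) (H' ++ [.W b])) (max K m)) (show 0 < min δ ε from lt_min hδ hε)
  have hmem : ∀ i ≤ n, i ∈ Finset.range (n + 1) := fun i hi => Finset.mem_range.mpr (by omega)
  refine ⟨⟨H' ++ [.W b], z', min κ (ε / 2)⟩, ⟨lt_min hκ (half_pos hε), hE⟩, ?_⟩
  refine
    { tol_le := min_le_right _ _
      close := ?_
      close_neg := ?_
      strip := ?_
      point := ?_
      deviation_le := ?_
      average := ?_
      halving := ?_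
      dense := ?_
      mixing := ?_ }
  · simpa only [conjLift_append_horizontal] using g3
  · simpa only [conjLift_append_horizontal] using g4
  · intro t
    simp only [stripImage_append_horizontal]
    exact (volume_symmDiff_stripImage_le H φ (hqp.q_pos l) t).trans h1
  · simpa only [Stage.point, evalWord_append_horizontal_zero H' hb] using hd
  · intro i hi
    simp only [deviation_append_horizontal H' hb]
    linarith [g2 i (hmem i hi), h4 i hi]
  · intro S hS y hy i hi N hN1 hN2
    simp only [Stage.point, evalWord_append_horizontal_zero H' hb, conjPerm_append_horizontal]
      at hS hy ⊢
    have a1 := g1 i (hmem i hi) z' hz' N hN1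
    have a2 := abs_birkhoffAverage_sub_le (S := S) (T := conjPerm α H') (g := f i) (x := y)
      (y := evalWord H' (z', 0)) hε.le (N := N) fun k hk => hfδ i hi _ _
        ((hsh S (fun x => (hS x).trans (min_le_left _ _)) _ _ (hy.trans (min_le_left _ _)) k
          (hk.le.trans (hN2.trans (le_max_left _ _)))).trans (min_le_left _ _))
    have := (abs_sub_le _ _ _).trans (add_le_add a2 a1)
    linarith
  · intro h i hi
    simp only [deviation_append_horizontal H' hb]
    linarith [g2 i (hmem i hi), h5 h i hi]
  · intro h
    refine ⟨K, fun S hS x w => ?_⟩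
    simp only [conjPerm_append_horizontal] at hS
    obtain ⟨k, hk, hkw⟩ := hK h x w
    refine ⟨k, hk, ?_⟩
    have := (hsh S (fun x => (hS x).trans (min_le_left _ _)) x x (by simpa using hκ.le) k
      (hk.trans ((le_max_left _ _).trans (le_max_right _ _)))).trans (min_le_right _ _)
    simp only
    linarith [dist_triangle (S^[k] x) ((conjPerm α H')^[k] x) w]
  · intro h
    refine ⟨m, hmn, fun S hSc hS i hi j hj t => ?_⟩
    simp only [conjPerm_append_horizontal, stripImage_append_horizontal] at hS ⊢
    have a1 := hm h i hi j hj t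
    have a2 : |(∫ x in stripImage H' t, f i x * f j (S^[m] x)) -
        ∫ x in stripImage H' t, f i x * f j ((conjPerm α H')^[m] x)| ≤ ε :=
      abs_setIntegral_mul_sub_le (hf i) (hf1 i) ((hf j).comp (hSc.iterate m))
        ((hf j).comp ((continuous_conjPerm α H').iterate m)) (fun x => hf1 j _) (fun x => hf1 j _)
        (fun x => hfδ j hj _ _ ((hsh S (fun x => (hS x).trans (min_le_left _ _)) x x
          (by simpa using hκ.le) m ((le_max_right _ _).trans (le_max_right _ _))).trans
            (min_le_left _ _))) _
    have := (abs_sub_le _ _ _).trans (add_le_add a2 a1)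
    linarith

end Step

/-! ### Limits of diffeomorphisms and of sets -/

section Halving

variable {ε : ℕ → ℝ}

lemma le_div_two_pow (hε : ∀ n, ε (n + 1) ≤ ε n / 2) (n m : ℕ) : ε (n + m) ≤ ε n / 2 ^ m := by
  induction m with
  | zero => simp
  | succ m ih =>
    rw [← add_assoc, pow_succ, ← div_div]
    exact (hε _).trans (div_le_div_of_nonneg_right ih zero_le_two)

lemma tendsto_zero_of_halving (hε0 : ∀ n, 0 ≤ ε n) (hε : ∀ n, ε (n + 1) ≤ ε n / 2) :
    Tendsto ε atTop (𝓝 0) := by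
  have h : Tendsto (fun n : ℕ => ε 0 * (1 / 2 : ℝ) ^ n) atTop (𝓝 0) := by
    simpa using (tendsto_pow_atTop_nhds_zero_of_lt_one (r := (1 / 2 : ℝ)) (by norm_num)
      (by norm_num)).const_mul (ε 0)
  refine squeeze_zero hε0 (fun n => ?_) h
  have := le_div_two_pow hε 0 n
  rw [zero_add] at this
  refine this.trans (le_of_eq ?_)
  rw [one_div, inv_pow, div_eq_mul_inv]

lemma exists_limit_point {X : Type*} [MetricSpace X] [CompleteSpace X] {x : ℕ → X}
    (hε : ∀ n, ε (n + 1) ≤ ε n / 2) (h : ∀ n, dist (x (n + 1)) (x n) ≤ ε n / 2) :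
    ∃ a, ∀ n, dist a (x n) ≤ ε n := by
  have hb : ∀ n m, dist (x (n + m)) (x (n + m + 1)) ≤ ε n / 2 / 2 ^ m := fun n m => by
    rw [dist_comm, div_right_comm]
    exact (h _).trans (div_le_div_of_nonneg_right (le_div_two_pow hε n m) zero_le_two)
  have hc : CauchySeq x := cauchySeq_of_le_geometric_two (C := ε 0) fun m => by
    simpa using hb 0 m
  obtain ⟨a, ha⟩ := cauchySeq_tendsto_of_complete hc
  refine ⟨a, fun n => ?_⟩
  rw [dist_comm]
  exact dist_le_of_le_geometric_two_of_tendsto₀ (f := fun m => x (n + m)) (fun m => hb n m)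
    (by simpa only [add_comm n] using (tendsto_add_atTop_iff_nat n).mpr ha)

/-- A sequence of smooth maps whose consecutive differences are summably small, the `n`-th one
together with its first `n` derivatives, has a smooth limit. -/
lemma exists_smooth_limit {E F : Type*} [NormedAddCommGroup E] [NormedSpace ℝ E]
    [NormedAddCommGroup F] [NormedSpace ℝ F] [CompleteSpace F] {L : ℕ → E → F}
    (hL : ∀ n, ContDiff ℝ ∞ (L n)) (hε : ∀ n, ε (n + 1) ≤ ε n / 2)
    (h : ∀ n, ∀ j ≤ n, ∀ x, ‖iteratedFDeriv ℝ j (fun y => L (n + 1) y - L n y) x‖ ≤ ε n / 2) :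
    ∃ G : E → F, ContDiff ℝ ∞ G ∧
      ∀ n, ∀ j ≤ n, ∀ x, ‖iteratedFDeriv ℝ j (fun y => G y - L n y) x‖ ≤ ε n := by
  set d : ℕ → E → F := fun n y => L (n + 1) y - L n y with hd
  have hdc : ∀ n, ContDiff ℝ ∞ (d n) := fun n => (hL (n + 1)).sub (hL n)
  have hb : ∀ n m j, j ≤ n → ∀ x, ‖iteratedFDeriv ℝ j (d (n + m)) x‖ ≤ ε n / 2 / 2 ^ m := by
    intro n m j hj x
    rw [div_right_comm]
    exact (h (n + m) j (by omega) x).trans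
      (div_le_div_of_nonneg_right (le_div_two_pow hε n m) zero_le_two)
  have hb0 : ∀ n m x, ‖d (n + m) x‖ ≤ ε n / 2 / 2 ^ m := fun n m x => by
    simpa using hb n m 0 (Nat.zero_le _) x
  have hs : ∀ n x, Summable fun m => d (n + m) x := fun n x =>
    Summable.of_norm_bounded (summable_geometric_two' (ε n)) fun m => hb0 n m x
  set R : ℕ → E → F := fun n x => ∑' m, d (n + m) x with hR
  have hRL : ∀ n x, L 0 x + R 0 x - L n x = R n x := by
    intro n x
    induction n with
    | zero => simp
    | succ n ih =>
      have e : R n x = d n x + R (n + 1) x := by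
        simp only [hR]
        rw [(hs n x).tsum_eq_zero_add]
        congr 2
        funext m
        congr 1
        omega
      rw [e] at ih
      rw [sub_eq_iff_eq_add] at ih ⊢
      rw [ih]
      simp only [hd]
      abel
  have hRc : ∀ n : ℕ, ContDiff ℝ n (R n) := fun n =>
    contDiff_tsum (N := (n : ℕ∞)) (v := fun _ m => ε n / 2 / 2 ^ m)
      (fun m => (hdc _).of_le (by exact_mod_cast le_top)) (fun _ _ => summable_geometric_two' (ε n))
      fun j m x hj => hb n m j (by exact_mod_cast hj) x
  refine ⟨fun x => L 0 x + R 0 x, ?_, fun n j hj x => ?_⟩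
  · rw [contDiff_infty]
    intro n
    have e : (fun x => L 0 x + R 0 x) = fun x => R n x + L n x := by
      funext x; rw [← hRL n x, sub_add_cancel]
    rw [e]
    exact (hRc n).add ((hL n).of_le (by exact_mod_cast le_top))
  · simp only [hRL]
    rw [hR, iteratedFDeriv_tsum_apply (N := (n : ℕ∞)) (v := fun _ m => ε n / 2 / 2 ^ m)
      (fun m => (hdc _).of_le (by exact_mod_cast le_top)) (fun _ _ => summable_geometric_two' (ε n))
      (fun j m x hj => hb n m j (by exact_mod_cast hj) x) (by exact_mod_cast hj)]
    exact tsum_of_norm_bounded (hasSum_geometric_two' (ε n)) fun m => hb n m j hj x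

end Halving

section LimitMap

lemma dist_torusProj_le (a b : ℝ × ℝ) : dist (torusProj a) (torusProj b) ≤ ‖a - b‖ := by
  rw [Prod.dist_eq, Prod.norm_def]
  exact max_le_max (dist_coe_circle_le _ _) (dist_coe_circle_le _ _)

lemma continuous_torusProj : Continuous torusProj :=
  ((AddCircle.continuous_mk' 1).comp continuous_fst).prodMk
    ((AddCircle.continuous_mk' 1).comp continuous_snd)

lemma torusProj_surjective : Function.Surjective torusProj := fun x =>
  ⟨(rep x.1, rep x.2), by simp [torusProj]⟩

lemma isSmoothLift_conjLift (α : ℝ) (H : List Shear) :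
    IsSmoothLift (conjLift H α) (conjPerm α H) := by
  refine ⟨contDiff_conjLift H α, fun p => ?_⟩
  have e : torusProj (liftWord (invWord H) p + (α, 0)) =
      torusProj (liftWord (invWord H) p) + ((α : UnitAddCircle), 0) := by
    simp [torusProj]
  rw [conjLift, proj_liftWord, e, proj_liftWord, evalWord_inv]
  rfl

lemma conjPerm_symm (α : ℝ) (H : List Shear) : (conjPerm α H).symm = conjPerm (-α) H := by
  have h : conjPerm (-α) H * conjPerm α H = 1 := by
    ext1 x
    obtain ⟨y, rfl⟩ := (evalWord H).surjective x
    rw [Equiv.Perm.mul_apply, conjPerm_evalWord, conjPerm_evalWord, add_assoc]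
    simp [← Prod.zero_eq_mk]
  exact (eq_inv_of_mul_eq_one_left h).symm

/-- A limit of lifts of torus maps is a lift of a torus map. -/
lemma exists_limit_map {L : ℕ → ℝ × ℝ → ℝ × ℝ} {T : ℕ → Torus2 → Torus2}
    (hL : ∀ n, IsSmoothLift (L n) (T n)) {ε : ℕ → ℝ} (hε0 : ∀ n, 0 ≤ ε n)
    (hε : ∀ n, ε (n + 1) ≤ ε n / 2)
    (h : ∀ n, ∀ j ≤ n, ∀ x, ‖iteratedFDeriv ℝ j (fun y => L (n + 1) y - L n y) x‖ ≤ ε n / 2) :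
    ∃ (G : ℝ × ℝ → ℝ × ℝ) (S : Torus2 → Torus2), IsSmoothLift G S ∧
      (∀ n, ∀ j ≤ n, ∀ x, ‖iteratedFDeriv ℝ j (fun y => G y - L n y) x‖ ≤ ε n) ∧
      ∀ n x, dist (S x) (T n x) ≤ ε n := by
  obtain ⟨G, hG, hGL⟩ := exists_smooth_limit (fun n => (hL n).1) hε h
  have hd : ∀ n p, dist (torusProj (G p)) (T n (torusProj p)) ≤ ε n := fun n p => by
    rw [← (hL n).2]
    refine (dist_torusProj_le _ _).trans ?_
    simpa using hGL n 0 (Nat.zero_le _) p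
  have hlim : ∀ p, Tendsto (fun n => T n (torusProj p)) atTop (𝓝 (torusProj (G p))) := fun p => by
    rw [tendsto_iff_dist_tendsto_zero]
    refine squeeze_zero (fun _ => dist_nonneg) (fun n => ?_) (tendsto_zero_of_halving hε0 hε)
    rw [dist_comm]; exact hd n p
  set σ := Function.surjInv torusProj_surjective with hσ
  have hσp : ∀ x, torusProj (σ x) = x := Function.surjInv_eq torusProj_surjective
  refine ⟨G, fun x => torusProj (G (σ x)), ⟨hG, fun p => ?_⟩, hGL, fun n x => ?_⟩
  · have := hlim (σ (torusProj p))
    rw [hσp] at this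
    exact tendsto_nhds_unique (hlim p) this
  · have := hd n (σ x)
    rwa [hσp] at this

lemma IsSmoothLift.continuous {G : ℝ × ℝ → ℝ × ℝ} {S : Torus2 → Torus2} (h : IsSmoothLift G S) :
    Continuous S := by
  have hq : IsOpenMap torusProj := by
    have h1 : IsOpenMap ((↑) : ℝ → UnitAddCircle) := QuotientAddGroup.isOpenMap_coe
    exact h1.prodMap h1
  rw [(IsOpenQuotientMap.mk torusProj_surjective continuous_torusProj
    hq).isQuotientMap.continuous_iff]
  have e : S ∘ torusProj = torusProj ∘ G := funext fun p => (h.2 p).symm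
  rw [e]
  exact continuous_torusProj.comp h.1.continuous

lemma abs_setIntegral_sub_setIntegral_le {g : Torus2 → ℝ} (hg : Measurable g) {C : ℝ}
    (hC : ∀ x, |g x| ≤ C) {A B : Set Torus2} (hA : MeasurableSet A) (hB : MeasurableSet B) :
    |(∫ x in A, g x) - ∫ x in B, g x| ≤ C * volume.real (symmDiff A B) := by
  have hC0 : 0 ≤ C := (abs_nonneg _).trans (hC 0)
  rw [← integral_indicator hA, ← integral_indicator hB]
  have hi := integrable_of_measurable_of_abs_le (μ := (volume : Measure Torus2)) hg hC
  have := abs_integral_sub_integral_le (B := symmDiff A B) (hi.indicator hA)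
      (hi.indicator hB) le_rfl
    (fun x hx => by
      rw [Set.mem_symmDiff] at hx
      by_cases h1 : x ∈ A <;> by_cases h2 : x ∈ B <;> simp_all) (C := C) fun x => by
      by_cases h1 : x ∈ A <;> by_cases h2 : x ∈ B <;> simp [h1, h2, hC x, hC0]
  simpa using this

/-- Invariance of the restriction of Lebesgue measure to a set passes to limits. -/
lemma measurePreserving_restrict_of_tendsto {T : Torus2 → Torus2} (hT : Continuous T)
    {S : ℕ → Torus2 → Torus2} (hS : ∀ n, Continuous (S n)) {ε : ℕ → ℝ}
    (hε : Tendsto ε atTop (𝓝 0)) (hST : ∀ n x, dist (T x) (S n x) ≤ ε n) {A : Set Torus2}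
    (hA : MeasurableSet A) {B : ℕ → Set Torus2} (hB : ∀ n, MeasurableSet (B n))
    (hAB : Tendsto (fun n => volume.real (symmDiff A (B n))) atTop (𝓝 0))
    (hinv : ∀ n, MeasurePreserving (S n) (volume.restrict (B n)) (volume.restrict (B n))) :
    MeasurePreserving T (volume.restrict A) (volume.restrict A) := by
  refine ⟨hT.measurable, ?_⟩
  refine ext_of_forall_integral_eq_of_IsFiniteMeasure fun g => ?_
  have hgc : Continuous g := g.continuous
  obtain ⟨C, hC0, hC⟩ := exists_abs_le_torus hgc
  rw [integral_map hT.measurable.aemeasurable hgc.aestronglyMeasurable]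
  have e : ∀ n, ∫ x in B n, g (S n x) = ∫ x in B n, g x := fun n => by
    conv_rhs => rw [← (hinv n).map_eq]
    rw [integral_map (hS n).measurable.aemeasurable hgc.aestronglyMeasurable]
  have l1 : Tendsto (fun n => ∫ x in B n, g x) atTop (𝓝 (∫ x in A, g x)) := by
    rw [tendsto_iff_dist_tendsto_zero]
    refine squeeze_zero (fun _ => dist_nonneg) (fun n => ?_) (by simpa using hAB.const_mul C)
    rw [dist_comm]
    exact abs_setIntegral_sub_setIntegral_le hgc.measurable hC hA (hB n)
  have l2 : Tendsto (fun n => ∫ x in B n, g (T x)) atTop (𝓝 (∫ x in A, g (T x))) := by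
    rw [tendsto_iff_dist_tendsto_zero]
    refine squeeze_zero (fun _ => dist_nonneg) (fun n => ?_) (by simpa using hAB.const_mul C)
    rw [dist_comm]
    exact abs_setIntegral_sub_setIntegral_le (hgc.comp hT).measurable (fun x => hC _) hA (hB n)
  have l3 : Tendsto (fun n => (∫ x in B n, g (S n x)) - ∫ x in B n, g (T x)) atTop (𝓝 0) := by
    rw [Metric.tendsto_nhds]
    intro η hη
    obtain ⟨δ, hδ, hgδ⟩ := exists_dist_torus_le hgc (half_pos hη)
    filter_upwards [hε.eventually_le_const hδ] with n hn
    have i1 : Integrable (fun x => g (S n x)) (volume.restrict (B n)) :=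
      integrable_of_measurable_of_abs_le (hgc.comp (hS n)).measurable fun x => hC _
    have i2 : Integrable (fun x => g (T x)) (volume.restrict (B n)) :=
      integrable_of_measurable_of_abs_le (hgc.comp hT).measurable fun x => hC _
    rw [dist_zero_right, ← integral_sub i1 i2]
    refine lt_of_le_of_lt (abs_setIntegral_le_of_abs_le (C := η / 2) (fun x => ?_) _) ?_
    · rw [abs_sub_comm]; exact hgδ _ _ ((hST n x).trans hn)
    · have : volume.real (B n) ≤ 1 := measureReal_le_one
      nlinarith
  have l4 := l2.add l3
  simp only [add_sub_cancel, add_zero, e] at l4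
  exact tendsto_nhds_unique l4 l1

/-- The limit of the conjugates belongs to `𝒜_α`. -/
lemma exists_limit_diffeo {α : ℝ} {H : ℕ → List Shear} {ε : ℕ → ℝ} (hε0 : ∀ n, 0 ≤ ε n)
    (hε : ∀ n, ε (n + 1) ≤ ε n / 2)
    (h : ∀ n, ∀ j ≤ n, ∀ x, ‖iteratedFDeriv ℝ j
      (fun y => conjLift (H (n + 1)) α y - conjLift (H n) α y) x‖ ≤ ε n / 2)
    (h' : ∀ n, ∀ j ≤ n, ∀ x, ‖iteratedFDeriv ℝ j
      (fun y => conjLift (H (n + 1)) (-α) y - conjLift (H n) (-α) y) x‖ ≤ ε n / 2) :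
    ∃ T : Equiv.Perm Torus2, T ∈ anosovKatokSpace α ∧ Continuous T ∧
      ∀ n x, dist (T x) (conjPerm α (H n) x) ≤ ε n := by
  obtain ⟨G, S, hGS, hG, hS⟩ := exists_limit_map (fun n => isSmoothLift_conjLift α (H n)) hε0 hε h
  obtain ⟨G', S', hGS', hG', hS'⟩ :=
    exists_limit_map (fun n => isSmoothLift_conjLift (-α) (H n)) hε0 hε h'
  have hzero := tendsto_zero_of_halving hε0 hε
  -- the two limits are inverse to each other
  have hinv : ∀ (R R' : Torus2 → Torus2) (U U' : ℕ → Torus2 → Torus2), Continuous R →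
      (∀ n x, dist (R x) (U n x) ≤ ε n) → (∀ n x, dist (R' x) (U' n x) ≤ ε n) →
      (∀ n x, U n (U' n x) = x) → ∀ x, R (R' x) = x := by
    intro R R' U U' hR h1 h2 h3 x
    have l1 : Tendsto (fun n => U' n x) atTop (𝓝 (R' x)) := by
      rw [tendsto_iff_dist_tendsto_zero]
      refine squeeze_zero (fun _ => dist_nonneg) (fun n => ?_) hzero
      rw [dist_comm]; exact h2 n x
    have l2 := (hR.tendsto (R' x)).comp l1
    have l3 : Tendsto (fun n => R (U' n x)) atTop (𝓝 x) := by
      rw [tendsto_iff_dist_tendsto_zero]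
      refine squeeze_zero (fun _ => dist_nonneg) (fun n => ?_) hzero
      have := h1 n (U' n x)
      rwa [h3] at this
    exact tendsto_nhds_unique l2 l3
  have hc : ∀ n x, conjPerm (-α) (H n) (conjPerm α (H n) x) = x := fun n x => by
    rw [← conjPerm_symm, Equiv.symm_apply_apply]
  have hc' : ∀ n x, conjPerm α (H n) (conjPerm (-α) (H n) x) = x := fun n x => by
    rw [← conjPerm_symm, Equiv.apply_symm_apply]
  let T : Equiv.Perm Torus2 :=
    { toFun := S
      invFun := S'
      left_inv := hinv S' S _ _ hGS'.continuous hS' hS hc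
      right_inv := hinv S S' _ _ hGS.continuous hS hS' hc' }
  have hmp : MeasurePreserving T (volume : Measure Torus2) volume := by
    have := measurePreserving_restrict_of_tendsto hGS.continuous
      (fun n => continuous_conjPerm α (H n)) hzero hS MeasurableSet.univ
      (B := fun _ => Set.univ) (fun _ => MeasurableSet.univ) (by simp)
      (fun n => by rw [Measure.restrict_univ]; exact measurePreserving_conjPerm α (H n))
    rwa [Measure.restrict_univ] at this
  refine ⟨T, ⟨⟨⟨G, hGS⟩, ⟨G', hGS'⟩, hmp⟩, fun k η hη => ?_⟩, hGS.continuous, hS⟩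
  obtain ⟨n, hn, hnk⟩ := ((hzero.eventually_le_const hη).and (eventually_ge_atTop k)).exists
  refine ⟨conjPerm α (H n), ⟨evalWord (H n), evalWord_mem_diffTorus _, rfl⟩,
    ⟨G, _, hGS, isSmoothLift_conjLift α (H n), fun j hj p => (hG n j (hj.trans hnk) p).trans hn⟩,
    ⟨G', _, hGS', ?_, fun j hj p => (hG' n j (hj.trans hnk) p).trans hn⟩⟩
  rw [conjPerm_symm]
  exact isSmoothLift_conjLift (-α) (H n)

end LimitMap

section LimitSet

/-- The points that belong to all but finitely many of the sets. -/
def liminfSet {X : Type*} (A : ℕ → Set X) : Set X := ⋃ n, ⋂ m ≥ n, A m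

variable {X : Type*}

lemma measurableSet_liminfSet [MeasurableSpace X] {A : ℕ → Set X} (hA : ∀ n, MeasurableSet (A n)) :
    MeasurableSet (liminfSet A) :=
  MeasurableSet.iUnion fun _ => MeasurableSet.iInter fun m => MeasurableSet.iInter fun _ => hA m

lemma disjoint_liminfSet {A B : ℕ → Set X} (h : ∀ n, Disjoint (A n) (B n)) :
    Disjoint (liminfSet A) (liminfSet B) := by
  rw [Set.disjoint_left]
  intro x hA hB
  simp only [liminfSet, Set.mem_iUnion, Set.mem_iInter] at hA hB
  obtain ⟨n, hn⟩ := hA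
  obtain ⟨m, hm⟩ := hB
  exact Set.disjoint_left.mp (h (max n m)) (hn _ (le_max_left _ _)) (hm _ (le_max_right _ _))

lemma symmDiff_liminfSet_subset (A : ℕ → Set X) (n : ℕ) :
    symmDiff (liminfSet A) (A n) ⊆ ⋃ m, symmDiff (A (n + m + 1)) (A (n + m)) := by
  intro x hx
  by_contra hcon
  have hstep : ∀ m, x ∈ A (n + m + 1) ↔ x ∈ A (n + m) := fun m => by
    by_contra h
    refine hcon (Set.mem_iUnion.mpr ⟨m, ?_⟩)
    rw [Set.mem_symmDiff]
    tauto
  have hall : ∀ m, x ∈ A (n + m) ↔ x ∈ A n := fun m => by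
    induction m with
    | zero => rfl
    | succ m ih => rw [← add_assoc, hstep, ih]
  have hlim : x ∈ liminfSet A ↔ x ∈ A n := by
    simp only [liminfSet, Set.mem_iUnion, Set.mem_iInter]
    constructor
    · rintro ⟨k, hk⟩
      exact (hall k).mp (hk (n + k) (by omega))
    · intro h
      refine ⟨n, fun m hm => ?_⟩
      obtain ⟨l, rfl⟩ := Nat.exists_eq_add_of_le hm
      exact (hall l).mpr h
  rw [Set.mem_symmDiff] at hx
  tauto

lemma measureReal_symmDiff_liminfSet_le [MeasurableSpace X] {μ : Measure X} {A : ℕ → Set X}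
    {ε : ℕ → ℝ} (hε0 : ∀ n, 0 ≤ ε n) (hε : ∀ n, ε (n + 1) ≤ ε n / 2)
    (h : ∀ n, μ (symmDiff (A (n + 1)) (A n)) ≤ ENNReal.ofReal (ε n)) (n : ℕ) :
    μ.real (symmDiff (liminfSet A) (A n)) ≤ 2 * ε n := by
  have hs := hasSum_geometric_two' (2 * ε n)
  refine ENNReal.toReal_le_of_le_ofReal (by linarith [hε0 n]) ?_
  rw [← hs.tsum_eq, ENNReal.ofReal_tsum_of_nonneg
      (fun m => by have := hε0 n; positivity) hs.summable]
  refine (measure_mono (symmDiff_liminfSet_subset A n)).trans ((measure_iUnion_le _).trans ?_)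
  refine ENNReal.tsum_le_tsum fun m => (h _).trans (ENNReal.ofReal_le_ofReal ?_)
  rw [mul_div_cancel_left₀ _ two_ne_zero]
  exact le_div_two_pow hε n m

end LimitSet

/-! ### Approximation by a countable family, and weak mixing -/

section DenseFamily

/-- Every continuous function is uniformly close to a multiple of a member of the family. -/
def SpansDensely (f : ℕ → Torus2 → ℝ) : Prop :=
  ∀ g : Torus2 → ℝ, Continuous g → ∀ ε > 0, ∃ (i : ℕ) (c : ℝ), ∀ x, |g x - c * f i x| ≤ ε

lemma exists_spansDensely : ∃ f : ℕ → Torus2 → ℝ, (∀ i, Continuous (f i)) ∧ (∀ i x, |f i x| ≤ 1) ∧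
    SpansDensely f := by
  set d : ℕ → C(Torus2, ℝ) := TopologicalSpace.denseSeq C(Torus2, ℝ)
  have hpos : ∀ i, 0 < 1 + ‖d i‖ := fun i => by positivity
  refine ⟨fun i x => (1 + ‖d i‖)⁻¹ * d i x, fun i => continuous_const.mul (d i).continuous,
    fun i x => ?_, fun g hg ε hε => ?_⟩
  · rw [abs_mul, abs_of_pos (inv_pos.mpr (hpos i)), inv_mul_le_iff₀ (hpos i), mul_one]
    have := (d i).norm_coe_le_norm x
    rw [Real.norm_eq_abs] at this
    linarith
  · obtain ⟨i, hi⟩ := (TopologicalSpace.denseRange_denseSeq C(Torus2, ℝ)).exists_dist_lt ⟨g, hg⟩ hε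
    refine ⟨i, 1 + ‖d i‖, fun x => ?_⟩
    rw [mul_inv_cancel_left₀ (hpos i).ne']
    exact ((ContinuousMap.dist_le hε.le).mp hi.le x)

lemma SpansDensely.exists_integral_sub_le {f : ℕ → Torus2 → ℝ} (hf : SpansDensely f)
    {ν : Measure Torus2} [IsProbabilityMeasure ν] (hfc : ∀ i, Continuous (f i))
    (hf1 : ∀ i x, |f i x| ≤ 1) {u : Torus2 → ℝ} (hu : Integrable u ν)
    {ε : ℝ} (hε : 0 < ε) : ∃ (i : ℕ) (c : ℝ), ∫ x, |u x - c * f i x| ∂ν ≤ ε := by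
  obtain ⟨g, hg, hgi⟩ := hu.exists_boundedContinuous_integral_sub_le (half_pos hε)
  obtain ⟨i, c, hic⟩ := hf g g.continuous (ε / 2) (half_pos hε)
  have hfi : Integrable (fun x => c * f i x) ν :=
    (integrable_of_measurable_of_abs_le (hfc i).measurable (hf1 i)).const_mul c
  have hug : Integrable (fun x => ‖u x - g x‖) ν := (hu.sub hgi).norm
  refine ⟨i, c, ?_⟩
  calc ∫ x, |u x - c * f i x| ∂ν ≤ ∫ x, (‖u x - g x‖ + ε / 2) ∂ν := by
        refine integral_mono (hu.sub hfi).abs (hug.add (integrable_const _)) fun x => ?_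
        rw [Real.norm_eq_abs]
        exact (abs_sub_le _ _ _).trans (add_le_add le_rfl (hic x))
    _ ≤ ε := by
        rw [integral_add hug (integrable_const _), integral_const, probReal_univ,
          one_smul]
        linarith

end DenseFamily

section WeakMixing

/-- Correlations depend continuously on the functions, in the `L¹` distance. -/
lemma abs_integral_mul_comp_sub_le {X : Type*} [MeasurableSpace X] {ν : Measure X}
    [IsProbabilityMeasure ν] {S : X → X} (hS : MeasurePreserving S ν ν) {u v u' v' : X → ℝ}
    (hu : Measurable u) (hv : Measurable v) (hu' : Measurable u') (hv' : Measurable v') {C C' : ℝ}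
    (huC : ∀ x, |u x| ≤ 1) (hvC : ∀ x, |v x| ≤ 1) (huC' : ∀ x, |u' x| ≤ C)
    (hvC' : ∀ x, |v' x| ≤ C') :
    |(∫ x, u x * v (S x) ∂ν) - ∫ x, u' x * v' (S x) ∂ν| ≤
      (∫ x, |u x - u' x| ∂ν) + C * ∫ x, |v x - v' x| ∂ν := by
  have iu := integrable_of_measurable_of_abs_le (μ := ν) hu huC
  have iv := integrable_of_measurable_of_abs_le (μ := ν) hv hvC
  have iu' := integrable_of_measurable_of_abs_le (μ := ν) hu' huC'
  have iv' := integrable_of_measurable_of_abs_le (μ := ν) hv' hvC'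
  have hC0 : ∀ x : X, 0 ≤ C := fun x => (abs_nonneg _).trans (huC' x)
  have i1 : Integrable (fun x => u x * v (S x)) ν :=
    integrable_of_measurable_of_abs_le (hu.mul (hv.comp hS.measurable)) (C := 1) fun x => by
      rw [abs_mul]; exact mul_le_one₀ (huC _) (abs_nonneg _) (hvC _)
  have i2 : Integrable (fun x => u' x * v' (S x)) ν :=
    integrable_of_measurable_of_abs_le (hu'.mul (hv'.comp hS.measurable)) (C := C * C') fun x => by
      rw [abs_mul]; exact mul_le_mul (huC' _) (hvC' _) (abs_nonneg _) (hC0 x)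
  have i0 : Integrable (fun x => |u x - u' x|) ν := (iu.sub iu').abs
  have i3 : Integrable (fun x => |v (S x) - v' (S x)|) ν :=
    (hS.integrable_comp_of_integrable (iv.sub iv')).abs
  have e : ∫ x, |v x - v' x| ∂ν = ∫ x, |v (S x) - v' (S x)| ∂ν := by
    conv_lhs => rw [← hS.map_eq]
    rw [integral_map hS.measurable.aemeasurable]
    exact (hv.sub hv').abs.aestronglyMeasurable
  rw [← integral_sub i1 i2, e, ← integral_const_mul,
    ← integral_add i0 (i3.const_mul C), ← Real.norm_eq_abs]
  refine (norm_integral_le_integral_norm _).trans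
    (integral_mono (i1.sub i2).norm (i0.add (i3.const_mul C)) fun x => ?_)
  show |u x * v (S x) - u' x * v' (S x)| ≤ |u x - u' x| + C * |v (S x) - v' (S x)|
  have e2 : u x * v (S x) - u' x * v' (S x) =
      (u x - u' x) * v (S x) + u' x * (v (S x) - v' (S x)) := by ring
  rw [e2]
  refine (abs_add_le _ _).trans (add_le_add ?_ ?_)
  · rw [abs_mul]
    exact mul_le_of_le_one_right (abs_nonneg _) (hvC _)
  · rw [abs_mul]
    exact mul_le_mul_of_nonneg_right (huC' x) (abs_nonneg _)

/-- A map is weakly mixing if the correlations of a family of continuous functions with dense span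
decay along a sequence of times. -/
lemma isWeaklyMixing_of_correlations {f : ℕ → Torus2 → ℝ} (hf : SpansDensely f)
    (hfc : ∀ i, Continuous (f i)) (hf1 : ∀ i x, |f i x| ≤ 1) {ν : Measure Torus2}
    [IsProbabilityMeasure ν] {T : Torus2 → Torus2} (hT : MeasurePreserving T ν ν) {m : ℕ → ℕ}
    (hm : Tendsto m atTop atTop)
    (h : ∀ i j, Tendsto (fun k => ∫ x, f i x * f j (T^[m k] x) ∂ν) atTop
      (𝓝 ((∫ x, f i x ∂ν) * ∫ x, f j x ∂ν))) : IsWeaklyMixing T ν := by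
  refine ⟨inferInstance, hT, m, hm, fun A B hA hB => ?_⟩
  set u : Torus2 → ℝ := B.indicator 1 with hu
  set v : Torus2 → ℝ := A.indicator 1 with hv
  have hum : Measurable u := measurable_one.indicator hB
  have hvm : Measurable v := measurable_one.indicator hA
  have hind : ∀ (D : Set Torus2) (x : Torus2), |D.indicator (1 : Torus2 → ℝ) x| ≤ 1 := fun D x => by
    by_cases hx : x ∈ D <;> simp [hx]
  have hmain : Tendsto (fun k => ∫ x, u x * v (T^[m k] x) ∂ν) atTop
      (𝓝 ((∫ x, u x ∂ν) * ∫ x, v x ∂ν)) := by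
    rw [Metric.tendsto_nhds]
    intro ε hε
    have hε5 : 0 < ε / 5 := by positivity
    obtain ⟨i, c, hc⟩ := hf.exists_integral_sub_le hfc hf1
      (integrable_of_measurable_of_abs_le (μ := ν) hum (hind B)) hε5
    have hc0 : 0 < |c| + 1 := by positivity
    obtain ⟨j, c', hc'⟩ := hf.exists_integral_sub_le hfc hf1
      (integrable_of_measurable_of_abs_le (μ := ν) hvm (hind A)) (div_pos hε5 hc0)
    have hb : ∀ (c : ℝ) i x, |c * f i x| ≤ |c| := fun c i x => by
      rw [abs_mul]; exact mul_le_of_le_one_right (abs_nonneg _) (hf1 i x)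
    have hbound : (∫ x, |u x - c * f i x| ∂ν) + |c| * ∫ x, |v x - c' * f j x| ∂ν ≤
        ε / 5 + ε / 5 := by
      refine add_le_add hc ((mul_le_mul_of_nonneg_left hc' (abs_nonneg c)).trans ?_)
      rw [mul_div_assoc', div_le_iff₀ hc0]
      nlinarith [abs_nonneg c]
    have hlim := ((h i j).const_mul (c * c')).sub_const
      (c * c' * ((∫ x, f i x ∂ν) * ∫ x, f j x ∂ν))
    rw [sub_self] at hlim
    filter_upwards [(Metric.tendsto_nhds.mp hlim) (ε / 5) hε5] with k hk
    rw [dist_zero_right, Real.norm_eq_abs] at hk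
    have h1 := abs_integral_mul_comp_sub_le (hT.iterate (m k)) hum hvm
      ((hfc i).measurable.const_mul c) ((hfc j).measurable.const_mul c') (hind B) (hind A)
      (hb c i) (hb c' j)
    have e1 : ∫ x, c * f i x * (c' * f j (T^[m k] x)) ∂ν =
        c * c' * ∫ x, f i x * f j (T^[m k] x) ∂ν := by
      rw [← integral_const_mul]; congr 1; funext x; ring
    rw [e1] at h1
    -- the product of the integrals is compared in the same way
    have iu := integrable_of_measurable_of_abs_le (μ := ν) hum (hind B)
    have iv := integrable_of_measurable_of_abs_le (μ := ν) hvm (hind A)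
    have ifc : ∀ i (c : ℝ), Integrable (fun x => c * f i x) ν := fun i c =>
      integrable_of_measurable_of_abs_le ((hfc i).measurable.const_mul c) (hb c i)
    have d1 : |(∫ x, u x ∂ν) - c * ∫ x, f i x ∂ν| ≤ ∫ x, |u x - c * f i x| ∂ν := by
      rw [← integral_const_mul, ← integral_sub iu (ifc i c)]
      exact abs_integral_le_integral_abs
    have d2 : |(∫ x, v x ∂ν) - c' * ∫ x, f j x ∂ν| ≤ ∫ x, |v x - c' * f j x| ∂ν := by
      rw [← integral_const_mul, ← integral_sub iv (ifc j c')]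
      exact abs_integral_le_integral_abs
    have hprob : ∀ {w : Torus2 → ℝ}, (∀ x, |w x| ≤ 1) → |∫ x, w x ∂ν| ≤ 1 := fun hw => by
      have := norm_integral_le_of_norm_le_const (μ := ν) (Eventually.of_forall
        fun x => (Real.norm_eq_abs _).le.trans (hw x))
      simpa using this
    have h2 : |(∫ x, u x ∂ν) * (∫ x, v x ∂ν) -
        c * c' * ((∫ x, f i x ∂ν) * ∫ x, f j x ∂ν)| ≤ ε / 5 + ε / 5 := by
      refine le_trans ?_ hbound
      have e2 : (∫ x, u x ∂ν) * (∫ x, v x ∂ν) - c * c' * ((∫ x, f i x ∂ν) * ∫ x, f j x ∂ν) =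
          ((∫ x, u x ∂ν) - c * ∫ x, f i x ∂ν) * (∫ x, v x ∂ν) +
            (c * ∫ x, f i x ∂ν) * ((∫ x, v x ∂ν) - c' * ∫ x, f j x ∂ν) := by ring
      rw [e2]
      refine (abs_add_le _ _).trans (add_le_add ?_ ?_)
      · rw [abs_mul]
        exact (mul_le_of_le_one_right (abs_nonneg _) (hprob (hind A))).trans d1
      · rw [abs_mul, abs_mul]
        exact mul_le_mul (mul_le_of_le_one_right (abs_nonneg _) (hprob (hf1 i))) d2 (abs_nonneg _)
          (abs_nonneg _)
    rw [Real.dist_eq]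
    rw [abs_le] at h1 h2
    rw [abs_lt] at hk ⊢
    constructor <;> linarith [h1.1, h1.2, h2.1, h2.2, hk.1, hk.2, hbound]
  have e3 : ∀ k, ∫ x, u x * v (T^[m k] x) ∂ν = ν.real (B ∩ T^[m k] ⁻¹' A) := fun k => by
    rw [← integral_indicator_one (hB.inter ((hT.iterate (m k)).measurable hA))]
    congr 1
    funext x
    by_cases h1 : x ∈ B <;> by_cases h2 : T^[m k] x ∈ A <;> simp [hu, hv, h1, h2]
  simp only [e3] at hmain
  rw [hu, hv, integral_indicator_one hB, integral_indicator_one hA] at hmain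
  rw [← ENNReal.tendsto_toReal_iff (fun _ => measure_ne_top _ _)
    (ENNReal.mul_ne_top (measure_ne_top _ _) (measure_ne_top _ _)), ENNReal.toReal_mul]
  exact hmain

end WeakMixing

/-! ### The limit of the construction -/

section Limit

variable {α : ℝ} {r : ℕ} {f : ℕ → Torus2 → ℝ} {len : ℕ → List Shear → ℕ} {s : ℕ → Stage}

lemma exists_stages (hα : Liouville α) (r : ℕ) [NeZero r] (hf : ∀ i, Continuous (f i))
    (hf1 : ∀ i x, |f i x| ≤ 1) : ∃ (len : ℕ → List Shear → ℕ) (s : ℕ → Stage),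
      (∀ n H, n ≤ len n H) ∧ (∀ n, 0 < (s n).tol) ∧
      ∀ n, IsStep α r f len n (s n) (s (n + 1)) := by
  obtain ⟨q, p, hqp⟩ := hα.exists_fastApprox
  obtain ⟨len, hlen1, hlen2⟩ := exists_len hα.irrational hqp hf
  choose g hg1 hg2 using exists_step hα.irrational hqp r hf hf1 hlen2
  obtain ⟨b, -, hb⟩ := exists_equalized (r := r) hf hf1 0 []
    (show 0 < (((0 : ℕ) : ℝ) + 1)⁻¹ by positivity)
  let s : (n : ℕ) → {s : Stage // s.IsGood r f n} :=
    fun n => Nat.rec ⟨⟨_, 0, 1⟩, ⟨one_pos, hb⟩⟩ (fun n s => ⟨g n s.1 s.2, hg1 n s.1 s.2⟩) n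
  exact ⟨len, fun n => (s n).1, hlen1, fun n => (s n).2.tol_pos, fun n => hg2 n (s n).1 (s n).2⟩

lemma tendsto_tol (hpos : ∀ n, 0 < (s n).tol) (hs : ∀ n, IsStep α r f len n (s n) (s (n + 1))) :
    Tendsto (fun n => (s n).tol) atTop (𝓝 0) :=
  tendsto_zero_of_halving (fun n => (hpos n).le) fun n => (hs n).tol_le

lemma isMinimalMap_of_stages (hpos : ∀ n, 0 < (s n).tol)
    (hs : ∀ n, IsStep α r f len n (s n) (s (n + 1))) {T : Torus2 → Torus2}
    (hT : ∀ n x, dist (T x) (conjPerm α (s n).word x) ≤ (s n).tol) : IsMinimalMap T := by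
  intro x
  rw [Metric.dense_iff]
  intro w ε hε
  obtain ⟨M, hM⟩ := eventually_atTop.mp ((tendsto_tol hpos hs).eventually_lt_const (half_pos hε))
  obtain ⟨K, hK⟩ := (hs (3 * M + 1)).dense (by omega)
  obtain ⟨k, -, hk⟩ := hK T (hT _) x w
  refine ⟨T^[k] x, ?_, k, rfl⟩
  rw [Metric.mem_ball]
  linarith [hM (3 * M + 1) (by omega)]

/-- The deviations decrease up to a summable error, and every third step halves them. -/
lemma tendsto_deviation (hpos : ∀ n, 0 < (s n).tol)
    (hs : ∀ n, IsStep α r f len n (s n) (s (n + 1))) (i : ℕ) :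
    Tendsto (fun n => deviation (s n).word (f i)) atTop (𝓝 0) := by
  set a : ℕ → ℝ := fun n => deviation (s (n + i)).word (f i) + 4 * (s (n + i)).tol with ha
  have hanti : Antitone a := antitone_nat_of_succ_le fun n => by
    have h1 := (hs (n + i)).deviation_le i (by omega)
    have h2 := (hs (n + i)).tol_le
    simp only [ha]
    rw [add_right_comm n 1 i]
    linarith
  have ha0 : ∀ n, 0 ≤ a n := fun n => by
    have h1 := deviation_nonneg (s (n + i)).word (f i)
    have h2 := hpos (n + i)
    simp only [ha]
    linarith
  have hlim : Tendsto a atTop (𝓝 (⨅ n, a n)) :=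
    tendsto_atTop_ciInf hanti ⟨0, by rintro _ ⟨n, rfl⟩; exact ha0 n⟩
  set l := ⨅ n, a n
  have htol : Tendsto (fun n => (s (n + i)).tol) atTop (𝓝 0) :=
    (tendsto_add_atTop_iff_nat i).mpr (tendsto_tol hpos hs)
  have hdev : Tendsto (fun n => deviation (s (n + i)).word (f i)) atTop (𝓝 l) := by
    have := hlim.sub (htol.const_mul 4)
    simpa [ha] using this
  have hl0 : 0 ≤ l := ge_of_tendsto' hdev fun n => deviation_nonneg _ _
  have hl : l ≤ l / 2 := by
    have hsub : Tendsto (fun k : ℕ => 3 * k + 2 * i) atTop atTop :=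
      tendsto_atTop_mono (fun k => by omega : ∀ k : ℕ, k ≤ 3 * k + 2 * i) tendsto_id
    have l1 := (hdev.comp ((tendsto_add_atTop_nat 1).comp hsub))
    have l2 := ((hdev.div_const 2).add (htol.const_mul 2)).comp hsub
    rw [mul_zero, add_zero] at l2
    refine le_of_tendsto_of_tendsto' l1 l2 fun k => ?_
    have h1 := (hs (3 * k + 2 * i + i)).halving (by omega) i (by omega)
    simp only [Function.comp_apply]
    rw [add_right_comm _ 1 i]
    exact h1
  have hl' : l = 0 := by linarith
  rw [hl'] at hdev
  exact (tendsto_add_atTop_iff_nat i).mp hdev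

/-- The limit of the base points is generic: the lengths controlled at stage `n` reach up to those
controlled at stage `n + 1`, so that all long averages are covered. -/
lemma isGenericMeasure_of_stages (hf : ∀ i, Continuous (f i)) (hspan : SpansDensely f)
    (hlen : ∀ n H, n ≤ len n H) (hpos : ∀ n, 0 < (s n).tol)
    (hs : ∀ n, IsStep α r f len n (s n) (s (n + 1))) {T : Torus2 → Torus2}
    (hT : ∀ n x, dist (T x) (conjPerm α (s n).word x) ≤ (s n).tol) :
    IsGenericMeasure T (volume : Measure Torus2) := by
  obtain ⟨a, ha⟩ := exists_limit_point (x := fun n => (s n).point) (fun n => (hs n).tol_le)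
    (fun n => (hs n).point)
  have hgen : ∀ i, Tendsto (fun N => birkhoffAverage ℝ T (f i) N a) atTop (𝓝 (∫ x, f i x)) := by
    intro i
    have hc : Tendsto (fun n : ℕ => deviation (s n).word (f i) + 2 * (s n).tol + ((n : ℝ) + 1)⁻¹)
        atTop (𝓝 0) := by
      have h1 := ((tendsto_deviation hpos hs i).add ((tendsto_tol hpos hs).const_mul 2)).add
        (tendsto_one_div_add_atTop_nhds_zero_nat (𝕜 := ℝ))
      simpa using h1
    rw [Metric.tendsto_atTop]
    intro ε hε
    obtain ⟨M₀, hM₀⟩ := eventually_atTop.mp (hc.eventually_lt_const hε)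
    set M := max M₀ i with hM
    refine ⟨len M (s M).word, fun N hN => ?_⟩
    -- the first stage `n ≥ M` whose window of lengths reaches up to `N`
    have hex : ∃ n, M ≤ n ∧ N ≤ len (n + 1) (s (n + 1)).word :=
      ⟨max M N, le_max_left _ _, ((le_max_right M N).trans (Nat.le_succ _)).trans (hlen _ _)⟩
    classical
    obtain ⟨hn1, hn2⟩ := Nat.find_spec hex
    set n := Nat.find hex with hn
    have hn3 : len n (s n).word ≤ N := by
      rcases hn1.eq_or_lt with h | h
      · rw [← h]; exact hN
      · by_contra! hcon
        have := Nat.find_min hex (m := n - 1) (by omega)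
        rw [Nat.sub_add_cancel (by omega)] at this
        exact this ⟨by omega, hcon.le⟩
    rw [Real.dist_eq]
    have hiM : i ≤ n := (le_max_right _ _).trans hn1
    exact lt_of_le_of_lt ((hs n).average T (hT _) a (ha _) i hiM N hn3 hn2)
      (hM₀ n ((le_max_left _ _).trans hn1))
  refine ⟨a, fun φ hφ _ => ?_⟩
  rw [Metric.tendsto_nhds]
  intro ε hε
  have hε4 : 0 < ε / 4 := by positivity
  obtain ⟨i, c, hic⟩ := hspan φ hφ (ε / 4) hε4
  have hlim := ((hgen i).const_mul c).sub_const (c * ∫ x, f i x)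
  rw [sub_self] at hlim
  filter_upwards [(Metric.tendsto_nhds.mp hlim) (ε / 4) hε4, eventually_ge_atTop 1] with N hN hN1
  rw [dist_zero_right, Real.norm_eq_abs] at hN
  have h1 : |birkhoffAverage ℝ T φ N a - c * birkhoffAverage ℝ T (f i) N a| ≤ ε / 4 := by
    have e : birkhoffAverage ℝ T φ N a - c * birkhoffAverage ℝ T (f i) N a =
        ∑ k ∈ Finset.range N, (N : ℝ)⁻¹ * (φ (T^[k] a) - c * f i (T^[k] a)) := by
      simp only [birkhoffAverage, birkhoffSum, smul_eq_mul, Finset.mul_sum, mul_sub,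
        Finset.sum_sub_distrib, mul_left_comm c]
    rw [e]
    exact abs_inv_mul_sum_le hN1 fun k _ => hic _
  obtain ⟨C, -, hC⟩ := exists_abs_le_torus hφ
  obtain ⟨C', -, hC'⟩ := exists_abs_le_torus (hf i)
  have i1 := integrable_of_measurable_of_abs_le (μ := (volume : Measure Torus2)) hφ.measurable hC
  have i2 := (integrable_of_measurable_of_abs_le (μ := (volume : Measure Torus2))
    (hf i).measurable hC').const_mul c
  have h2 : |(∫ x, φ x) - c * ∫ x, f i x| ≤ ε / 4 := by
    rw [← integral_const_mul]
    have := abs_integral_sub_integral_le (B := ∅) i1 i2 hε4.le (fun x _ => hic x) hic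
    simpa using this
  rw [Real.dist_eq]
  rw [abs_le] at h1 h2
  rw [abs_lt] at hN ⊢
  constructor <;> linarith [h1.1, h1.2, h2.1, h2.2, hN.1, hN.2]

/-- The limit of the images of a strip. -/
def limitStrip (s : ℕ → Stage) (t : ZMod r) : Set Torus2 :=
  liminfSet fun n => stripImage (s n).word t

lemma measurableSet_limitStrip (s : ℕ → Stage) (t : ZMod r) : MeasurableSet (limitStrip s t) :=
  measurableSet_liminfSet fun _ => measurableSet_stripImage _ t

lemma measureReal_symmDiff_limitStrip_le (hpos : ∀ n, 0 < (s n).tol)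
    (hs : ∀ n, IsStep α r f len n (s n) (s (n + 1))) (t : ZMod r) (n : ℕ) :
    volume.real (symmDiff (limitStrip s t) (stripImage (s n).word t)) ≤ 2 * (s n).tol :=
  measureReal_symmDiff_liminfSet_le (fun n => (hpos n).le) (fun n => (hs n).tol_le)
    (fun n => (hs n).strip t) n

lemma volume_limitStrip [NeZero r] (hpos : ∀ n, 0 < (s n).tol)
    (hs : ∀ n, IsStep α r f len n (s n) (s (n + 1))) (t : ZMod r) :
    volume (limitStrip s t) = (r : ENNReal)⁻¹ := by
  have hreal : volume.real (limitStrip s t) = (r : ℝ)⁻¹ := by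
    have h : ∀ n, |volume.real (limitStrip s t) - (r : ℝ)⁻¹| ≤ 2 * (s n).tol := fun n => by
      have e : volume.real (stripImage (s n).word t) = (r : ℝ)⁻¹ := by
        rw [Measure.real, volume_stripImage]; simp
      have h1 := abs_setIntegral_sub_setIntegral_le (g := fun _ => 1) measurable_const (C := 1)
        (fun _ => by simp) (measurableSet_limitStrip s t) (measurableSet_stripImage (s n).word t)
      rw [setIntegral_const, setIntegral_const, e] at h1
      simp only [smul_eq_mul, mul_one, one_mul] at h1
      exact h1.trans (measureReal_symmDiff_limitStrip_le hpos hs t n)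
    have h2 : |volume.real (limitStrip s t) - (r : ℝ)⁻¹| ≤ 0 :=
      ge_of_tendsto' (by simpa using (tendsto_tol hpos hs).const_mul 2) h
    rw [← sub_eq_zero]
    exact abs_eq_zero.mp (le_antisymm h2 (abs_nonneg _))
  have hr : (r : ENNReal) ≠ 0 := by exact_mod_cast NeZero.ne r
  rw [← ENNReal.toReal_eq_toReal_iff' (measure_ne_top _ _) (ENNReal.inv_ne_top.mpr hr)]
  rw [ENNReal.toReal_inv, ENNReal.toReal_natCast]
  exact hreal

lemma disjoint_limitStrip (s : ℕ → Stage) {t t' : ZMod r} (h : t ≠ t') :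
    Disjoint (limitStrip s t) (limitStrip s t') :=
  disjoint_liminfSet fun _ => disjoint_stripImage _ h

lemma measurePreserving_conjPerm_stripImage (α : ℝ) (H : List Shear) (t : ZMod r) :
    MeasurePreserving (conjPerm α H) (volume.restrict (stripImage H t))
      (volume.restrict (stripImage H t)) := by
  have h := (measurePreserving_conjPerm α H).restrict_preimage (measurableSet_stripImage H t)
  have e : conjPerm α H ⁻¹' stripImage H t = stripImage H t := by
    ext x
    obtain ⟨y, rfl⟩ := (evalWord H).surjective x
    rw [Set.mem_preimage, conjPerm_evalWord, stripImage, (evalWord H).injective.mem_set_image,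
      (evalWord H).injective.mem_set_image]
    simp
  rwa [e] at h

lemma measurePreserving_limitStrip (hpos : ∀ n, 0 < (s n).tol)
    (hs : ∀ n, IsStep α r f len n (s n) (s (n + 1))) {T : Torus2 → Torus2} (hTc : Continuous T)
    (hT : ∀ n x, dist (T x) (conjPerm α (s n).word x) ≤ (s n).tol) (t : ZMod r) :
    MeasurePreserving T (volume.restrict (limitStrip s t)) (volume.restrict (limitStrip s t)) :=
  measurePreserving_restrict_of_tendsto hTc (fun _ => continuous_conjPerm α _)
    (tendsto_tol hpos hs) hT (measurableSet_limitStrip s t)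
    (fun _ => measurableSet_stripImage _ t)
    (squeeze_zero (fun _ => measureReal_nonneg)
      (fun n => measureReal_symmDiff_limitStrip_le hpos hs t n)
      (by simpa using (tendsto_tol hpos hs).const_mul 2))
    fun _ => measurePreserving_conjPerm_stripImage α _ t

/-- The mixing times of the stages `3 k + 2` form a mixing sequence for the limit. -/
lemma isWeaklyMixing_of_stages [NeZero r] (hf : ∀ i, Continuous (f i)) (hf1 : ∀ i x, |f i x| ≤ 1)
    (hspan : SpansDensely f) (hpos : ∀ n, 0 < (s n).tol)
    (hs : ∀ n, IsStep α r f len n (s n) (s (n + 1))) {T : Torus2 → Torus2} (hTc : Continuous T)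
    (hT : ∀ n x, dist (T x) (conjPerm α (s n).word x) ≤ (s n).tol) (t : ZMod r) :
    IsWeaklyMixing T (ProbabilityTheory.cond volume (limitStrip s t)) := by
  have hr0 : (r : ℝ) ≠ 0 := by exact_mod_cast NeZero.ne r
  have hvol := volume_limitStrip hpos hs t
  set E := limitStrip s t with hE
  have hE0 : volume E ≠ 0 := by rw [hvol]; simp
  have : IsProbabilityMeasure (ProbabilityTheory.cond volume E) :=
    ProbabilityTheory.cond_isProbabilityMeasure hE0
  have hint :
      ∀ g : Torus2 → ℝ, ∫ x, g x ∂(ProbabilityTheory.cond volume E) = r * ∫ x in E, g x := by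
    intro g
    rw [ProbabilityTheory.cond, integral_smul_measure, hvol, inv_inv, ENNReal.toReal_natCast,
      smul_eq_mul]
  choose m hmn hm using fun k : ℕ => (hs (3 * k + 2)).mixing (by omega)
  have hmt : Tendsto m atTop atTop :=
    tendsto_atTop_mono (fun k => by have := hmn k; omega : ∀ k : ℕ, k ≤ m k) tendsto_id
  refine isWeaklyMixing_of_correlations hspan hf hf1 ?_ hmt fun i j => ?_
  · exact (measurePreserving_limitStrip hpos hs hTc hT t).smul_measure _
  simp only [hint]
  have hsub : Tendsto (fun k : ℕ => 3 * k + 2) atTop atTop :=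
    tendsto_atTop_mono (fun k => by omega : ∀ k : ℕ, k ≤ 3 * k + 2) tendsto_id
  have htol := (tendsto_tol hpos hs).comp hsub
  have htol' := (tendsto_tol hpos hs).comp ((tendsto_add_atTop_nat 1).comp hsub)
  have hinv := (tendsto_one_div_add_atTop_nhds_zero_nat (𝕜 := ℝ)).comp hsub
  have hbound : Tendsto (fun k : ℕ => 2 * (s (3 * k + 2 + 1)).tol + (2 * (s (3 * k + 2)).tol +
      2 * r * (((3 * k + 2 : ℕ) : ℝ) + 1)⁻¹) + r * (2 * (s (3 * k + 2)).tol +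
        2 * (s (3 * k + 2)).tol)) atTop (𝓝 0) := by
    have := ((htol'.const_mul 2).add ((htol.const_mul 2).add (hinv.const_mul (2 * r : ℝ)))).add
      (((htol.const_mul 2).add (htol.const_mul 2)).const_mul (r : ℝ))
    simpa using this
  have hcorr : Tendsto (fun k => ∫ x in E, f i x * f j (T^[m k] x)) atTop
      (𝓝 (r * ((∫ x in E, f i x) * ∫ x in E, f j x))) := by
    rw [tendsto_iff_dist_tendsto_zero]
    refine squeeze_zero' (Eventually.of_forall fun _ => dist_nonneg) ?_ hbound
    filter_upwards [eventually_ge_atTop (max i j)] with k hk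
    have hi : i ≤ 3 * k + 2 := by have := le_max_left i j; omega
    have hj : j ≤ 3 * k + 2 := by have := le_max_right i j; omega
    have h1 := hm k T hTc (hT _) i hi j hj t
    have h2 := abs_setIntegral_sub_setIntegral_le
      ((hf i).mul ((hf j).comp (hTc.iterate (m k)))).measurable (C := 1)
      (fun x => by
        show |f i x * f j (T^[m k] x)| ≤ 1
        rw [abs_mul]; exact mul_le_one₀ (hf1 _ _) (abs_nonneg _) (hf1 _ _))
      (measurableSet_limitStrip s t) (measurableSet_stripImage (s (3 * k + 2 + 1)).word t)
    rw [one_mul] at h2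
    have h2' := h2.trans (measureReal_symmDiff_limitStrip_le hpos hs t (3 * k + 2 + 1))
    have h3 : ∀ i, |(∫ x in stripImage (s (3 * k + 2)).word t, f i x) - ∫ x in E, f i x| ≤
        2 * (s (3 * k + 2)).tol := fun i => by
      have := abs_setIntegral_sub_setIntegral_le (hf i).measurable (hf1 i)
        (measurableSet_limitStrip s t) (measurableSet_stripImage (s (3 * k + 2)).word t)
      rw [one_mul] at this
      rw [abs_sub_comm]
      exact this.trans (measureReal_symmDiff_limitStrip_le hpos hs t (3 * k + 2))
    have hle1 : ∀ i (A : Set Torus2), |∫ x in A, f i x| ≤ 1 := fun i A =>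
      (abs_setIntegral_le_of_abs_le (hf1 i) A).trans (by rw [one_mul]; exact measureReal_le_one)
    have h4 := mul_le_mul_of_nonneg_left
      (abs_mul_sub_mul_le (hle1 i _) (hle1 j _) (h3 i) (h3 j)) (Nat.cast_nonneg (α := ℝ) r)
    rw [← abs_of_nonneg (Nat.cast_nonneg (α := ℝ) r), ← abs_mul,
      abs_of_nonneg (Nat.cast_nonneg (α := ℝ) r), mul_sub] at h4
    rw [Real.dist_eq]
    have h5 := (abs_sub_le _ _ _).trans (add_le_add h2' h1)
    exact (abs_sub_le _ _ _).trans (add_le_add h5 h4)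
  have e : ∀ a b : ℝ, r * a * (r * b) = r * (r * (a * b)) := fun a b => by ring
  rw [e]
  exact hcorr.const_mul (r : ℝ)

/-- An invariant set of measure strictly between `0` and `1` prevents ergodicity. -/
lemma not_ergodic_of_measurePreserving_restrict {T : Torus2 → Torus2} {E : Set Torus2}
    (hE : MeasurableSet E) (hT : MeasurePreserving T (volume.restrict E) (volume.restrict E))
    (h0 : volume E ≠ 0) (h1 : volume E ≠ 1) : ¬ Ergodic T (volume : Measure Torus2) := by
  intro herg
  have hsub : E ≤ᵐ[volume] T ⁻¹' E := by
    have h2 : (volume.restrict E) (T ⁻¹' E)ᶜ = 0 := by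
      have := hT.measure_preimage hE.compl.nullMeasurableSet
      rw [Set.preimage_compl] at this
      rw [this, Measure.restrict_apply hE.compl, Set.compl_inter_self, measure_empty]
    rw [Measure.restrict_apply (hT.measurable hE).compl] at h2
    rw [ae_le_set, Set.sdiff_eq, Set.inter_comm]
    exact h2
  rcases herg.ae_empty_or_univ_of_ae_le_preimage hE.nullMeasurableSet hsub with h | h
  · exact h0 ((measure_congr h).trans measure_empty)
  · exact h1 ((measure_congr h).trans measure_univ)

end Limit

/-! ### From the stages to the diffeomorphism -/

/-- The construction for a number `R ≥ 2` of strips; a single strip would be all of the torus. -/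
lemma exists_minimal_generic_weaklyMixing {α : ℝ} (hα : Liouville α) {R : ℕ} (hR : 2 ≤ R) :
    ∃ T : Equiv.Perm Torus2, T ∈ anosovKatokSpace α ∧ IsMinimalMap T ∧
      IsGenericMeasure T (volume : Measure Torus2) ∧ ¬ Ergodic T (volume : Measure Torus2) ∧
      ∃ E : ZMod R → Set Torus2, (∀ t, MeasurableSet (E t)) ∧
        (∀ t t', t ≠ t' → Disjoint (E t) (E t')) ∧ (∀ t, volume (E t) = (R : ENNReal)⁻¹) ∧
        ∀ t, IsWeaklyMixing T (ProbabilityTheory.cond volume (E t)) := by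
  have : NeZero R := ⟨by omega⟩
  obtain ⟨f, hf, hf1, hspan⟩ := exists_spansDensely
  obtain ⟨len, s, hlen, hpos, hs⟩ := exists_stages hα R hf hf1
  obtain ⟨T, hTA, hTc, hT⟩ := exists_limit_diffeo (α := α) (H := fun n => (s n).word)
    (fun n => (hpos n).le) (fun n => (hs n).tol_le) (fun n => (hs n).close)
    fun n => (hs n).close_neg
  refine ⟨T, hTA, isMinimalMap_of_stages hpos hs hT,
    isGenericMeasure_of_stages hf hspan hlen hpos hs hT, ?_, limitStrip s,
    measurableSet_limitStrip s, fun t t' h => disjoint_limitStrip s h,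
    volume_limitStrip hpos hs, isWeaklyMixing_of_stages hf hf1 hspan hpos hs hTc hT⟩
  have hvol := volume_limitStrip hpos hs (0 : ZMod R)
  refine not_ergodic_of_measurePreserving_restrict (measurableSet_limitStrip s (0 : ZMod R))
    (measurePreserving_limitStrip hpos hs hTc hT 0) (by rw [hvol]; simp) ?_
  rw [hvol, ne_eq, ENNReal.inv_eq_one]
  have : R ≠ 1 := by omega
  exact_mod_cast this

theorem theoremA (r : ℕ) (α : ℝ) (hα : Liouville α) :
    ∃ T : Equiv.Perm Torus2, T ∈ anosovKatokSpace α ∧ IsMinimalMap T ∧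
      IsGenericMeasure T (volume : Measure Torus2) ∧
      ¬ Ergodic T (volume : Measure Torus2) ∧
      ∃ (E : Fin r → Set Torus2) (μ : Fin r → Measure Torus2),
        (∀ t, MeasurableSet (E t)) ∧
        Pairwise (fun s t => Disjoint (E s) (E t)) ∧
        (∀ t, 0 < volume (E t)) ∧
        (2 ≤ r → ∀ t, volume (E t) = (r : ENNReal)⁻¹) ∧
        ∀ t, μ t = ProbabilityTheory.cond volume (E t) ∧
          μ t ≪ volume ∧ IsWeaklyMixing T (μ t) := by
  -- For `r ≤ 1` two strips are made, since the measure must not be ergodic, and at most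
  -- one of them is used.
  obtain ⟨T, h1, h2, h3, h4, E, hE1, hE2, hE3, hE4⟩ :=
    exists_minimal_generic_weaklyMixing hα (le_max_right r 2)
  have hinj :
      ∀ t t' : Fin r, t ≠ t' → ((t : ℕ) : ZMod (max r 2)) ≠ ((t' : ℕ) : ZMod (max r 2)) := by
    intro t t' h heq
    have hlt : ∀ t : Fin r, (t : ℕ) < max r 2 := fun t => t.2.trans_le (le_max_left _ _)
    have := congrArg ZMod.val heq
    rw [ZMod.val_cast_of_lt (hlt t), ZMod.val_cast_of_lt (hlt t')] at this
    exact h (Fin.ext this)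
  refine ⟨T, h1, h2, h3, h4, fun t => E (t : ℕ), fun t => ProbabilityTheory.cond volume (E (t : ℕ)),
    fun t => hE1 _, fun t t' h => hE2 _ _ (hinj t t' h), fun t => ?_, fun hr t => ?_,
    fun t => ⟨rfl, ProbabilityTheory.cond_absolutelyContinuous, hE4 _⟩⟩
  · rw [hE3]; simp
  · rw [hE3, max_eq_left hr]
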